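/- **Setting.** A *generalized link* $L$ in $\mathbb{R}^3$ is a finite family of disjoint Lipschitz curves, each closed or an arc, in which each endpoint $x$ of an arc is constrained to an affine subspace $M_x$, and all curves must stay where finitely many $C^1$ functions $g_j$ (each with $0$ as a regular value) are $\ge 0$. Its *Gehring thickness* $\mathrm{Thi}(L)$ is the minimal distance between points on different components, and $O(L)=\min_j\min_{x\in L}g_j(x)$. A continuous vector field $\xi$ along $L$ is *compatible* if $\xi_x$ is tangent to $M_x$ at each endpoint $x$. The first variation of length $\delta\mathrm{Len}$ is the continuous linear functional on continuous vector fields along $L$ that equals $\frac{d}{dt}\big|_{0}\mathrm{Len}(L+t\xi)$ for Lipschitz $\xi$ (it is part of the claim that it exists). $L$ is *strongly critical* for (unweighted) Gehring ropelength if there is $\varepsilon>0$ such that every compatible $\xi$ with $\delta_\xi\mathrm{Len}=-1$ satisfies $\min\big(\delta^+_\xi\mathrm{Thi}(L),\,\delta^+_\xi O(L)\big)\le-\varepsilon$, where $\delta^+_\xi F=\frac{d}{dt}\big|_{0^+}F(L+t\xi)$ (these one-sided derivatives are part of the claim, too). **The configuration.** Let $k\ge 0$, $l\ge1$, $m\ge1$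 be integers, $n=k+l$, and $0\le\tau\le\min(l,m)$; put $\tau_1=\tau/n$, $\tau_2=\tau/m$. Use coordinates $(x_1,x_2,z)$ on $\mathbb{R}^3$ and let $P_i$ be the $x_iz$-plane. For $\{i,j\}=\{1,2\}$ and $|u|\le\tau_i$ put $v=\tau_j(1-|u|/\tau_i)$ and $$X_i(u)=u\sqrt{\frac{1-v^2}{1-u^2v^2}},\qquad H_i(u)=\int_0^{|u|}\frac{w}{\sqrt{1-w^2}}\,X_i'(w)\,dw$$ (for $\tau=0$ the arcs degenerate to a point, $X_i(0)=H_i(0)=0$). These are the arcs of the weighted clasp $C(\tau_1,\tau_2)$; here $u$ is the vertical component of the unit tangent, up to sign. * *Innermost curve in $P_1$.* With outward normal $(\sin\theta,\cos\theta)$ in the $(x_1,z)$-plane: for $|\theta|\le\arcsin\tau_1$ it is the point $\big(X_1(\sin\theta),\ \sqrt{1-\tau_1^2}+H_1(\tau_1)-H_1(\sin\theta)\big)$, and for larger $|\theta|$ it is the point $(\sin\theta,\cos\theta)$ of the unit circle about the origin. * *Innermost curve in $P_2$.* With outward normal $(\sin\theta,-\cos\theta)$ in the $(x_2,z)$-plane,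 for $|\theta|\le\arcsin\tau_2$: the point $\big(X_2(\sin\theta),H_2(\sin\theta)\big)$, with tip at the origin. * *$\alpha_1,\dots,\alpha_k$* (closed, in $P_1$): $\alpha_1$ consists of the innermost curve of $P_1$ for $|\theta|\le\pi/2$, two vertical segments of length $m-1$, and a lower unit semicircle about $(0,0,-(m-1))$; $\alpha_{j+1}$ is its outer parallel at distance $j$. * *$\beta_1,\dots,\beta_l$* (arcs in $P_1$): $\beta_{j+1}$ is the outer parallel at distance $k+j$ of the innermost curve of $P_1$ for $|\theta|\le\arcsin(\tau/l)$, continued at both ends by tangent straight segments out and down. * *$\gamma_1,\dots,\gamma_m$* (arcs in $P_2$): $\gamma_{j+1}$ is the outer parallel at distance $j$ of the innermost curve of $P_2$ for $|\theta|\le\arcsin(\tau/m)$, continued at both ends by tangent straight segments out and up. The straight segments of the $\beta$'s end on two planes, at distance $b$ from the origin, with outer unit normals $(\pm\cos\Theta,0,-\sin\Theta)$, $\Theta=\arcsin(\tau/l)$, and those of the $\gamma$'s on two planes at distance $c$ with outer unit normals $(0,\pm\cos\Phi,\sin\Phi)$, $\Phi=\arcsin(\tau/m)$. The endpoints are constrained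 to these planes, and the four half-spaces beyond the planes are the obstacles. This is the generalized link $C_{k,l}^m(\tau)$: a clasp connect-summed with a Hopf link, with $k,l,m$ parallel copies of the components $\alpha,\beta,\gamma$. Call the planes *far enough out* if all straight segments have positive length and all components lie on the inner side of all four planes. **Theorem.** The planes are far enough out whenever $b$ and $c$ are sufficiently large (depending on $k,l,m,\tau$). Whenever they are far enough out, the configuration is a generalized link with Gehring thickness exactly $1$, and it is strongly critical for unweighted Gehring ropelength. -/

import Mathlib

noncomputable section

namespace Ropelength

/-- Euclidean three-space with coordinates `(x₁, x₂, z)`. -/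
abbrev E3 : Type := EuclideanSpace ℝ (Fin 3)

/-! ### Generalized links and Gehring ropelength -/

/-- The data of a generalized link with components indexed by `ι` and obstacles indexed by `κ`.
Component `i` is the curve `curve i` restricted to `[lo i, hi i]`; it is either a closed curve or
an arc whose two endpoints are constrained to the affine subspaces `startM i` and `endM i`
(these are irrelevant for closed components).  Obstacle `j` is the set where `obst j < 0`. -/
structure GenLink (ι κ : Type) where
  lo : ι → ℝ
  hi : ι → ℝ
  curve : ι → ℝ → E3
  closed : ι → Prop
  startM : ι → AffineSubspace ℝ E3
  endM : ι → AffineSubspace ℝ E3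
  obst : κ → E3 → ℝ

namespace GenLink

variable {ι κ : Type}

/-- The parameter interval of component `i`. -/
abbrev dom (L : GenLink ι κ) (i : ι) : Set ℝ := Set.Icc (L.lo i) (L.hi i)

/-- The data form a generalized link: the components are disjoint Lipschitz curves that close up or
satisfy their endpoint constraints, the obstacle functions are `C¹` with `0` as a regular value,
and all components avoid all obstacles. -/
structure IsGeneralizedLink (L : GenLink ι κ) : Prop where
  lo_lt_hi : ∀ i, L.lo i < L.hi i
  lipschitz : ∀ i, ∃ K, LipschitzOnWith K (L.curve i) (L.dom i)
  closes_up : ∀ i, L.closed i → L.curve i (L.lo i) = L.curve i (L.hi i)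
  start_mem : ∀ i, ¬ L.closed i → L.curve i (L.lo i) ∈ L.startM i
  end_mem : ∀ i, ¬ L.closed i → L.curve i (L.hi i) ∈ L.endM i
  disjoint : ∀ i j, i ≠ j → Disjoint (L.curve i '' L.dom i) (L.curve j '' L.dom j)
  obst_contDiff : ∀ j, ContDiff ℝ 1 (L.obst j)
  obst_regular : ∀ j p, L.obst j p = 0 → fderiv ℝ (L.obst j) p ≠ 0
  avoids : ∀ j i, ∀ s ∈ L.dom i, 0 ≤ L.obst j (L.curve i s)

/-- Positions of all points of a (varied) link. -/
abbrev Pos (L : GenLink ι κ) : Type := ∀ i, L.dom i → E3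

/-- Continuous vector fields along the link. -/
abbrev VF (L : GenLink ι κ) : Type := ∀ i, C(L.dom i, E3)

/-- The position of the link itself. -/
def pos (L : GenLink ι κ) : L.Pos := fun i s => L.curve i s

/-- The link moved for time `t` with velocity `ξ`. -/
def move (L : GenLink ι κ) (ξ : L.VF) (t : ℝ) : L.Pos := fun i s => L.curve i s + t • ξ i s

/-- Gehring thickness: the minimal distance between points on different components. -/
def gThi (L : GenLink ι κ) (f : L.Pos) : ℝ :=
  sInf {d : ℝ | ∃ i j, i ≠ j ∧ ∃ (s : L.dom i) (t : L.dom j), d = dist (f i s) (f j t)}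

/-- The minimum of all obstacle functions along the link. -/
def obstMin (L : GenLink ι κ) (f : L.Pos) : ℝ :=
  sInf {d : ℝ | ∃ (j : κ) (i : ι) (s : L.dom i), d = L.obst j (f i s)}

/-- A vector field is compatible with the constraints if it is tangent to the constraint subspace
at each endpoint.  On a closed component the two ends of the parameter interval are the same
point. -/
def Compatible (L : GenLink ι κ) (ξ : L.VF) : Prop :=
  ∀ i,
    (L.closed i → ∀ s t : L.dom i, (s : ℝ) = L.lo i → (t : ℝ) = L.hi i → ξ i s = ξ i t) ∧
    (¬ L.closed i →
      (∀ s : L.dom i, (s : ℝ) = L.lo i → ξ i s ∈ (L.startM i).direction) ∧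
      (∀ s : L.dom i, (s : ℝ) = L.hi i → ξ i s ∈ (L.endM i).direction))

/-- The weighted length `∑ wᵢ Len(fᵢ)` of Lipschitz curves `fᵢ` on the parameter intervals. -/
def wlen [Fintype ι] (L : GenLink ι κ) (w : ι → ℝ) (f : ι → ℝ → E3) : ℝ :=
  ∑ i, w i * ∫ s in (L.lo i)..(L.hi i), ‖deriv (f i) s‖

/-- `D` is the first variation of weighted length: the continuous linear functional (a vector
valued Radon measure along the link) which gives the derivative of weighted length for
every Lipschitz velocity field.  Lipschitz fields are dense, so there is at most one such `D`; it
exists for curves of finite total curvature. -/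
def IsFirstVariationLen [Fintype ι] (L : GenLink ι κ) (w : ι → ℝ) (D : L.VF →L[ℝ] ℝ) : Prop :=
  ∀ η : ι → C(ℝ, E3), (∀ i, ∃ K, LipschitzWith K (η i)) →
    HasDerivAt (fun t : ℝ => L.wlen w (fun i s => L.curve i s + t • η i s))
      (D (fun i => (η i).restrict (L.dom i))) 0

/-- `L` is strongly critical for minimizing weighted length when constrained by Gehring thickness
(and by its endpoint constraints and obstacles): for some `ε > 0`, every compatible `ξ` that
shortens the link at unit rate has `min (δ⁺_ξ gThi) (δ⁺_ξ obstMin) ≤ -ε`, where `δ⁺_ξ` is the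
one-sided derivative. -/
def StronglyCritical [Fintype ι] (L : GenLink ι κ) (w : ι → ℝ) : Prop :=
  ∃ D : L.VF →L[ℝ] ℝ, L.IsFirstVariationLen w D ∧
    ∃ ε > (0 : ℝ), ∀ ξ : L.VF, L.Compatible ξ → D ξ = -1 →
      ∃ a b : ℝ,
        HasDerivWithinAt (fun t => L.gThi (L.move ξ t)) a (Set.Ici 0) 0 ∧
        HasDerivWithinAt (fun t => L.obstMin (L.move ξ t)) b (Set.Ici 0) 0 ∧
        min a b ≤ -ε

end GenLink

/-! ### Weighted clasp arcs

In the weighted clasp `C(τ₁, τ₂)` the arc `i` is parametrized by `u ∈ [-τᵢ, τᵢ]`, the vertical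
component of its unit tangent; the touching points satisfy `|u₁|/τ₁ + |u₂|/τ₂ = 1`. -/

/-- Horizontal coordinate, at parameter `u`, of the clasp arc with end parameter `τ₁` clasped to one
with end parameter `τ₂`; for `u ≥ 0` it is `√(u² (1 - v²) / (1 - u² v²))`, where
`v = τ₂ (1 - u/τ₁)` is the parameter of the touching point; it is odd in `u`. -/
def claspX (τ₁ τ₂ u : ℝ) : ℝ :=
  u * √((1 - (τ₂ * (1 - |u| / τ₁)) ^ 2) / (1 - u ^ 2 * (τ₂ * (1 - |u| / τ₁)) ^ 2))

/-- Height of the point `u` of that arc relative to its tip `u = 0`, determined by the slope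
`dz/dx = u / √(1 - u²)`. -/
def claspH (τ₁ τ₂ u : ℝ) : ℝ :=
  ∫ w in (0 : ℝ)..|u|, w / √(1 - w ^ 2) * deriv (claspX τ₁ τ₂) w

/-- The innermost curve in the plane `P₁`, as `(x₁, z)`, at the point with outward normal
`(sin θ, cos θ)` (so `u₁ = sin θ` where `|θ| ≤ π/2`): the clasp arc for `|u₁| ≤ τ₁` on top, continued
by the unit circle about the origin. -/
def archBase (τ₁ τ₂ θ : ℝ) : ℝ × ℝ :=
  if |θ| ≤ Real.arcsin τ₁ then
    (claspX τ₁ τ₂ (Real.sin θ),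
      √(1 - τ₁ ^ 2) + (claspH τ₁ τ₂ τ₁ - claspH τ₁ τ₂ (Real.sin θ)))
  else (Real.sin θ, Real.cos θ)

/-- Outer parallel of `archBase` at distance `d`. -/
def arch (τ₁ τ₂ d θ : ℝ) : ℝ × ℝ :=
  archBase τ₁ τ₂ θ + d • (Real.sin θ, Real.cos θ)

/-- The innermost clasp arc in the plane `P₂`, as `(x₂, z)`, at the point with outward normal
`(sin θ, -cos θ)` (so `u₂ = sin θ`).  Its tip is the origin. -/
def bowlBase (τ₁ τ₂ θ : ℝ) : ℝ × ℝ :=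
  (claspX τ₂ τ₁ (Real.sin θ), claspH τ₂ τ₁ (Real.sin θ))

/-- Outer parallel of `bowlBase` at distance `d`. -/
def bowl (τ₁ τ₂ d θ : ℝ) : ℝ × ℝ :=
  bowlBase τ₁ τ₂ θ + d • (Real.sin θ, -Real.cos θ)

/-- Truncation of `t` to `[-a, a]`. -/
def trunc (a t : ℝ) : ℝ := max (-a) (min t a)

/-! ### The three kinds of components (planar coordinates) -/

/-- A copy of `α`: the closed outer parallel at distance `d` of the curve consisting of the full
upper arc `|θ| ≤ π/2` of `archBase`, two vertical segments of length `h`, and a lower unit semicircle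
about `(0, -h)`.  The parameter `t ∈ [-(π + h), π + h]` is `θ` on the upper arc; `s` is the length
already travelled down along a vertical segment. -/
def alphaCurve (τ₁ τ₂ h d t : ℝ) : ℝ × ℝ :=
  let s := max 0 (min (|t| - Real.pi / 2) h)
  let θ := SignType.sign t * (|t| - s)
  arch τ₁ τ₂ d θ + (0, -s)

/-- A copy of `β`: the outer parallel at distance `d` for `|θ| ≤ Θ`, continued by tangent
straight lines. -/
def betaCurve (τ₁ τ₂ Θ d t : ℝ) : ℝ × ℝ :=
  let θ := trunc Θ t
  arch τ₁ τ₂ d θ + (t - θ) • (Real.cos θ, -Real.sin θ)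

/-- A copy of `γ`: the outer parallel at distance `d` for `|θ| ≤ Φ`, continued by tangent
straight lines. -/
def gammaCurve (τ₁ τ₂ Φ d t : ℝ) : ℝ × ℝ :=
  let θ := trunc Φ t
  bowl τ₁ τ₂ d θ + (t - θ) • (Real.cos θ, Real.sin θ)

/-- Inclusion of the plane `P₁ = {x₂ = 0}`. -/
def inP₁ (p : ℝ × ℝ) : E3 := !₂[p.1, 0, p.2]

/-- Inclusion of the plane `P₂ = {x₁ = 0}`. -/
def inP₂ (p : ℝ × ℝ) : E3 := !₂[0, p.1, p.2]

/-! ### The bounding planes -/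

/-- Sign attached to one of the two ends of an arc. -/
def sgn (e : Bool) : ℝ := if e then 1 else -1

/-- Outer unit normal of the plane for the ends `e` of the copies of `β`; the plane makes
the angle `Θ` with the vertical. -/
def betaNormal (Θ : ℝ) (e : Bool) : E3 := !₂[sgn e * Real.cos Θ, 0, -Real.sin Θ]

/-- Outer unit normal of the plane for the ends `e` of the copies of `γ`; the plane makes
the angle `Φ` with the vertical. -/
def gammaNormal (Φ : ℝ) (e : Bool) : E3 := !₂[0, sgn e * Real.cos Φ, Real.sin Φ]

/-- The plane `⟪ν, p⟫ = b`, for a unit vector `ν`. -/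
def plane (ν : E3) (b : ℝ) : AffineSubspace ℝ E3 :=
  AffineSubspace.mk' (b • ν) (Submodule.span ℝ {ν})ᗮ

/-! ### The configuration of `C_{k,l}^m(τ)` -/

/-- Angle of the `β` planes. -/
def betaAngle (l : ℕ) (τ : ℝ) : ℝ := Real.arcsin (τ / l)

/-- Angle of the `γ` planes. -/
def gammaAngle (m : ℕ) (τ : ℝ) : ℝ := Real.arcsin (τ / m)

/-- Distance from the innermost tip of `γ` (the origin) to the plane normal to the innermost `γ` at
the end of its clasp arc. -/
def gammaArcEnd (k l m : ℕ) (τ : ℝ) : ℝ :=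
  let Φ := gammaAngle m τ
  let p := bowlBase (τ / (k + l)) (τ / m) Φ
  p.1 * Real.cos Φ + p.2 * Real.sin Φ

/-- The described configuration of `C_{k,l}^m(τ)`, with components the `k` copies of `α`, the `l` copies
of `β` and the `m` copies of `γ`.  The `β` planes and the `γ` planes are at distances `b` and `c` from
the innermost tip of `γ`, which is the origin, and the four half-spaces beyond them are the
obstacles.  The straight ends of `β` and `γ` have lengths `b` and `c - gammaArcEnd k l m τ`. -/
def claspConfig (k l m : ℕ) (τ b c : ℝ) : GenLink (Fin k ⊕ Fin l ⊕ Fin m) (Bool ⊕ Bool) where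
  lo
    | .inl _ => -(Real.pi + (m - 1))
    | .inr (.inl _) => -(betaAngle l τ + b)
    | .inr (.inr _) => -(gammaAngle m τ + (c - gammaArcEnd k l m τ))
  hi
    | .inl _ => Real.pi + (m - 1)
    | .inr (.inl _) => betaAngle l τ + b
    | .inr (.inr _) => gammaAngle m τ + (c - gammaArcEnd k l m τ)
  curve
    | .inl i, t => inP₁ (alphaCurve (τ / (k + l)) (τ / m) (m - 1) i t)
    | .inr (.inl i), t => inP₁ (betaCurve (τ / (k + l)) (τ / m) (betaAngle l τ) (k + i) t)
    | .inr (.inr i), t => inP₂ (gammaCurve (τ / (k + l)) (τ / m) (gammaAngle m τ) i t)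
  closed
    | .inl _ => True
    | .inr _ => False
  startM
    | .inl _ => ⊤
    | .inr (.inl _) => plane (betaNormal (betaAngle l τ) false) b
    | .inr (.inr _) => plane (gammaNormal (gammaAngle m τ) false) c
  endM
    | .inl _ => ⊤
    | .inr (.inl _) => plane (betaNormal (betaAngle l τ) true) b
    | .inr (.inr _) => plane (gammaNormal (gammaAngle m τ) true) c
  obst
    | .inl e, p => b - inner ℝ (betaNormal (betaAngle l τ) e) p
    | .inr e, p => c - inner ℝ (gammaNormal (gammaAngle m τ) e) p

/-- The bounding planes are far enough out for the configuration: the straight ends have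
positive length, and all components stay on the inner side of all four planes. -/
def PlanesFarEnough (k l m : ℕ) (τ b c : ℝ) : Prop :=
  0 < b ∧ gammaArcEnd k l m τ < c ∧
    ∀ j i, ∀ s ∈ (claspConfig k l m τ b c).dom i,
      0 ≤ (claspConfig k l m τ b c).obst j ((claspConfig k l m τ b c).curve i s)

end Ropelength

end

noncomputable section
namespace Ropelength
open Set Filter Topology MeasureTheory intervalIntegral

/-! ### Calculus of the clasp arcs -/

/-! The proof is a balance of forces, condensed into one inequality. Suppose a velocity field moves
every two touching points (points of different components at distance 1) apart at rate at least `a`;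
this is `Separating`. Then the first variation of length is at least `totalForce * a`, where
`totalForce` is nonnegative and depends only on `k`, `l`, `m`, `τ` (`Separating.totalForce_mul_le`).
The minimum of a compact family of smooth functions has a one-sided derivative, namely the least
derivative among the minimizers (`exists_hasDerivWithinAt_sInf`). So the derivative of thickness
along `ξ` is such a rate `a`, and if length decreases at unit rate then `a ≤ -1 / (totalForce + 1)`.
The obstacle term only has to possess a derivative.

For a compatible field the first variation is the integral of the outward normal speed against the
turning of the normal: the arcs meet their planes orthogonally, so the ends contribute nothing.
Three families of contacts bound this integral from below.

1. Consecutive parallels touch along their common normal, so the normal speed grows by `a` from one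
copy to the next. This reduces everything to the innermost curves.

2. On the clasp arcs, the points with `u = τ₁ r` and `v = τ₂ (1 - r)` touch. Summing the four mirror
contacts at `±u`, `±v` leaves only normal speeds of the two arcs (`Separating.clasp_contact`).
Integrating over `r` turns these into turning integrals weighted by `1/τ₁ = n/τ` and `1/τ₂ = m/τ`,
that is, by the numbers of parallel copies in the two planes (`Separating.integral_clasp_ge`). This
is why the end parameters are `τ/n` and `τ/m`.

3. The circular parts touch the tip of the innermost `γ` (above) or of the outermost `γ` (the lower
semicircles of the `α`'s). By symmetry only the vertical speed of the tip enters. The upper circles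
contribute `2k` times the speed of the first tip, because `n (τ/l - τ/n) + k (1 - τ/l) = k`; the
lower ones contribute `-2k` times the speed of the last tip. The stacked tips separate at rate at
least `a` per step, which closes the balance.

That the thickness is 1 rests on convexity. Each component is a parallel of a convex curve whose
normal angle increases monotonically (`Front`), so it lies on the inner side of its tangents, and
copies in one plane are separated by tangent lines. Across the two planes the separation is by slabs
parallel to a tangent of each arc. Their width is controlled by the support inequality
`clasp_support`, with equality at the touching pairs computed in `clasp_height_gap`. -/

/-- The derivative of `claspX a b` at `u ∈ (0, a)`. -/
def claspSpeed (a b u : ℝ) : ℝ :=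
  √((1 - (b * (1 - u / a)) ^ 2) / (1 - u ^ 2 * (b * (1 - u / a)) ^ 2)) +
    (b / a * (b * (1 - u / a)) * (1 - u ^ 2) + u * (b * (1 - u / a)) ^ 2 *
      (1 - (b * (1 - u / a)) ^ 2)) / (1 - u ^ 2 * (b * (1 - u / a)) ^ 2) ^ 2 *
    (u / √((1 - (b * (1 - u / a)) ^ 2) / (1 - u ^ 2 * (b * (1 - u / a)) ^ 2)))

section
variable {a b u : ℝ}

lemma claspX_neg : claspX a b (-u) = -claspX a b u := by simp [claspX]

lemma claspX_zero : claspX a b 0 = 0 := by simp [claspX]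

lemma claspH_neg : claspH a b (-u) = claspH a b u := by simp [claspH]

lemma claspH_zero : claspH a b 0 = 0 := by simp [claspH]

lemma claspX_end (ha : 0 ≤ a) : claspX a b a = a := by
  rcases ha.eq_or_lt with rfl | ha
  · simp [claspX]
  · simp [div_self ha.ne', claspX, abs_of_pos ha]

/-- The parameter of the touching point lies in `[0, b]`. -/
lemma partner_mem (ha : 0 < a) (hb : 0 < b) (h0 : 0 ≤ u) (h1 : u ≤ a) :
    0 ≤ b * (1 - u / a) ∧ b * (1 - u / a) ≤ b := by
  have h2 : u / a ≤ 1 := (div_le_one ha).2 h1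
  have h3 : 0 ≤ u / a := by positivity
  constructor
  · exact mul_nonneg hb.le (by linarith)
  · nlinarith

/-- Writing `v` for the partner, `v ≤ 1 - u`, so `1 - v ^ 2 ≥ 2 * u - u ^ 2 ≥ u`. For `b = 1` the
quantity `1 - v ^ 2` vanishes at the tip; this bound shows that it does so no faster than `u`. -/
lemma partner_gap (ha : 0 < a) (ha1 : a ≤ 1) (hb : 0 < b) (hb1 : b ≤ 1) (h0 : 0 ≤ u)
    (h1 : u ≤ a) : u ≤ 1 - (b * (1 - u / a)) ^ 2 := by
  obtain ⟨h2, h3⟩ := partner_mem ha hb h0 h1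
  have h4 : u ≤ u / a := by rw [le_div_iff₀ ha]; nlinarith
  have h5 : u / a ≤ 1 := (div_le_one ha).2 h1
  have h6 : b * (1 - u / a) ≤ 1 - u := by nlinarith
  nlinarith

lemma partner_prod (ha : 0 < a) (ha1 : a ≤ 1) (hb : 0 < b) (hb1 : b ≤ 1) (h0 : 0 ≤ u)
    (h1 : u ≤ a) : 0 < 1 - u ^ 2 * (b * (1 - u / a)) ^ 2 := by
  obtain ⟨h2, h3⟩ := partner_mem ha hb h0 h1
  have h4 := partner_gap ha ha1 hb hb1 h0 h1
  rcases h0.eq_or_lt with rfl | h0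
  · norm_num
  · set v := b * (1 - u / a)
    have : u ^ 2 ≤ 1 := by nlinarith
    have : v ^ 2 < 1 := by linarith
    have : u ^ 2 * v ^ 2 ≤ v ^ 2 := by nlinarith [sq_nonneg v]
    linarith

lemma hasDerivAt_claspX (ha : 0 < a) (ha1 : a ≤ 1) (hb : 0 < b) (hb1 : b ≤ 1) (h0 : 0 < u)
    (h1 : u ≤ a) :
    HasDerivAt (fun u => u * √((1 - (b * (1 - u / a)) ^ 2) / (1 - u ^ 2 * (b * (1 - u / a)) ^ 2)))
      (claspSpeed a b u) u := by
  have hA := partner_gap ha ha1 hb hb1 h0.le h1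
  have hB := partner_prod ha ha1 hb hb1 h0.le h1
  have hv : HasDerivAt (fun u : ℝ => b * (1 - u / a)) (-(b / a)) u := by
    refine ((((hasDerivAt_id u).div_const a).const_sub 1).const_mul b).congr_deriv ?_
    ring
  have hAd := (hv.pow 2).const_sub 1
  have hBd := (((hasDerivAt_id u).pow 2).mul (hv.pow 2)).const_sub 1
  have hq := hAd.div hBd hB.ne'
  have hpos : 0 < (1 - (b * (1 - u / a)) ^ 2) / (1 - u ^ 2 * (b * (1 - u / a)) ^ 2) :=
    div_pos (by linarith) hB
  refine ((hasDerivAt_id u).mul (hq.sqrt hpos.ne')).congr_deriv ?_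
  simp only [claspSpeed, id, Pi.mul_apply, Pi.pow_apply, Pi.div_apply]
  set v := b * (1 - u / a)
  set s := √((1 - v ^ 2) / (1 - u ^ 2 * v ^ 2)) with hs
  have hsp : 0 < s := Real.sqrt_pos.2 hpos
  push_cast
  field_simp
  ring

lemma claspX_eventuallyEq (h0 : 0 < u) : claspX a b =ᶠ[𝓝 u]
    fun u => u * √((1 - (b * (1 - u / a)) ^ 2) / (1 - u ^ 2 * (b * (1 - u / a)) ^ 2)) := by
  filter_upwards [lt_mem_nhds h0] with w hw
  simp [claspX, abs_of_pos hw]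

lemma claspX_hasDerivAt (ha : 0 < a) (ha1 : a ≤ 1) (hb : 0 < b) (hb1 : b ≤ 1) (h0 : 0 < u)
    (h1 : u ≤ a) : HasDerivAt (claspX a b) (claspSpeed a b u) u :=
  (hasDerivAt_claspX ha ha1 hb hb1 h0 h1).congr_of_eventuallyEq (claspX_eventuallyEq h0)

/-- The delicate point is `u = 0` when `b = 1`, where the last factor of `claspSpeed` reads `0 / 0 =
0`. By `partner_gap` its denominator is at least `√u`, so this factor is at most `√u` and tends to
the value `0`. -/
lemma claspSpeed_continuousOn (ha : 0 < a) (ha1 : a ≤ 1) (hb : 0 < b) (hb1 : b ≤ 1) :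
    ContinuousOn (claspSpeed a b) (Icc 0 a) := by
  have hB : ∀ u ∈ Icc 0 a, (1 - u ^ 2 * (b * (1 - u / a)) ^ 2) ≠ 0 := fun u hu =>
    (partner_prod ha ha1 hb hb1 hu.1 hu.2).ne'
  have hq : ContinuousOn
      (fun u => √((1 - (b * (1 - u / a)) ^ 2) / (1 - u ^ 2 * (b * (1 - u / a)) ^ 2))) (Icc 0 a) :=
    (ContinuousOn.div (by fun_prop) (by fun_prop) hB).sqrt
  unfold claspSpeed
  refine hq.add (ContinuousOn.mul (ContinuousOn.div (by fun_prop) (by fun_prop)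
    fun u hu => pow_ne_zero _ (hB u hu)) ?_)
  have hle : ∀ u ∈ Icc 0 a,
      √u ≤ √((1 - (b * (1 - u / a)) ^ 2) / (1 - u ^ 2 * (b * (1 - u / a)) ^ 2)) := by
    intro u hu
    apply Real.sqrt_le_sqrt
    have h1 := partner_gap ha ha1 hb hb1 hu.1 hu.2
    have h2 := partner_prod ha ha1 hb hb1 hu.1 hu.2
    rw [le_div_iff₀ h2]
    have : 0 ≤ u ^ 2 * (b * (1 - u / a)) ^ 2 := by positivity
    nlinarith [hu.1]
  intro u hu
  rcases hu.1.eq_or_lt with rfl | h0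
  · have h3 : Tendsto (fun u : ℝ => √u) (𝓝[Icc 0 a] 0) (𝓝 0) := by
      have := (Real.continuous_sqrt.tendsto 0).mono_left (nhdsWithin_le_nhds (s := Icc 0 a))
      simpa using this
    rw [ContinuousWithinAt]
    simp only [zero_div]
    refine squeeze_zero' ?_ ?_ h3
    · filter_upwards [self_mem_nhdsWithin] with w hw
      exact div_nonneg hw.1 (Real.sqrt_nonneg _)
    · filter_upwards [self_mem_nhdsWithin] with w hw
      rcases hw.1.eq_or_lt with rfl | hw0
      · simp
      · have := hle w hw
        have h4 : 0 < √w := Real.sqrt_pos.2 hw0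
        rw [div_le_iff₀ (lt_of_lt_of_le h4 this)]
        nlinarith [Real.mul_self_sqrt hw.1]
  · exact continuousWithinAt_id.div (hq u hu)
      (lt_of_lt_of_le (Real.sqrt_pos.2 h0) (hle u hu)).ne'

lemma claspSpeed_nonneg (ha : 0 < a) (ha1 : a ≤ 1) (hb : 0 < b) (hb1 : b ≤ 1) (h0 : 0 ≤ u)
    (h1 : u ≤ a) : 0 ≤ claspSpeed a b u := by
  have h2 := partner_gap ha ha1 hb hb1 h0 h1
  have h3 := partner_mem ha hb h0 h1
  unfold claspSpeed
  set v := b * (1 - u / a)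
  have h4 : 0 ≤ 1 - u ^ 2 := by nlinarith
  have h5 : 0 ≤ 1 - v ^ 2 := by linarith
  have := h3.1
  positivity

lemma claspSpeed_pos (ha : 0 < a) (ha1 : a ≤ 1) (hb : 0 < b) (hb1 : b ≤ 1) (h0 : 0 < u)
    (h1 : u ≤ a) : 0 < claspSpeed a b u := by
  have h2 := partner_gap ha ha1 hb hb1 h0.le h1
  have h3 := partner_mem ha hb h0.le h1
  have h6 := partner_prod ha ha1 hb hb1 h0.le h1
  unfold claspSpeed
  set v := b * (1 - u / a)
  have h4 : 0 ≤ 1 - u ^ 2 := by nlinarith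
  have h5 : 0 < 1 - v ^ 2 := by linarith
  have := h3.1
  positivity

lemma claspX_continuousOn (ha : 0 < a) (ha1 : a ≤ 1) (hb : 0 < b) (hb1 : b ≤ 1) :
    ContinuousOn (claspX a b) (Icc (-a) a) := by
  unfold claspX
  refine continuousOn_id.mul (ContinuousOn.sqrt (ContinuousOn.div (by fun_prop) (by fun_prop) ?_))
  intro u hu
  have := partner_prod ha ha1 hb hb1 (abs_nonneg u) (abs_le.2 hu)
  rw [sq_abs] at this
  exact this.ne'

/-- For `a = 1` the integrand is unbounded at the end. It is nonnegative and has the antiderivative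
`-√(1 - w ^ 2)`, continuous up to the end, which gives integrability. -/
lemma intervalIntegrable_div_sqrt (ha : 0 ≤ a) (ha1 : a ≤ 1) :
    IntervalIntegrable (fun w => w / √(1 - w ^ 2)) volume 0 a := by
  refine intervalIntegrable_deriv_of_nonneg (g := fun w => -√(1 - w ^ 2)) (by fun_prop) ?_ ?_
  · intro w hw
    rw [min_eq_left ha, max_eq_right ha] at hw
    have h : 0 < 1 - w ^ 2 := by nlinarith [hw.1, hw.2]
    refine ((((hasDerivAt_id w).pow 2).const_sub 1).sqrt (by simpa using h.ne')).neg.congr_deriv ?_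
    simp
    field_simp
  · intro w hw
    rw [min_eq_left ha] at hw
    exact div_nonneg hw.1.le (Real.sqrt_nonneg _)

lemma claspH_intervalIntegrable (ha : 0 < a) (ha1 : a ≤ 1) (hb : 0 < b) (hb1 : b ≤ 1) :
    IntervalIntegrable (fun w => w / √(1 - w ^ 2) * deriv (claspX a b) w) volume 0 a := by
  have h1 := (intervalIntegrable_div_sqrt ha.le ha1).mul_continuousOn
    (g := claspSpeed a b) (by rw [uIcc_of_le ha.le]; exact claspSpeed_continuousOn ha ha1 hb hb1)
  refine h1.congr fun w hw => ?_
  rw [uIoc_of_le ha.le] at hw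
  simp only [(claspX_hasDerivAt ha ha1 hb hb1 hw.1 hw.2).deriv]

lemma claspH_continuousOn (ha : 0 < a) (ha1 : a ≤ 1) (hb : 0 < b) (hb1 : b ≤ 1) :
    ContinuousOn (claspH a b) (Icc (-a) a) := by
  have h1 : ContinuousOn
      (fun u => ∫ w in (0 : ℝ)..u, w / √(1 - w ^ 2) * deriv (claspX a b) w) (uIcc 0 a) := by
    apply continuousOn_primitive_interval
    rw [uIcc_of_le ha.le, integrableOn_Icc_iff_integrableOn_Ioc,
      ← intervalIntegrable_iff_integrableOn_Ioc_of_le ha.le]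
    exact claspH_intervalIntegrable ha ha1 hb hb1
  rw [uIcc_of_le ha.le] at h1
  exact h1.comp (continuous_abs.continuousOn) fun u hu => ⟨abs_nonneg u, abs_le.2 hu⟩

lemma claspH_hasDerivAt (ha : 0 < a) (ha1 : a ≤ 1) (hb : 0 < b) (hb1 : b ≤ 1) (h0 : 0 < u)
    (h1 : u < a) : HasDerivAt (claspH a b) (u / √(1 - u ^ 2) * claspSpeed a b u) u := by
  have hInt : IntervalIntegrable (fun w => w / √(1 - w ^ 2) * deriv (claspX a b) w) volume 0 u :=
    (claspH_intervalIntegrable ha ha1 hb hb1).mono_set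
      (by rw [uIcc_of_le ha.le, uIcc_of_le h0.le]; exact Icc_subset_Icc le_rfl h1.le)
  have hev : (fun w => w / √(1 - w ^ 2) * deriv (claspX a b) w) =ᶠ[𝓝 u]
      fun w => w / √(1 - w ^ 2) * claspSpeed a b w := by
    filter_upwards [Ioo_mem_nhds h0 h1] with w hw
    rw [(claspX_hasDerivAt ha ha1 hb hb1 hw.1 hw.2.le).deriv]
  have hs : 0 < 1 - u ^ 2 := by nlinarith
  have hc : ContinuousAt (fun w => w / √(1 - w ^ 2) * deriv (claspX a b) w) u := by
    refine ContinuousAt.congr ?_ hev.symm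
    refine (ContinuousAt.div (f := fun w : ℝ => w) (g := fun w : ℝ => √(1 - w ^ 2)) (by fun_prop)
      (by fun_prop) (Real.sqrt_pos.2 hs).ne').mul ?_
    exact (claspSpeed_continuousOn ha ha1 hb hb1).continuousAt (Icc_mem_nhds h0 h1)
  have := integral_hasDerivAt_right hInt
    ((((by fun_prop : Measurable fun w : ℝ => w / √(1 - w ^ 2)).mul
      (measurable_deriv (claspX a b))).stronglyMeasurable.stronglyMeasurableAtFilter)) hc
  rw [hev.eq_of_nhds] at this
  refine this.congr_of_eventuallyEq ?_
  filter_upwards [lt_mem_nhds h0] with w hw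
  simp [claspH, abs_of_pos hw]

lemma claspH_nonneg (ha : 0 < a) (ha1 : a ≤ 1) (hb : 0 < b) (hb1 : b ≤ 1) (h : |u| ≤ a) :
    0 ≤ claspH a b u := by
  unfold claspH
  rw [integral_of_le (abs_nonneg u)]
  refine setIntegral_nonneg measurableSet_Ioc fun w hw => ?_
  rw [(claspX_hasDerivAt ha ha1 hb hb1 hw.1 (hw.2.trans h)).deriv]
  exact mul_nonneg (div_nonneg hw.1.le (Real.sqrt_nonneg _))
    (claspSpeed_nonneg ha ha1 hb hb1 hw.1.le (hw.2.trans h))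

lemma claspX_of_partner (h0 : 0 ≤ u) {v : ℝ} (hv : v = b * (1 - u / a)) :
    claspX a b u = u * √((1 - v ^ 2) / (1 - u ^ 2 * v ^ 2)) := by
  rw [claspX, abs_of_nonneg h0, hv]

/-- The touching relation `u / a + v / b = 1` is symmetric, so facts about one arc transfer to the
other by exchanging `a` and `b`. -/
lemma partner_symm (ha : 0 < a) (hb : 0 < b) {v : ℝ} (hv : v = b * (1 - u / a)) :
    u = a * (1 - v / b) := by
  rw [hv]; field_simp; ring

end

/-- A continuous function whose derivative is nonnegative off a finite set is monotone. -/
lemma le_of_hasDerivAt_nonneg_off_finset (S : Finset ℝ) {f f' : ℝ → ℝ} {a b : ℝ} (hab : a ≤ b)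
    (hc : ContinuousOn f (Icc a b))
    (hd : ∀ x ∈ Ioo a b, x ∉ S → HasDerivAt f (f' x) x ∧ 0 ≤ f' x) : f a ≤ f b := by
  induction S using Finset.induction_on generalizing a b with
  | empty =>
    refine monotoneOn_of_deriv_nonneg (convex_Icc a b) hc ?_ ?_ (left_mem_Icc.2 hab)
      (right_mem_Icc.2 hab) hab <;> rw [interior_Icc] <;> intro x hx
    · exact (hd x hx (by simp)).1.differentiableAt.differentiableWithinAt
    · rw [(hd x hx (by simp)).1.deriv]
      exact (hd x hx (by simp)).2
  | insert c S _ ih =>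
    by_cases hcm : c ∈ Ioo a b
    · refine (ih hcm.1.le (hc.mono (Icc_subset_Icc le_rfl hcm.2.le)) fun x hx hxS => ?_).trans
        (ih hcm.2.le (hc.mono (Icc_subset_Icc hcm.1.le le_rfl)) fun x hx hxS => ?_)
      · exact hd x ⟨hx.1, hx.2.trans hcm.2⟩ (by simp [hx.2.ne, hxS])
      · exact hd x ⟨hcm.1.trans hx.1, hx.2⟩ (by simp [hx.1.ne', hxS])
    · refine ih hab hc fun x hx hxS => hd x hx ?_
      rw [Finset.mem_insert, not_or]
      exact ⟨fun h => hcm (h ▸ hx), hxS⟩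

/-! ### Touching points of the two clasp arcs. -/

section
variable {a b u : ℝ}

lemma sqrt_prod_identities {u v : ℝ} (hu : u ^ 2 ≤ 1) (hv : v ^ 2 ≤ 1)
    (hB : 0 < 1 - u ^ 2 * v ^ 2) :
    √((1 - v ^ 2) / (1 - u ^ 2 * v ^ 2)) = √(1 - v ^ 2) / √(1 - u ^ 2 * v ^ 2) ∧
    √((1 - u ^ 2) / (1 - v ^ 2 * u ^ 2)) = √(1 - u ^ 2) / √(1 - u ^ 2 * v ^ 2) ∧
    √(1 - u ^ 2) ^ 2 = 1 - u ^ 2 ∧ √(1 - v ^ 2) ^ 2 = 1 - v ^ 2 ∧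
    √(1 - u ^ 2 * v ^ 2) ^ 2 = 1 - u ^ 2 * v ^ 2 := by
  refine ⟨Real.sqrt_div (by linarith) _, ?_, Real.sq_sqrt (by linarith),
    Real.sq_sqrt (by linarith), Real.sq_sqrt hB.le⟩
  rw [mul_comm (v ^ 2)]
  exact Real.sqrt_div (by linarith) _

/-- The difference of heights of two touching points. -/
lemma clasp_height_gap (ha : 0 < a) (ha1 : a ≤ 1) (hb : 0 < b) (hb1 : b ≤ 1) (h0 : 0 ≤ u)
    (h1 : u ≤ a) :
    √(1 - a ^ 2) + (claspH a b a - claspH a b u) - claspH b a (b * (1 - u / a)) =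
      √(1 - u ^ 2) * √(1 - (b * (1 - u / a)) ^ 2) / √(1 - u ^ 2 * (b * (1 - u / a)) ^ 2) := by
  rcases h1.eq_or_lt with rfl | h1
  · simp [div_self ha.ne', claspH_zero]
  -- `g` is the defect of the claimed identity. It vanishes at `u = a`, where the partner is `0`, so
  -- it suffices that its derivative is zero.
  set g : ℝ → ℝ := fun u => √(1 - a ^ 2) + (claspH a b a - claspH a b u) -
    claspH b a (b * (1 - u / a)) -
      √(1 - u ^ 2) * √(1 - (b * (1 - u / a)) ^ 2) / √(1 - u ^ 2 * (b * (1 - u / a)) ^ 2) with hg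
  have hcont : ContinuousOn g (Icc u a) := by
    refine ContinuousOn.sub (ContinuousOn.sub (continuousOn_const.add
      (continuousOn_const.sub ?_)) ?_) (ContinuousOn.div (by fun_prop) (by fun_prop) ?_)
    · exact (claspH_continuousOn ha ha1 hb hb1).mono (Icc_subset_Icc (by linarith) le_rfl)
    · refine (claspH_continuousOn hb hb1 ha ha1).comp (by fun_prop) fun w hw => ?_
      have := partner_mem ha hb (h0.trans hw.1) hw.2
      exact ⟨by linarith, this.2⟩
    · exact fun w hw => (Real.sqrt_pos.2 (partner_prod ha ha1 hb hb1 (h0.trans hw.1) hw.2)).ne'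
  have hder : ∀ w ∈ Ioo u a, HasDerivAt g ((fun _ => 0) w) w := by
    intro w hw
    have hw0 : 0 < w := h0.trans_lt hw.1
    obtain ⟨hv0, hvb⟩ := partner_mem ha hb hw0.le hw.2.le
    have hgap := partner_gap ha ha1 hb hb1 hw0.le hw.2.le
    have hB := partner_prod ha ha1 hb hb1 hw0.le hw.2.le
    have hv0 : 0 < b * (1 - w / a) := mul_pos hb (by
      have := (div_lt_one ha).2 hw.2; linarith)
    have hvb : b * (1 - w / a) < b := by
      have : 0 < w / a := by positivity
      nlinarith
    have hvd : HasDerivAt (fun w : ℝ => b * (1 - w / a)) (-(b / a)) w := by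
      refine ((((hasDerivAt_id w).div_const a).const_sub 1).const_mul b).congr_deriv ?_
      ring
    have hX1 := claspX_hasDerivAt ha ha1 hb hb1 hw0 hw.2.le
    have hX2 := (claspX_hasDerivAt hb hb1 ha ha1 hv0 hvb.le).comp w hvd
    have hH1 := claspH_hasDerivAt ha ha1 hb hb1 hw0 hw.2
    have hH2 := (claspH_hasDerivAt hb hb1 ha ha1 hv0 hvb).comp w hvd
    -- The claimed gap `z` completes the two horizontal coordinates to a unit vector, so it may be
    -- differentiated as `√(1 - X₁ ^ 2 - X₂ ^ 2)`. Moreover `X₁ / z` and `X₂ / z` are the slopes `u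
    -- / √(1 - u ^ 2)` and `v / √(1 - v ^ 2)` from which the heights are integrated; hence all terms
    -- of the derivative of `g` cancel.
    have key : ∀ x : ℝ, 0 < x → x < a →
        1 - claspX a b x ^ 2 - claspX b a (b * (1 - x / a)) ^ 2 =
        (√(1 - x ^ 2) * √(1 - (b * (1 - x / a)) ^ 2) / √(1 - x ^ 2 * (b * (1 - x / a)) ^ 2)) ^ 2 ∧
        claspX a b x = x * (√(1 - (b * (1 - x / a)) ^ 2) / √(1 - x ^ 2 * (b * (1 - x / a)) ^ 2)) ∧
        claspX b a (b * (1 - x / a)) = (b * (1 - x / a)) *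
          (√(1 - x ^ 2) / √(1 - x ^ 2 * (b * (1 - x / a)) ^ 2)) := by
      intro x hx0 hxa
      have hgap := partner_gap ha ha1 hb hb1 hx0.le hxa.le
      have hB := partner_prod ha ha1 hb hb1 hx0.le hxa.le
      have hv0 := (partner_mem ha hb hx0.le hxa.le).1
      have e1 := claspX_of_partner (a := a) (b := b) hx0.le rfl
      have e2 := claspX_of_partner (a := b) (b := a) hv0
        (partner_symm (u := x) ha hb rfl)
      set v := b * (1 - x / a)
      obtain ⟨i1, i2, i3, i4, i5⟩ := sqrt_prod_identities (u := x) (v := v)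
        (by nlinarith) (by linarith) hB
      rw [i1] at e1
      rw [i2] at e2
      refine ⟨?_, e1, e2⟩
      rw [e1, e2]
      have hr : √(1 - x ^ 2 * v ^ 2) ≠ 0 := (Real.sqrt_pos.2 hB).ne'
      simp only [mul_pow, div_pow, i3, i4, i5]
      field_simp
      ring
    obtain ⟨k1, k2, k3⟩ := key w hw0 hw.2
    have hp : 0 < √(1 - w ^ 2) := Real.sqrt_pos.2 (by nlinarith [hw.2])
    have hq : 0 < √(1 - (b * (1 - w / a)) ^ 2) := Real.sqrt_pos.2 (by linarith)
    have hr : 0 < √(1 - w ^ 2 * (b * (1 - w / a)) ^ 2) := Real.sqrt_pos.2 hB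
    have hdz : HasDerivAt (fun x => √(1 - claspX a b x ^ 2 - claspX b a (b * (1 - x / a)) ^ 2))
        _ w := (((hX1.pow 2).const_sub 1).sub (hX2.pow 2)).sqrt (by
          simp only [Pi.sub_apply, Pi.pow_apply, Function.comp_apply]
          rw [k1]; positivity)
    have hdz' := hdz.congr_of_eventuallyEq (f₁ := fun x =>
      √(1 - x ^ 2) * √(1 - (b * (1 - x / a)) ^ 2) / √(1 - x ^ 2 * (b * (1 - x / a)) ^ 2)) (by
        filter_upwards [Ioo_mem_nhds hw0 hw.2] with x hx
        rw [(key x hx.1 hx.2).1, Real.sqrt_sq (by positivity)])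
    refine ((((hH1.const_sub _).const_add _).sub hH2).sub hdz').congr_deriv ?_
    simp only [Pi.sub_apply, Pi.pow_apply, Function.comp_apply]
    rw [k1, Real.sqrt_sq (by positivity), k2, k3]
    simp only [Nat.cast_ofNat, Nat.add_one_sub_one, pow_one]
    generalize b * (1 - w / a) = v at *
    generalize √(1 - w ^ 2) = p at *
    generalize √(1 - v ^ 2) = q at *
    generalize √(1 - w ^ 2 * v ^ 2) = r at *
    field_simp
    ring
  obtain ⟨c, hc, hc'⟩ := exists_hasDerivAt_eq_slope g _ h1 hcont hder
  have hga : g a = 0 := by simp [hg, div_self ha.ne', claspH_zero]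
  rw [eq_div_iff (by linarith)] at hc'
  have : g u = 0 := by simp at hc'; linarith
  simp only [hg] at this
  linarith

end

/-! ### The arcs parametrized by the angle of their normal. -/

/-- The clasp arc with end parameter `a`, clasped to one with end parameter `b`, at the point with
upward unit normal `(sin θ, cos θ)`.  Its tip is the origin. -/
def claspArc (a b θ : ℝ) : ℝ × ℝ := (claspX a b (Real.sin θ), -claspH a b (Real.sin θ))

/-- The admissible pairs of end parameters. -/
def ClaspParams (a b : ℝ) : Prop := (a = 0 ∧ b = 0) ∨ (0 < a ∧ a ≤ 1 ∧ 0 < b ∧ b ≤ 1)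

section
variable {a b θ φ : ℝ}

lemma ClaspParams.symm (h : ClaspParams a b) : ClaspParams b a := by
  rcases h with h | h
  · exact .inl h.symm
  · exact .inr ⟨h.2.2.1, h.2.2.2, h.1, h.2.1⟩

lemma ClaspParams.nonneg (h : ClaspParams a b) : 0 ≤ a := by
  rcases h with h | h
  · exact h.1.ge
  · exact h.1.le

lemma ClaspParams.le_one (h : ClaspParams a b) : a ≤ 1 := by
  rcases h with h | h
  · rw [h.1]; exact zero_le_one
  · exact h.2.1

lemma ClaspParams.pos (h : ClaspParams a b) (ha : a ≠ 0) : 0 < a ∧ a ≤ 1 ∧ 0 < b ∧ b ≤ 1 := by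
  rcases h with h | h
  · exact absurd h.1 ha
  · exact h

lemma sin_mem_of_le_arcsin (ha : 0 ≤ a) (ha1 : a ≤ 1) (h0 : 0 ≤ θ) (h1 : θ ≤ Real.arcsin a) :
    0 ≤ Real.sin θ ∧ Real.sin θ ≤ a := by
  have h2 := Real.arcsin_le_pi_div_two a
  refine ⟨Real.sin_nonneg_of_nonneg_of_le_pi h0 (by linarith [Real.pi_pos]), ?_⟩
  calc Real.sin θ ≤ Real.sin (Real.arcsin a) :=
        Real.sin_le_sin_of_le_of_le_pi_div_two (by linarith [Real.pi_pos]) h2 h1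
    _ = a := Real.sin_arcsin (by linarith) ha1

lemma sin_mem_of_lt_arcsin (ha : 0 ≤ a) (ha1 : a ≤ 1) (h0 : 0 < θ) (h1 : θ < Real.arcsin a) :
    0 < Real.sin θ ∧ Real.sin θ < a := by
  have h2 := Real.arcsin_le_pi_div_two a
  refine ⟨Real.sin_pos_of_pos_of_lt_pi h0 (by linarith [Real.pi_pos]), ?_⟩
  calc Real.sin θ < Real.sin (Real.arcsin a) :=
        Real.sin_lt_sin_of_lt_of_le_pi_div_two (by linarith [Real.pi_pos]) h2 h1
    _ = a := Real.sin_arcsin (by linarith) ha1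

lemma abs_sin_le_of_abs_le_arcsin (ha : 0 ≤ a) (ha1 : a ≤ 1) (h1 : |θ| ≤ Real.arcsin a) :
    |Real.sin θ| ≤ a := by
  have := sin_mem_of_le_arcsin ha ha1 (abs_nonneg θ) h1
  rcases abs_cases θ with h | h <;> rw [h.1] at this
  · rw [abs_of_nonneg this.1]; exact this.2
  · rw [Real.sin_neg] at this
    rw [abs_of_nonpos (by linarith)]; exact this.2

lemma claspArc_neg : claspArc a b (-θ) = (-(claspArc a b θ).1, (claspArc a b θ).2) := by
  simp [claspArc, claspX_neg, claspH_neg]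

lemma claspArc_continuousOn (h : ClaspParams a b) :
    ContinuousOn (claspArc a b) {θ | |θ| ≤ Real.arcsin a} := by
  rcases h with ⟨rfl, rfl⟩ | ⟨ha, ha1, hb, hb1⟩
  · simp only [Real.arcsin_zero, abs_nonpos_iff]
    exact continuousOn_singleton _ _
  · have hm : MapsTo Real.sin {θ | |θ| ≤ Real.arcsin a} (Icc (-a) a) := fun θ hθ =>
      abs_le.1 (abs_sin_le_of_abs_le_arcsin ha.le ha1 hθ)
    exact ((claspX_continuousOn ha ha1 hb hb1).comp Real.continuous_sin.continuousOn hm).prodMk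
      ((claspH_continuousOn ha ha1 hb hb1).comp Real.continuous_sin.continuousOn hm).neg

/-- Reflecting a curve reflects its velocity. -/
lemma hasDerivAt_of_reflect {f : ℝ → ℝ × ℝ} {s t ψ : ℝ}
    (hf : ∀ θ, f (-θ) = (-(f θ).1, (f θ).2))
    (h : HasDerivAt f (s • (Real.cos ψ, -Real.sin ψ)) t) :
    HasDerivAt f (s • (Real.cos (-ψ), -Real.sin (-ψ))) (-t) := by
  have e : f = fun θ => (-(f (-θ)).1, (f (-θ)).2) := by
    funext θ; simp [hf]
  have h' : HasDerivAt f (s • (Real.cos ψ, -Real.sin ψ)) (-(-t)) := by rwa [neg_neg]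
  have h1 := h'.scomp (-t) (hasDerivAt_neg (-t))
  rw [e]
  have h2 := (hasFDerivAt_fst (𝕜 := ℝ)).comp_hasDerivAt (-t) h1
  have h3 := (hasFDerivAt_snd (𝕜 := ℝ)).comp_hasDerivAt (-t) h1
  refine (h2.neg.prodMk h3).congr_deriv ?_
  simp

/-- With `u = sin θ` the slope `u / √(1 - u ^ 2)` is `tan θ`, so the velocity is a multiple of the
unit tangent belonging to the normal angle `θ`. The tip is left out: the formula involves `|u|`
there, and the exceptional point is harmless later. -/
lemma claspArc_hasDerivAt (h : ClaspParams a b) (h0 : θ ≠ 0) (h1 : |θ| < Real.arcsin a) :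
    HasDerivAt (claspArc a b)
      (claspSpeed a b |Real.sin θ| • (Real.cos θ, -Real.sin θ)) θ := by
  have key : ∀ θ, 0 < θ → θ < Real.arcsin a → HasDerivAt (claspArc a b)
      (claspSpeed a b |Real.sin θ| • (Real.cos θ, -Real.sin θ)) θ := by
    intro θ h0 h1
    have ha0 : a ≠ 0 := by
      rintro rfl
      rw [Real.arcsin_zero] at h1
      linarith
    obtain ⟨ha, ha1, hb, hb1⟩ := h.pos ha0
    obtain ⟨s0, s1⟩ := sin_mem_of_lt_arcsin ha.le ha1 h0 h1
    have hpi := Real.arcsin_le_pi_div_two a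
    have hc : 0 < Real.cos θ := Real.cos_pos_of_mem_Ioo ⟨by linarith, by linarith⟩
    have e : √(1 - Real.sin θ ^ 2) = Real.cos θ := by
      rw [← Real.cos_sq', Real.sqrt_sq hc.le]
    have dX := (claspX_hasDerivAt ha ha1 hb hb1 s0 s1.le).comp θ (Real.hasDerivAt_sin θ)
    have dH := (claspH_hasDerivAt ha ha1 hb hb1 s0 s1).comp θ (Real.hasDerivAt_sin θ)
    refine (dX.prodMk dH.neg).congr_deriv ?_
    rw [e, abs_of_pos s0]
    ext
    · simp
    · simp
      field_simp
  rcases lt_or_gt_of_ne h0 with h0 | h0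
  · rw [abs_of_neg h0] at h1
    have := hasDerivAt_of_reflect (fun _ => claspArc_neg) (key (-θ) (by linarith) h1)
    simpa using this
  · rw [abs_of_pos h0] at h1
    exact key θ h0 h1

lemma archBase_of_le (h : |θ| ≤ Real.arcsin a) :
    archBase a b θ = claspArc a b θ + (0, √(1 - a ^ 2) + claspH a b a) := by
  rw [archBase, if_pos h]
  ext
  · simp [claspArc]
  · simp [claspArc]; ring

lemma archBase_neg : archBase a b (-θ) = (-(archBase a b θ).1, (archBase a b θ).2) := by
  unfold archBase
  rw [abs_neg]
  split_ifs <;> simp [claspX_neg, claspH_neg]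

/-- At the junction `|θ| = arcsin a` the two branches agree, because the clasp arc ends at
horizontal coordinate `a` and its vertical offset is chosen to put that end on the unit circle. -/
lemma archBase_of_ge (h : ClaspParams a b) (h1 : Real.arcsin a ≤ |θ|) :
    archBase a b θ = (Real.sin θ, Real.cos θ) := by
  rcases h1.eq_or_lt with h1 | h1
  · have key : archBase a b (Real.arcsin a) =
        (Real.sin (Real.arcsin a), Real.cos (Real.arcsin a)) := by
      have h2 : 0 ≤ Real.arcsin a := Real.arcsin_nonneg.2 h.nonneg
      rw [archBase, if_pos (by rw [abs_of_nonneg h2]),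
        Real.sin_arcsin (by linarith [h.nonneg]) h.le_one, claspX_end h.nonneg, sub_self, add_zero,
        Real.cos_arcsin]
    rcases abs_choice θ with h2 | h2
    · rw [h2] at h1; rw [← h1]; exact key
    · rw [h2] at h1
      have : θ = -Real.arcsin a := by linarith
      rw [this, archBase_neg, key]; simp
  · rw [archBase, if_neg (not_le.2 h1)]

lemma archBase_continuous (h : ClaspParams a b) : Continuous (archBase a b) := by
  have : archBase a b = fun θ => if |θ| ≤ Real.arcsin a then
      claspArc a b θ + (0, √(1 - a ^ 2) + claspH a b a) else (Real.sin θ, Real.cos θ) := by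
    funext θ
    split_ifs with h1
    · exact archBase_of_le h1
    · exact archBase_of_ge h (not_le.1 h1).le
  rw [this]
  refine continuous_if_le continuous_abs continuous_const
    ((claspArc_continuousOn h).add continuousOn_const) (by fun_prop) fun θ hθ => ?_
  rw [← archBase_of_le hθ.le, archBase_of_ge h hθ.ge]

/-- The speed of `archBase`. -/
def archSpeed (a b θ : ℝ) : ℝ := if |θ| < Real.arcsin a then claspSpeed a b |Real.sin θ| else 1

lemma archBase_hasDerivAt (h : ClaspParams a b) (h0 : θ ≠ 0) (h1 : |θ| ≠ Real.arcsin a) :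
    HasDerivAt (archBase a b) (archSpeed a b θ • (Real.cos θ, -Real.sin θ)) θ := by
  rcases lt_or_gt_of_ne h1 with h1 | h1
  · rw [archSpeed, if_pos h1]
    refine ((claspArc_hasDerivAt h h0 h1).add_const
      (0, √(1 - a ^ 2) + claspH a b a)).congr_of_eventuallyEq ?_
    filter_upwards [continuous_abs.continuousAt.eventually (gt_mem_nhds h1)] with w hw
    exact archBase_of_le hw.le
  · rw [archSpeed, if_neg (not_lt.2 h1.le), one_smul]
    refine ((Real.hasDerivAt_sin θ).prodMk (Real.hasDerivAt_cos θ)).congr_of_eventuallyEq ?_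
    filter_upwards [continuous_abs.continuousAt.eventually (lt_mem_nhds h1)] with w hw
    exact archBase_of_ge h hw.le

lemma abs_sin_pos_of_abs_le_arcsin (h0 : θ ≠ 0) (h1 : |θ| ≤ Real.arcsin a) :
    0 < |Real.sin θ| := by
  have := Real.arcsin_le_pi_div_two a
  have := Real.pi_pos
  rw [abs_le] at h1
  rw [abs_pos, Ne, Real.sin_eq_zero_iff_of_lt_of_lt (by linarith) (by linarith)]
  exact h0

lemma claspSpeed_sin_pos (h : ClaspParams a b) (h0 : θ ≠ 0) (h1 : |θ| ≤ Real.arcsin a) :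
    0 < claspSpeed a b |Real.sin θ| := by
  have h3 : a ≠ 0 := by
    rintro rfl
    rw [Real.arcsin_zero] at h1
    exact h0 (abs_nonpos_iff.1 h1)
  obtain ⟨ha, ha1, hb, hb1⟩ := h.pos h3
  exact claspSpeed_pos ha ha1 hb hb1 (abs_sin_pos_of_abs_le_arcsin h0 h1)
    (abs_sin_le_of_abs_le_arcsin ha.le ha1 h1)

lemma archSpeed_pos (h : ClaspParams a b) (h0 : θ ≠ 0) : 0 < archSpeed a b θ := by
  unfold archSpeed
  split_ifs with h1
  · exact claspSpeed_sin_pos h h0 h1.le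
  · exact zero_lt_one

lemma exists_claspSpeed_le (h : ClaspParams a b) :
    ∃ C, 1 ≤ C ∧ ∀ θ, |θ| ≤ Real.arcsin a → θ ≠ 0 → claspSpeed a b |Real.sin θ| ≤ C := by
  rcases h with ⟨rfl, rfl⟩ | ⟨ha, ha1, hb, hb1⟩
  · refine ⟨1, le_rfl, fun θ h1 h0 => ?_⟩
    rw [Real.arcsin_zero] at h1
    exact absurd (abs_nonpos_iff.1 h1) h0
  · obtain ⟨C, hC⟩ := isCompact_Icc.exists_bound_of_continuousOn
      (claspSpeed_continuousOn ha ha1 hb hb1)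
    refine ⟨max 1 C, le_max_left _ _, fun θ h1 _ => ?_⟩
    exact (le_abs_self _).trans ((hC _ ⟨abs_nonneg _,
      abs_sin_le_of_abs_le_arcsin ha.le ha1 h1⟩).trans (le_max_right _ _))

lemma exists_archSpeed_le (h : ClaspParams a b) :
    ∃ C, 1 ≤ C ∧ ∀ θ, θ ≠ 0 → archSpeed a b θ ≤ C := by
  obtain ⟨C, hC1, hC⟩ := exists_claspSpeed_le h
  refine ⟨C, hC1, fun θ h0 => ?_⟩
  unfold archSpeed
  split_ifs with h1
  · exact hC θ h1.le h0
  · exact hC1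

/-- Touching points of the two arcs: the difference is a unit vector orthogonal to both arcs. -/
lemma clasp_touch (ha : 0 < a) (ha1 : a ≤ 1) (hb : 0 < b) (hb1 : b ≤ 1) (h0 : 0 ≤ θ)
    (h1 : θ ≤ Real.arcsin a) (hφ0 : 0 ≤ φ) (hφ1 : φ ≤ Real.arcsin b)
    (h : Real.sin φ = b * (1 - Real.sin θ / a)) :
    0 < √(1 - Real.sin θ ^ 2 * Real.sin φ ^ 2) ∧
    (archBase a b θ).1 = Real.sin θ * Real.cos φ / √(1 - Real.sin θ ^ 2 * Real.sin φ ^ 2) ∧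
    claspX b a (Real.sin φ) =
      Real.sin φ * Real.cos θ / √(1 - Real.sin θ ^ 2 * Real.sin φ ^ 2) ∧
    (archBase a b θ).2 - claspH b a (Real.sin φ) =
      Real.cos θ * Real.cos φ / √(1 - Real.sin θ ^ 2 * Real.sin φ ^ 2) := by
  obtain ⟨s0, s1⟩ := sin_mem_of_le_arcsin ha.le ha1 h0 h1
  have hpa := Real.arcsin_le_pi_div_two a
  have hpb := Real.arcsin_le_pi_div_two b
  have e1 : √(1 - Real.sin θ ^ 2) = Real.cos θ := by
    rw [← Real.cos_sq', Real.sqrt_sq (Real.cos_nonneg_of_mem_Icc ⟨by linarith, by linarith⟩)]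
  have e2 : √(1 - Real.sin φ ^ 2) = Real.cos φ := by
    rw [← Real.cos_sq', Real.sqrt_sq (Real.cos_nonneg_of_mem_Icc ⟨by linarith, by linarith⟩)]
  have hv0 := (partner_mem ha hb s0 s1).1
  have hB := partner_prod ha ha1 hb hb1 s0 s1
  have hg := clasp_height_gap ha ha1 hb hb1 s0 s1
  rw [← h] at hv0 hB hg
  obtain ⟨i1, i2, -⟩ := sqrt_prod_identities (Real.sin_sq_le_one θ) (Real.sin_sq_le_one φ) hB
  have hm : |θ| ≤ Real.arcsin a := by rwa [abs_of_nonneg h0]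
  refine ⟨Real.sqrt_pos.2 hB, ?_, ?_, ?_⟩
  · rw [archBase, if_pos hm]
    simp only
    rw [claspX_of_partner s0 h, i1, e2, mul_div_assoc]
  · rw [claspX_of_partner hv0 (partner_symm ha hb h), i2, e1, mul_div_assoc]
  · rw [archBase, if_pos hm]
    simp only
    rw [hg, e1, e2]

end

/-! ### The support inequality between the two clasp arcs. -/

section
variable {a b θ φ : ℝ}

/-- After clearing denominators the difference is `(v ^ 2 - w ^ 2) * (1 - u ^ 2)`. -/
lemma sqrt_ratio_antitone {u v w : ℝ} (hu : u ^ 2 ≤ 1) (hw : 0 ≤ w) (hwv : w ≤ v)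
    (hB : 0 < 1 - u ^ 2 * v ^ 2) :
    √((1 - v ^ 2) / (1 - u ^ 2 * v ^ 2)) ≤ √((1 - w ^ 2) / (1 - u ^ 2 * w ^ 2)) := by
  have h1 : w ^ 2 ≤ v ^ 2 := by gcongr
  have h2 : 0 < 1 - u ^ 2 * w ^ 2 := by nlinarith [sq_nonneg u]
  apply Real.sqrt_le_sqrt
  rw [div_le_div_iff₀ hB h2]
  nlinarith

/-- The support inequality divided by `cos θ` has the slope `tan θ` as its variable. These
identities translate back, and identify the derivative of the width term with an expression of the
same shape as `claspX`. -/
lemma tan_mul_cos_div (h0 : 0 ≤ θ) (h1 : θ < Real.pi / 2) (hφ : 0 ≤ Real.cos φ) :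
    Real.tan θ * Real.cos φ / √(1 + (Real.tan θ * Real.cos φ) ^ 2) =
      Real.sin θ * √((1 - Real.sin φ ^ 2) / (1 - Real.sin θ ^ 2 * Real.sin φ ^ 2)) ∧
    √(1 + (Real.tan θ * Real.cos φ) ^ 2) * Real.cos θ =
      √(1 - Real.sin θ ^ 2 * Real.sin φ ^ 2) ∧ 0 < 1 - Real.sin θ ^ 2 * Real.sin φ ^ 2 := by
  have hc : 0 < Real.cos θ := Real.cos_pos_of_mem_Ioo ⟨by linarith [Real.pi_pos], h1⟩
  have hB : 0 < 1 - Real.sin θ ^ 2 * Real.sin φ ^ 2 := by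
    nlinarith [Real.sin_sq_add_cos_sq θ, Real.sin_sq_le_one φ, sq_nonneg (Real.sin θ),
      sq_nonneg (Real.sin φ), pow_pos hc 2]
  have e : 1 + (Real.tan θ * Real.cos φ) ^ 2 =
      (1 - Real.sin θ ^ 2 * Real.sin φ ^ 2) / Real.cos θ ^ 2 := by
    rw [Real.tan_eq_sin_div_cos]
    field_simp
    have h2 := Real.sin_sq_add_cos_sq θ
    have h3 := Real.sin_sq_add_cos_sq φ
    linear_combination h2 + (Real.sin θ) ^ 2 * h3
  have e2 : √(1 + (Real.tan θ * Real.cos φ) ^ 2) =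
      √(1 - Real.sin θ ^ 2 * Real.sin φ ^ 2) / Real.cos θ := by
    rw [e, Real.sqrt_div hB.le, Real.sqrt_sq hc.le]
  have hr := Real.sqrt_pos.2 hB
  refine ⟨?_, ?_, hB⟩
  · rw [e2, ← Real.cos_sq', Real.sqrt_div (sq_nonneg _), Real.sqrt_sq hφ, Real.tan_eq_sin_div_cos]
    field_simp
  · rw [e2]; field_simp

/-- Support inequality between the two arcs, in terms of the slopes of the normals. -/
lemma clasp_support_tan (ha : 0 < a) (ha1 : a ≤ 1) (hb : 0 < b) (hb1 : b ≤ 1) (h0 : 0 ≤ θ)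
    (h1 : θ < Real.pi / 2) (hφ0 : 0 < φ) (hφ1 : φ ≤ Real.arcsin b) :
    √(1 + (Real.tan θ * Real.cos φ) ^ 2) ≤
      ((archBase a b θ).1 * Real.tan θ + (archBase a b θ).2) * Real.cos φ +
      (claspX b a (Real.sin φ) * Real.sin φ - claspH b a (Real.sin φ) * Real.cos φ) := by
  have hP : ClaspParams a b := .inr ⟨ha, ha1, hb, hb1⟩
  have hpb := Real.arcsin_le_pi_div_two b
  obtain ⟨v0, v1⟩ := sin_mem_of_le_arcsin hb.le hb1 hφ0.le hφ1
  have v0 : 0 < Real.sin φ := Real.sin_pos_of_pos_of_lt_pi hφ0 (by linarith [Real.pi_pos])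
  have hcφ : 0 ≤ Real.cos φ := Real.cos_nonneg_of_mem_Icc ⟨by linarith, by linarith⟩
  obtain ⟨u0, u1⟩ := partner_mem hb ha v0.le v1
  set θ₀ := Real.arcsin (a * (1 - Real.sin φ / b)) with hθ₀
  have hu1 : a * (1 - Real.sin φ / b) < 1 := by
    have : 0 < Real.sin φ / b := by positivity
    nlinarith
  have hs : Real.sin θ₀ = a * (1 - Real.sin φ / b) := Real.sin_arcsin (by linarith) hu1.le
  have hs' : Real.sin φ = b * (1 - Real.sin θ₀ / a) := partner_symm hb ha hs
  have hθ₀0 : 0 ≤ θ₀ := Real.arcsin_nonneg.2 u0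
  have hθ₀a : θ₀ ≤ Real.arcsin a := Real.monotone_arcsin u1
  have hθ₀1 : θ₀ < Real.pi / 2 := Real.arcsin_lt_pi_div_two.2 hu1
  -- `k` is the slack of the inequality for fixed `φ`. It vanishes at `θ₀` and will be shown to
  -- decrease before and increase after `θ₀`.
  set k : ℝ → ℝ := fun θ => ((archBase a b θ).1 * Real.tan θ + (archBase a b θ).2) * Real.cos φ +
      (claspX b a (Real.sin φ) * Real.sin φ - claspH b a (Real.sin φ) * Real.cos φ) -
      √(1 + (Real.tan θ * Real.cos φ) ^ 2) with hk
  suffices h : 0 ≤ k θ by simp only [hk] at h; linarith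
  have hcont : ∀ {x y : ℝ}, 0 ≤ x → y < Real.pi / 2 → ContinuousOn k (Icc x y) := by
    intro x y hx hy
    have ht : ContinuousOn Real.tan (Icc x y) := by
      refine Real.continuousOn_tan_Ioo.mono fun w hw => ⟨?_, ?_⟩
      · have := hw.1; linarith [Real.pi_pos]
      · have := hw.2; linarith
    have hA := archBase_continuous hP
    have hA1 : ContinuousOn (fun θ => (archBase a b θ).1) (Icc x y) := by fun_prop
    have hA2 : ContinuousOn (fun θ => (archBase a b θ).2) (Icc x y) := by fun_prop
    fun_prop
  -- The velocity of `archBase` is orthogonal to its normal, so only the derivatives of `tan` and of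
  -- the square root survive. The speed of the arc does not enter.
  have hder : ∀ w, 0 < w → w < Real.pi / 2 → w ≠ Real.arcsin a → HasDerivAt k
      (Real.cos φ / Real.cos w ^ 2 * ((archBase a b w).1 -
        Real.tan w * Real.cos φ / √(1 + (Real.tan w * Real.cos φ) ^ 2))) w := by
    intro w hw0 hw1 hwa
    have hc : 0 < Real.cos w := Real.cos_pos_of_mem_Ioo ⟨by linarith, hw1⟩
    have hB := archBase_hasDerivAt hP hw0.ne' (by rwa [abs_of_pos hw0])
    have hB1 := (hasFDerivAt_fst (𝕜 := ℝ)).comp_hasDerivAt w hB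
    have hB2 := (hasFDerivAt_snd (𝕜 := ℝ)).comp_hasDerivAt w hB
    have ht := Real.hasDerivAt_tan hc.ne'
    have hpos : 0 < 1 + (Real.tan w * Real.cos φ) ^ 2 := by positivity
    have hq := (((ht.mul_const (Real.cos φ)).pow 2).const_add 1).sqrt hpos.ne'
    refine (((((hB1.mul ht).add hB2).mul_const (Real.cos φ)).add_const
      (claspX b a (Real.sin φ) * Real.sin φ - claspH b a (Real.sin φ) * Real.cos φ)).sub
      hq).congr_deriv ?_
    simp only [Function.comp_apply, ContinuousLinearMap.coe_fst', ContinuousLinearMap.coe_snd',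
      Prod.smul_mk, smul_eq_mul, Pi.pow_apply, Nat.cast_ofNat, Nat.add_one_sub_one, pow_one]
    have hr := Real.sqrt_pos.2 hpos
    have e : Real.cos w * Real.tan w = Real.sin w := by
      rw [mul_comm]; exact Real.tan_mul_cos hc.ne'
    generalize √(1 + (Real.tan w * Real.cos φ) ^ 2) = r at *
    rw [← e]
    field_simp
    ring
  -- Taking the partner to be `max 0 _` covers the circular continuation by the same formula, with
  -- partner `0`. The sign of the derivative of `k` is then decided by comparing this partner with
  -- `sin φ`.
  have hx : ∀ w, 0 < w → w < Real.pi / 2 → (archBase a b w).1 = Real.sin w *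
      √((1 - (max 0 (b * (1 - Real.sin w / a))) ^ 2) /
        (1 - Real.sin w ^ 2 * (max 0 (b * (1 - Real.sin w / a))) ^ 2)) := by
    intro w hw0 hw1
    have hsw : 0 ≤ Real.sin w := Real.sin_nonneg_of_nonneg_of_le_pi hw0.le (by linarith)
    rcases le_total w (Real.arcsin a) with h | h
    · obtain ⟨s0, s1⟩ := sin_mem_of_le_arcsin ha.le ha1 hw0.le h
      rw [max_eq_right (partner_mem ha hb s0 s1).1, archBase, if_pos (by rwa [abs_of_pos hw0])]
      exact claspX_of_partner s0 rfl
    · have : a ≤ Real.sin w := (Real.arcsin_le_iff_le_sin' ⟨by linarith, hw1⟩).1 h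
      rw [max_eq_left, archBase_of_ge hP (by rwa [abs_of_pos hw0])]
      · simp
      · have := (one_le_div ha).2 this
        nlinarith
  have hval : k θ₀ = 0 := by
    obtain ⟨hr, t1, t2, t3⟩ := clasp_touch ha ha1 hb hb1 hθ₀0 hθ₀a hφ0.le hφ1 hs'
    obtain ⟨-, e2, hB⟩ := tan_mul_cos_div hθ₀0 hθ₀1 hcφ
    have hc : 0 < Real.cos θ₀ := Real.cos_pos_of_mem_Ioo ⟨by linarith [Real.pi_pos], hθ₀1⟩
    have hr2 : √(1 - Real.sin θ₀ ^ 2 * Real.sin φ ^ 2) ^ 2 = _ := Real.sq_sqrt hB.le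
    have e : Real.tan θ₀ * Real.cos θ₀ = Real.sin θ₀ := Real.tan_mul_cos hc.ne'
    have t3' : (archBase a b θ₀).2 = claspH b a (Real.sin φ) +
      Real.cos θ₀ * Real.cos φ / √(1 - Real.sin θ₀ ^ 2 * Real.sin φ ^ 2) := by linarith
    refine (mul_eq_zero.1 (?_ : k θ₀ * Real.cos θ₀ = 0)).resolve_right hc.ne'
    have : k θ₀ * Real.cos θ₀ = ((archBase a b θ₀).1 * Real.sin θ₀ +
        (archBase a b θ₀).2 * Real.cos θ₀) * Real.cos φ +
        (claspX b a (Real.sin φ) * Real.sin φ - claspH b a (Real.sin φ) * Real.cos φ) *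
        Real.cos θ₀ - √(1 - Real.sin θ₀ ^ 2 * Real.sin φ ^ 2) := by
      rw [← e2, ← e]; simp only [hk]; ring
    rw [this, t1, t2, t3']
    have i1 := Real.sin_sq_add_cos_sq θ₀
    have i2 := Real.sin_sq_add_cos_sq φ
    generalize √(1 - Real.sin θ₀ ^ 2 * Real.sin φ ^ 2) = r at *
    field_simp
    rw [hr2]
    linear_combination Real.cos φ ^ 2 * i1 + Real.sin φ ^ 2 * i1 + i2
  rcases le_total θ₀ θ with h | h
  · rw [← hval]
    refine le_of_hasDerivAt_nonneg_off_finset {Real.arcsin a} h (hcont hθ₀0 h1)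
      fun w hw hwS => ⟨hder w (by linarith [hw.1]) (by linarith [hw.2]) (by simpa using hwS), ?_⟩
    have hw0 : 0 < w := by linarith [hw.1]
    have hw1 : w < Real.pi / 2 := by linarith [hw.2]
    obtain ⟨e1, -, hB⟩ := tan_mul_cos_div hw0.le hw1 hcφ
    rw [hx w hw0 hw1, e1, ← mul_sub]
    refine mul_nonneg (by positivity) (mul_nonneg
      (Real.sin_nonneg_of_nonneg_of_le_pi hw0.le (by linarith)) (sub_nonneg.2 ?_))
    refine sqrt_ratio_antitone (Real.sin_sq_le_one _) (le_max_left _ _) (max_le v0.le ?_) hB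
    rw [hs']
    have : Real.sin θ₀ ≤ Real.sin w :=
      Real.sin_le_sin_of_le_of_le_pi_div_two (by linarith) hw1.le hw.1.le
    gcongr
  · have := le_of_hasDerivAt_nonneg_off_finset {Real.arcsin a} (f := fun w => -k w)
      (f' := fun w => -(Real.cos φ / Real.cos w ^ 2 * ((archBase a b w).1 -
        Real.tan w * Real.cos φ / √(1 + (Real.tan w * Real.cos φ) ^ 2)))) h
      (hcont h0 hθ₀1).neg fun w hw hwS => ⟨(hder w (by linarith [hw.1]) (by linarith [hw.2])
        (by simpa using hwS)).neg, ?_⟩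
    · simp only [hval] at this; linarith
    have hw0 : 0 < w := by linarith [hw.1]
    have hw1 : w < Real.pi / 2 := by linarith [hw.2]
    obtain ⟨e1, -, -⟩ := tan_mul_cos_div hw0.le hw1 hcφ
    obtain ⟨s0, s1⟩ := sin_mem_of_le_arcsin ha.le ha1 hw0.le (hw.2.le.trans hθ₀a)
    have hv := (partner_mem ha hb s0 s1).1
    have hB := partner_prod ha ha1 hb hb1 s0 s1
    rw [hx w hw0 hw1, e1, ← mul_sub, max_eq_right hv, neg_nonneg]
    refine mul_nonpos_of_nonneg_of_nonpos (by positivity) (mul_nonpos_of_nonneg_of_nonpos s0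
      (sub_nonpos.2 ?_))
    refine sqrt_ratio_antitone (Real.sin_sq_le_one _) v0.le ?_ hB
    rw [hs']
    have : Real.sin w ≤ Real.sin θ₀ :=
      Real.sin_le_sin_of_le_of_le_pi_div_two (by linarith) hθ₀1.le hw.2.le
    gcongr

/-- For `φ > 0` this is `clasp_support_tan` times `cos θ`. The point touching `φ = 0` is the end
`arcsin a`, which is `π / 2` when `a = 1`; the slope is unusable there, so `φ = 0` is reached by
continuity. -/
lemma clasp_support_nonneg (h : ClaspParams a b) (h0 : 0 ≤ θ) (h1 : θ < Real.pi / 2)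
    (hφ0 : 0 ≤ φ) (hφ1 : φ ≤ Real.arcsin b) :
    √(1 - Real.sin θ ^ 2 * Real.sin φ ^ 2) ≤
      ((archBase a b θ).1 * Real.sin θ + (archBase a b θ).2 * Real.cos θ) * Real.cos φ +
      ((claspArc b a φ).1 * Real.sin φ + (claspArc b a φ).2 * Real.cos φ) * Real.cos θ := by
  have hc : 0 < Real.cos θ := Real.cos_pos_of_mem_Ioo ⟨by linarith [Real.pi_pos], h1⟩
  rcases h with ⟨rfl, rfl⟩ | ⟨ha, ha1, hb, hb1⟩
  · have : φ = 0 := le_antisymm (by simpa using hφ1) hφ0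
    rw [this, archBase_of_ge (.inl ⟨rfl, rfl⟩) (by simp)]
    simp [claspArc, claspX_zero, claspH_zero]
    nlinarith [Real.sin_sq_add_cos_sq θ]
  · have hP : ClaspParams a b := .inr ⟨ha, ha1, hb, hb1⟩
    have hΦ : 0 < Real.arcsin b := Real.arcsin_pos.2 hb
    have hpos : ∀ φ, 0 < φ → φ ≤ Real.arcsin b → √(1 - Real.sin θ ^ 2 * Real.sin φ ^ 2) ≤
      ((archBase a b θ).1 * Real.sin θ + (archBase a b θ).2 * Real.cos θ) * Real.cos φ +
      ((claspArc b a φ).1 * Real.sin φ + (claspArc b a φ).2 * Real.cos φ) * Real.cos θ := by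
      intro φ hφ0 hφ1
      have hpb := Real.arcsin_le_pi_div_two b
      have hcφ : 0 ≤ Real.cos φ := Real.cos_nonneg_of_mem_Icc ⟨by linarith, by linarith⟩
      have := clasp_support_tan ha ha1 hb hb1 h0 h1 hφ0 hφ1
      have := mul_le_mul_of_nonneg_right this hc.le
      rw [(tan_mul_cos_div h0 h1 hcφ).2.1] at this
      refine this.trans_eq ?_
      have e : Real.tan θ * Real.cos θ = Real.sin θ := Real.tan_mul_cos hc.ne'
      rw [← e]
      simp only [claspArc]
      ring
    rcases hφ0.eq_or_lt with rfl | hφ0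
    · have hcA : ContinuousOn (claspArc b a) (Icc 0 (Real.arcsin b)) :=
        (claspArc_continuousOn hP.symm).mono fun w hw => by
          rw [mem_ofPred_eq, abs_of_nonneg hw.1]; exact hw.2
      have hc1 := hcA.fst
      have hc2 := hcA.snd
      have hcl : closure (Ioc 0 (Real.arcsin b)) = Icc 0 (Real.arcsin b) := closure_Ioc hΦ.ne
      refine le_on_closure (s := Ioc 0 (Real.arcsin b)) (fun w hw => hpos w hw.1 hw.2) ?_ ?_
        (by rw [hcl]; exact left_mem_Icc.2 hΦ.le) <;> rw [hcl]
      · fun_prop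
      · exact (continuousOn_const.mul (by fun_prop)).add
          (((hc1.mul (by fun_prop)).add (hc2.mul (by fun_prop))).mul continuousOn_const)
    · exact hpos φ hφ0 hφ1

/-- Support inequality between the two arcs. -/
lemma clasp_support (h : ClaspParams a b) (h1 : |θ| < Real.pi / 2) (hφ1 : |φ| ≤ Real.arcsin b) :
    √(1 - Real.sin θ ^ 2 * Real.sin φ ^ 2) ≤
      ((archBase a b θ).1 * Real.sin θ + (archBase a b θ).2 * Real.cos θ) * Real.cos φ +
      ((claspArc b a φ).1 * Real.sin φ + (claspArc b a φ).2 * Real.cos φ) * Real.cos θ := by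
  have key := clasp_support_nonneg h (abs_nonneg θ) h1 (abs_nonneg φ) hφ1
  rcases abs_choice θ with e | e <;> rcases abs_choice φ with e' | e' <;> rw [e, e'] at key <;>
    simpa [archBase_neg, claspArc_neg] using key

end

/-! ### General lemmas: Lipschitz curves, variation of length, minima of families -/

/-- Pairing `f` with the fixed vector `f y - f x` reduces the vector-valued mean value bound to
monotonicity of a real function, where finitely many exceptional points do no harm. -/
lemma lipschitzOnWith_of_hasDerivAt_off_finset {E : Type*} [NormedAddCommGroup E]
    [InnerProductSpace ℝ E] (S : Finset ℝ) {f f' : ℝ → E} {a b C : ℝ} (hC : 0 ≤ C)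
    (hc : ContinuousOn f (Icc a b))
    (hd : ∀ x ∈ Ioo a b, x ∉ S → HasDerivAt f (f' x) x ∧ ‖f' x‖ ≤ C) :
    LipschitzOnWith ⟨C, hC⟩ f (Icc a b) := by
  have key : ∀ x ∈ Icc a b, ∀ y ∈ Icc a b, x ≤ y → ‖f y - f x‖ ≤ C * (y - x) := by
    intro x hx y hy hxy
    set e := f y - f x with he
    have hsub : Icc x y ⊆ Icc a b := Icc_subset_Icc hx.1 hy.2
    have hf := hc.mono hsub
    have := le_of_hasDerivAt_nonneg_off_finset S (f := fun t => C * ‖e‖ * t - inner ℝ e (f t))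
      (f' := fun t => C * ‖e‖ - inner ℝ e (f' t)) hxy (by fun_prop) fun t ht htS => by
        obtain ⟨h1, h2⟩ := hd t (Ioo_subset_Ioo hx.1 hy.2 ht) htS
        refine ⟨?_, ?_⟩
        · refine (((hasDerivAt_id t).const_mul (C * ‖e‖)).sub
            ((hasDerivAt_const t e).inner ℝ h1)).congr_deriv ?_
          simp
        · have := real_inner_le_norm e (f' t)
          nlinarith [norm_nonneg e]
    have h3 : inner ℝ e (f y) - inner ℝ e (f x) = ‖e‖ ^ 2 := by
      rw [← inner_sub_right, ← he, real_inner_self_eq_norm_sq]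
    rcases (norm_nonneg e).eq_or_lt with h0 | h0
    · rw [← h0]; exact mul_nonneg hC (by linarith)
    · nlinarith
  refine LipschitzOnWith.of_dist_le_mul fun x hx y hy => ?_
  change _ ≤ C * _
  rcases le_total x y with h | h
  · rw [dist_comm, dist_comm x y, dist_eq_norm, Real.dist_eq, abs_of_nonneg (by linarith)]
    exact key x hx y hy h
  · rw [dist_eq_norm, Real.dist_eq, abs_of_nonneg (by linarith)]
    exact key y hy x hx h

lemma hasDerivAt_norm_add_smul {E : Type*} [NormedAddCommGroup E] [InnerProductSpace ℝ E]
    {A : E} (B : E) (hA : A ≠ 0) :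
    HasDerivAt (fun t : ℝ => ‖A + t • B‖) (inner ℝ A B / ‖A‖) 0 := by
  have h1 : HasDerivAt (fun t : ℝ => A + t • B) B 0 := by
    simpa using ((hasDerivAt_id (0 : ℝ)).smul_const B).const_add A
  have h2 := h1.norm_sq
  have h3 := h2.sqrt (by simpa using hA)
  have e : (fun t : ℝ => ‖A + t • B‖) = fun t => √(((‖A + · • B‖) ^ 2 : ℝ → ℝ) t) := by
    funext t; simp
  rw [e]
  refine h3.congr_deriv ?_
  simp
  field_simp

/-- First variation of the length of a curve with unit tangent `T` and positive speed. -/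
lemma hasDerivAt_integral_norm_deriv {lo hi C : ℝ} (hlh : lo ≤ hi) (S : Finset ℝ)
    {f T N : ℝ → E3} {s κ : ℝ → ℝ} {KT Kη : NNReal} {η : ℝ → E3}
    (hf : ∀ t ∈ Ioo lo hi, t ∉ S → HasDerivAt f (s t • T t) t ∧ 0 < s t ∧ s t ≤ C)
    (hT1 : ∀ t, ‖T t‖ = 1) (hTl : LipschitzWith KT T)
    (hT : ∀ t ∈ Ioo lo hi, t ∉ S → HasDerivAt T (-(κ t • N t)) t)
    (hη : LipschitzWith Kη η) :
    HasDerivAt (fun r : ℝ => ∫ t in lo..hi, ‖deriv (fun t => f t + r • η t) t‖)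
      (inner ℝ (T hi) (η hi) - inner ℝ (T lo) (η lo) +
        ∫ t in lo..hi, κ t * inner ℝ (N t) (η t)) 0 := by
  have hgood : ∀ᵐ t : ℝ, t ∈ uIoc lo hi → t ∈ Ioo lo hi ∧ t ∉ S ∧ DifferentiableAt ℝ η t := by
    have h1 : ∀ᵐ t : ℝ, t ∉ (S : Set ℝ) := S.countable_toSet.ae_notMem volume
    have h2 : ∀ᵐ t : ℝ, t ≠ hi := Measure.ae_ne volume hi
    filter_upwards [h1, h2, hη.ae_differentiableAt (μ := volume)] with t h1 h2 h3 ht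
    rw [uIoc_of_le hlh] at ht
    exact ⟨⟨ht.1, lt_of_le_of_ne ht.2 h2⟩, by simpa using h1, h3⟩
  have hder : ∀ᵐ t : ℝ, t ∈ uIoc lo hi → ∀ r : ℝ,
      deriv (fun t => f t + r • η t) t = s t • T t + r • deriv η t := by
    filter_upwards [hgood] with t ht htm r
    obtain ⟨h1, h2, h3⟩ := ht htm
    exact ((hf t h1 h2).1.add (h3.hasDerivAt.const_smul r)).deriv
  have hbd : ∀ t, ‖deriv η t‖ ≤ Kη := fun t => norm_deriv_le_of_lipschitz hη
  have hcT : Continuous T := hTl.continuous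
  have hcη : Continuous η := hη.continuous
  -- For almost every `t` the integrand `‖s • T + r • η'‖` is Lipschitz in `r` with constant at most
  -- `Kη`, since `‖η'‖ ≤ Kη`. This permits differentiation under the integral sign; the derivative
  -- at `r = 0` is `⟪T, η'⟫`.
  have hmain := intervalIntegral.hasDerivAt_integral_of_dominated_loc_of_lip (μ := volume)
    (a := lo) (b := hi) (F := fun r t => ‖deriv (fun t => f t + r • η t) t‖)
    (F' := fun t => inner ℝ (T t) (deriv η t)) (x₀ := (0 : ℝ)) (s := univ) (bound := fun _ => Kη)
    univ_mem
    (Eventually.of_forall fun r => (measurable_deriv _).norm.aestronglyMeasurable) (by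
      refine (intervalIntegrable_const (c := C)).mono_fun'
        (measurable_deriv _).norm.aestronglyMeasurable ?_
      rw [EventuallyLE, ae_restrict_iff' measurableSet_uIoc]
      filter_upwards [hder, hgood] with t h1 h2 ht
      obtain ⟨h3, h4, h5⟩ := h2 ht
      obtain ⟨-, h6, h7⟩ := hf t h3 h4
      rw [h1 ht 0]
      simp only [zero_smul, add_zero, norm_smul, hT1, mul_one, norm_norm]
      rw [Real.norm_of_nonneg h6.le]
      exact h7)
    (hcT.measurable.inner (measurable_deriv η)).aestronglyMeasurable
    (by
      filter_upwards [hder] with t h1 ht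
      refine LipschitzOnWith.of_dist_le_mul fun x _ y _ => ?_
      rw [h1 ht x, h1 ht y, Real.dist_eq, Real.dist_eq]
      refine (abs_norm_sub_norm_le _ _).trans ?_
      rw [add_sub_add_left_eq_sub, ← sub_smul, norm_smul, mul_comm]
      simp only [Real.coe_nnabs, NNReal.abs_eq, Real.norm_eq_abs]
      exact mul_le_mul_of_nonneg_right (hbd t) (abs_nonneg _))
    intervalIntegrable_const
    (by
      filter_upwards [hder, hgood] with t h1 h2 ht
      obtain ⟨h3, h4, h5⟩ := h2 ht
      obtain ⟨-, h6, -⟩ := hf t h3 h4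
      simp only [h1 ht]
      have hT0 : T t ≠ 0 := fun h => by simpa [h] using hT1 t
      refine (hasDerivAt_norm_add_smul (deriv η t) (smul_ne_zero h6.ne' hT0)).congr_deriv ?_
      rw [norm_smul, hT1, mul_one, Real.norm_of_nonneg h6.le, real_inner_smul_left]
      field_simp)
  obtain ⟨hInt, hD⟩ := hmain
  refine hD.congr_deriv ?_
  obtain ⟨M, hM⟩ := isCompact_Icc.exists_bound_of_continuousOn (s := Icc lo hi) hcη.continuousOn
  have hM0 : 0 ≤ M := (norm_nonneg _).trans (hM lo (left_mem_Icc.2 hlh))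
  -- Integration by parts: `⟪T, η⟫` is a product of Lipschitz functions, hence absolutely
  -- continuous, so the fundamental theorem of calculus holds although `η` is differentiable only
  -- almost everywhere.
  have hlip : LipschitzOnWith (Kη + KT * ⟨M, hM0⟩) (fun t => inner ℝ (T t) (η t)) (uIcc lo hi) := by
    rw [uIcc_of_le hlh]
    refine LipschitzOnWith.of_dist_le_mul fun x hx y hy => ?_
    have e : inner ℝ (T x) (η x) - inner ℝ (T y) (η y) =
        inner ℝ (T x) (η x - η y) + inner ℝ (T x - T y) (η y) := by
      rw [inner_sub_right, inner_sub_left]; ring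
    rw [Real.dist_eq, e]
    have h1 := abs_real_inner_le_norm (T x) (η x - η y)
    have h2 := abs_real_inner_le_norm (T x - T y) (η y)
    have h3 := hη.dist_le_mul x y
    have h4 := hTl.dist_le_mul x y
    have h5 := hM y hy
    rw [dist_eq_norm] at h3 h4
    rw [hT1, one_mul] at h1
    have h6 : ‖T x - T y‖ * ‖η y‖ ≤ KT * dist x y * M :=
      mul_le_mul h4 h5 (norm_nonneg _) (by positivity)
    refine (abs_add_le _ _).trans ?_
    change _ ≤ ((Kη : ℝ) + KT * M) * dist x y
    nlinarith
  have hac := hlip.absolutelyContinuousOnInterval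
  have hFTC := hac.integral_deriv_eq_sub
  have hdg : ∀ᵐ t : ℝ, t ∈ uIoc lo hi → deriv (fun t => inner ℝ (T t) (η t)) t =
      inner ℝ (T t) (deriv η t) - κ t * inner ℝ (N t) (η t) := by
    filter_upwards [hgood] with t h2 ht
    obtain ⟨h3, h4, h5⟩ := h2 ht
    rw [((hT t h3 h4).inner ℝ h5.hasDerivAt).deriv, inner_neg_left, real_inner_smul_left]
    ring
  have hgi := hac.intervalIntegrable_deriv
  have e1 : ∫ t in lo..hi, κ t * inner ℝ (N t) (η t) = ∫ t in lo..hi,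
      (inner ℝ (T t) (deriv η t) - deriv (fun t => inner ℝ (T t) (η t)) t) := by
    apply intervalIntegral.integral_congr_ae
    filter_upwards [hdg] with t ht htm
    rw [ht htm]; ring
  rw [e1, intervalIntegral.integral_sub hInt hgi, hFTC]
  ring

/-- One-sided derivative of the minimum of a compact family of functions. -/
lemma exists_hasDerivWithinAt_sInf {Y : Type*} [TopologicalSpace Y] [CompactSpace Y] [Nonempty Y]
    (g : ℝ → Y → ℝ) (g₀ g₁ : Y → ℝ) (c₀ : Continuous g₀) (c₁ : Continuous g₁)
    (hlow : ∀ t, 0 ≤ t → ∀ y, g₀ y + t * g₁ y ≤ g t y) (h0 : ∀ y, g 0 y = g₀ y)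
    (hd : ∀ y, HasDerivWithinAt (fun t => g t y) (g₁ y) (Ici 0) 0) :
    ∃ a, HasDerivWithinAt (fun t => sInf (range (g t))) a (Ici 0) 0 ∧
      ∀ y, (∀ y', g₀ y ≤ g₀ y') → a ≤ g₁ y := by
  obtain ⟨ym, -, hym⟩ := isCompact_univ.exists_isMinOn univ_nonempty c₀.continuousOn
  have hmin : ∀ y, g₀ ym ≤ g₀ y := fun y => hym (mem_univ y)
  have hK : IsCompact {y | g₀ y = g₀ ym} := (isClosed_eq c₀ continuous_const).isCompact
  obtain ⟨y₀, hy₀, hy₀'⟩ := hK.exists_isMinOn ⟨ym, rfl⟩ c₁.continuousOn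
  have hy₀ : g₀ y₀ = g₀ ym := hy₀
  -- The derivative is attained at `y₀`, the minimizer of `g₀` with the smallest velocity `g₁`. The
  -- upper estimate uses only this point; the lower one uses `hlow`, which replaces any uniform
  -- differentiability.
  refine ⟨g₁ y₀, ?_, fun y hy => hy₀' (show g₀ y = g₀ ym from le_antisymm (hy ym) (hmin y))⟩
  obtain ⟨C, hC⟩ := isCompact_univ.exists_bound_of_continuousOn c₁.continuousOn
  have hC' : ∀ y, |g₁ y| ≤ C := fun y => hC y (mem_univ y)
  have hC0 : 0 ≤ C := (abs_nonneg _).trans (hC' ym)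
  have hval : sInf (range (g 0)) = g₀ ym := by
    have : g 0 = g₀ := funext h0
    rw [this]
    exact le_antisymm (csInf_le ⟨g₀ ym, by rintro _ ⟨y, rfl⟩; exact hmin y⟩ ⟨ym, rfl⟩)
      (le_csInf (range_nonempty _) (by rintro _ ⟨y, rfl⟩; exact hmin y))
  have hbdd : ∀ t, 0 ≤ t → BddBelow (range (g t)) := by
    intro t ht
    refine ⟨g₀ ym - t * C, ?_⟩
    rintro _ ⟨y, rfl⟩
    have h1 := hlow t ht y
    have h2 := neg_le_of_abs_le (hC' y)
    nlinarith [hmin y]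
  rw [hasDerivWithinAt_iff_isLittleO, Asymptotics.isLittleO_iff]
  intro ε hε
  have hup := (hasDerivWithinAt_iff_isLittleO.1 (hd y₀)).def hε
  -- By compactness, points whose velocity is below that of `y₀` by at least `ε` start at least `δ`
  -- above the minimum, so for small times they cannot become minimal.
  obtain ⟨δ, hδ, hδ'⟩ : ∃ δ > 0, ∀ y, g₁ y ≤ g₁ y₀ - ε → g₀ ym + δ ≤ g₀ y := by
    have hZ : IsCompact {y | g₁ y ≤ g₁ y₀ - ε} := (isClosed_le c₁ continuous_const).isCompact
    rcases Set.eq_empty_or_nonempty {y | g₁ y ≤ g₁ y₀ - ε} with he | hne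
    · exact ⟨1, one_pos, fun y hy => absurd (show y ∈ {y | g₁ y ≤ g₁ y₀ - ε} from hy)
        (by rw [he]; exact notMem_empty y)⟩
    · obtain ⟨z, hz, hz'⟩ := hZ.exists_isMinOn hne c₀.continuousOn
      have hz : g₁ z ≤ g₁ y₀ - ε := hz
      refine ⟨g₀ z - g₀ ym, ?_, fun y hy => ?_⟩
      · refine sub_pos.2 (lt_of_le_of_ne (hmin z) fun h => ?_)
        have : g₁ y₀ ≤ g₁ z := hy₀' (show g₀ z = g₀ ym from h.symm)
        linarith
      · have : g₀ z ≤ g₀ y := hz' hy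
        linarith
  -- Velocities differ by at most `2 * C`, so up to this time a head start of `δ` is not used up;
  -- the `+ 1` keeps the denominator positive.
  have hsmall : ∀ᶠ t in 𝓝[≥] (0 : ℝ), t < δ / (2 * C + 1) :=
    mem_nhdsWithin_of_mem_nhds (gt_mem_nhds (by positivity))
  filter_upwards [hup, hsmall, self_mem_nhdsWithin] with t h1 h2 ht
  have ht : 0 ≤ t := ht
  rw [lt_div_iff₀ (by positivity)] at h2
  simp only [sub_zero, smul_eq_mul, Real.norm_eq_abs, h0, hy₀, hval] at h1 ⊢
  rw [abs_of_nonneg ht] at h1 ⊢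
  rw [abs_le] at h1 ⊢
  constructor
  · have : g₀ ym + t * g₁ y₀ - ε * t ≤ sInf (range (g t)) := by
      refine le_csInf (range_nonempty _) ?_
      rintro _ ⟨y, rfl⟩
      refine le_trans ?_ (hlow t ht y)
      rcases le_or_gt (g₁ y) (g₁ y₀ - ε) with h | h
      · have h3 := hδ' y h
        have h4 := neg_le_of_abs_le (hC' y)
        have h5 := le_of_abs_le (hC' y₀)
        nlinarith
      · nlinarith [hmin y]
    linarith
  · have := csInf_le (hbdd t ht) ⟨y₀, rfl⟩
    linarith [h1.2]

/-! ### Planar fronts -/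

/-- The unit normal at angle `θ` from the vertical. -/
def nrm (θ : ℝ) : ℝ × ℝ := (Real.sin θ, Real.cos θ)

/-- The unit tangent for the normal angle `θ`. -/
def tng (θ : ℝ) : ℝ × ℝ := (Real.cos θ, -Real.sin θ)

/-- The inner product of the plane. -/
def dot (p q : ℝ × ℝ) : ℝ := p.1 * q.1 + p.2 * q.2

/-- A planar curve `B` with normal angle `ϑ` whose rate of turning is `κ`. -/
structure Front (B : ℝ → ℝ × ℝ) (ϑ κ : ℝ → ℝ) : Prop where
  cont : Continuous B
  mono : Monotone ϑ
  lip : LipschitzWith 2 ϑ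
  deriv : ∃ (S : Finset ℝ) (C : ℝ) (s : ℝ → ℝ), ∀ t, t ∉ S →
    HasDerivAt B (s t • tng (ϑ t)) t ∧ 0 < s t ∧ s t ≤ C ∧ HasDerivAt ϑ (κ t) t ∧
      0 ≤ κ t ∧ κ t ≤ 1

lemma dot_nrm_nrm (θ ψ : ℝ) : dot (nrm θ) (nrm ψ) = Real.cos (θ - ψ) := by
  simp [dot, nrm, Real.cos_sub]; ring

lemma dot_tng_nrm (θ ψ : ℝ) : dot (tng θ) (nrm ψ) = Real.sin (ψ - θ) := by
  simp [dot, nrm, tng, Real.sin_sub]; ring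

lemma dot_add_left (p q r : ℝ × ℝ) : dot (p + q) r = dot p r + dot q r := by
  simp [dot]; ring

lemma dot_smul_left (c : ℝ) (p r : ℝ × ℝ) : dot (c • p) r = c * dot p r := by
  simp [dot]; ring

namespace Front
variable {B : ℝ → ℝ × ℝ} {ϑ κ : ℝ → ℝ}

lemma hasDerivAt_dot {v : ℝ × ℝ} {t : ℝ} (p : ℝ × ℝ) (h : HasDerivAt B v t) :
    HasDerivAt (fun t => dot (B t) p) (dot v p) t := by
  have h1 := (hasFDerivAt_fst (𝕜 := ℝ)).comp_hasDerivAt t h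
  have h2 := (hasFDerivAt_snd (𝕜 := ℝ)).comp_hasDerivAt t h
  exact ((h1.mul_const p.1).add (h2.mul_const p.2)).congr_deriv (by simp [dot])

/-- The component in the direction `nrm ψ` has derivative `s t * sin (ψ - ϑ t)` with `s t > 0`, so
its monotonicity depends on the normal angle alone. -/
lemma dot_le (F : Front B ϑ κ) {x y ψ : ℝ} (hxy : x ≤ y)
    (h : ∀ w ∈ Ioo x y, 0 ≤ Real.sin (ψ - ϑ w)) : dot (B x) (nrm ψ) ≤ dot (B y) (nrm ψ) := by
  obtain ⟨S, C, s, hS⟩ := F.deriv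
  have hc := F.cont
  refine le_of_hasDerivAt_nonneg_off_finset S (f := fun t => dot (B t) (nrm ψ))
    (f' := fun t => s t * Real.sin (ψ - ϑ t)) hxy (by unfold dot; fun_prop) fun w hw hwS => ⟨?_, ?_⟩
  · refine (hasDerivAt_dot (nrm ψ) (hS w hwS).1).congr_deriv ?_
    rw [dot_smul_left, dot_tng_nrm]
  · exact mul_nonneg (hS w hwS).2.1.le (h w hw)

lemma dot_ge (F : Front B ϑ κ) {x y ψ : ℝ} (hxy : x ≤ y)
    (h : ∀ w ∈ Ioo x y, Real.sin (ψ - ϑ w) ≤ 0) : dot (B y) (nrm ψ) ≤ dot (B x) (nrm ψ) := by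
  have := F.dot_le (ψ := ψ + Real.pi) hxy fun w hw => by
    have := h w hw
    rw [show ψ + Real.pi - ϑ w = (ψ - ϑ w) + Real.pi by ring, Real.sin_add_pi]
    linarith
  simp only [dot, nrm, Real.sin_add_pi, Real.cos_add_pi] at this ⊢
  linarith

/-- A front that turns by at most `π` lies on the inner side of its tangents. -/
lemma dot_le_of_abs_le (F : Front B ϑ κ) {t t₀ : ℝ} (h : |ϑ t₀ - ϑ t| ≤ Real.pi) :
    dot (B t) (nrm (ϑ t₀)) ≤ dot (B t₀) (nrm (ϑ t₀)) := by
  rw [abs_le] at h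
  rcases le_total t t₀ with h1 | h1
  · refine F.dot_le h1 fun w hw => ?_
    have := F.mono hw.1.le
    have := F.mono hw.2.le
    exact Real.sin_nonneg_of_nonneg_of_le_pi (by linarith) (by linarith)
  · refine F.dot_ge h1 fun w hw => ?_
    have := F.mono hw.1.le
    have := F.mono hw.2.le
    exact Real.sin_nonpos_of_nonpos_of_neg_pi_le (by linarith) (by linarith)

/-- A closed front lies on the inner side of its tangents. -/
lemma dot_le_of_closed (F : Front B ϑ κ) {c t t₀ : ℝ} (hc : ϑ c = Real.pi)
    (hc' : ϑ (-c) = -Real.pi) (hB : B c = B (-c)) (ht : t ∈ Icc (-c) c) (ht₀ : t₀ ∈ Icc (-c) c) :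
    dot (B t) (nrm (ϑ t₀)) ≤ dot (B t₀) (nrm (ϑ t₀)) := by
  have a1 := F.mono ht.1
  have a2 := F.mono ht.2
  have a3 := F.mono ht₀.1
  have a4 := F.mono ht₀.2
  rcases le_or_gt |ϑ t₀ - ϑ t| Real.pi with h | h
  · exact F.dot_le_of_abs_le h
  have hpi := Real.pi_pos
  rcases lt_abs.1 h with h | h
  -- The angle difference exceeds `π`. The curve is followed from `t` back to its closing point,
  -- which is also the other end of the parameter interval; from there the remaining difference is
  -- at most `π`.
  · have h1 : dot (B t) (nrm (ϑ t₀)) ≤ dot (B (-c)) (nrm (ϑ t₀)) := F.dot_ge ht.1 fun w hw => by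
      have := F.mono hw.1.le
      have := F.mono hw.2.le
      rw [← Real.sin_sub_two_pi]
      exact Real.sin_nonpos_of_nonpos_of_neg_pi_le (by linarith) (by linarith)
    rw [← hB] at h1
    exact h1.trans (F.dot_le_of_abs_le (abs_le.2 ⟨by linarith, by linarith⟩))
  · have h1 : dot (B t) (nrm (ϑ t₀)) ≤ dot (B c) (nrm (ϑ t₀)) := F.dot_le ht.2 fun w hw => by
      have := F.mono hw.1.le
      have := F.mono hw.2.le
      rw [← Real.sin_add_two_pi]
      exact Real.sin_nonneg_of_nonneg_of_le_pi (by linarith) (by linarith)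
    rw [hB] at h1
    exact h1.trans (F.dot_le_of_abs_le (abs_le.2 ⟨by linarith, by linarith⟩))

end Front

/-! ### Tangent extensions of arcs -/

lemma trunc_of_abs_le {a t : ℝ} (h : |t| ≤ a) : trunc a t = t := by
  rw [abs_le] at h
  rw [trunc, min_eq_left h.2, max_eq_right h.1]

lemma trunc_of_ge {a t : ℝ} (ha : 0 ≤ a) (h : a ≤ t) : trunc a t = a := by
  rw [trunc, min_eq_right h, max_eq_right (by linarith)]

lemma trunc_neg {a t : ℝ} (ha : 0 ≤ a) : trunc a (-t) = -trunc a t := by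
  unfold trunc
  rcases le_total t a with h1 | h1 <;> rcases le_total (-a) t with h2 | h2 <;>
    rcases le_total (-t) a with h3 | h3 <;> rcases le_total (-a) (-t) with h4 | h4 <;>
    simp [*] <;> linarith

lemma abs_trunc_le {a t : ℝ} (ha : 0 ≤ a) : |trunc a t| ≤ a := by
  rw [abs_le, trunc]
  exact ⟨le_max_left _ _, max_le (by linarith) (min_le_right _ _)⟩

lemma trunc_monotone (a : ℝ) : Monotone (trunc a) := fun x y h => by
  unfold trunc; gcongr

lemma trunc_lipschitz (a : ℝ) : LipschitzWith 1 (trunc a) := by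
  unfold trunc
  exact (LipschitzWith.id.min_const a).const_max (-a)

lemma sub_trunc_monotone (a : ℝ) : Monotone (fun t => t - trunc a t) := fun x y h => by
  have := (trunc_lipschitz a).dist_le_mul y x
  rw [Real.dist_eq, Real.dist_eq, abs_of_nonneg (sub_nonneg.2 (trunc_monotone a h)),
    abs_of_nonneg (sub_nonneg.2 h)] at this
  simp at this ⊢
  linarith

/-- The extension by tangent lines of the part `|θ| ≤ Θ` of a curve `A` parametrized by its normal
angle. -/
def tangentExt (A : ℝ → ℝ × ℝ) (Θ t : ℝ) : ℝ × ℝ :=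
  A (trunc Θ t) + (t - trunc Θ t) • tng (trunc Θ t)

/-- The rate of turning of a tangent extension. -/
def extTurn (Θ t : ℝ) : ℝ := if |t| ≤ Θ then 1 else 0

lemma tng_neg (θ : ℝ) : tng (-θ) = ((tng θ).1, -(tng θ).2) := by simp [tng]

lemma nrm_neg (θ : ℝ) : nrm (-θ) = (-(nrm θ).1, (nrm θ).2) := by simp [nrm]

lemma tangentExt_neg {A : ℝ → ℝ × ℝ} {Θ t : ℝ} (hΘ : 0 ≤ Θ)
    (hA : ∀ θ, A (-θ) = (-(A θ).1, (A θ).2)) :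
    tangentExt A Θ (-t) = (-(tangentExt A Θ t).1, (tangentExt A Θ t).2) := by
  unfold tangentExt
  rw [trunc_neg hΘ, hA, tng_neg]
  ext <;> simp <;> ring

lemma tangentExt_front {A : ℝ → ℝ × ℝ} {Θ C : ℝ} {s : ℝ → ℝ} (S : Finset ℝ) (hΘ : 0 ≤ Θ)
    (hC : 1 ≤ C) (hA : ∀ θ, A (-θ) = (-(A θ).1, (A θ).2)) (hc : ContinuousOn A {θ | |θ| ≤ Θ})
    (hd : ∀ θ, |θ| < Θ → θ ∉ S → HasDerivAt A (s θ • tng θ) θ ∧ 0 < s θ ∧ s θ ≤ C) :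
    Front (tangentExt A Θ) (trunc Θ) (extTurn Θ) where
  cont := by
    have h1 : Continuous (trunc Θ) := (trunc_lipschitz Θ).continuous
    have h2 : Continuous fun t => A (trunc Θ t) := by
      rw [← continuousOn_univ]
      exact hc.comp h1.continuousOn fun t _ => abs_trunc_le hΘ
    unfold tangentExt tng
    exact h2.add ((continuous_id.sub h1).smul
      ((Real.continuous_cos.comp h1).prodMk (Real.continuous_sin.comp h1).neg))
  mono := trunc_monotone Θ
  lip := (trunc_lipschitz Θ).weaken (by norm_num)
  deriv := by
    have hout : ∀ t, Θ < t → HasDerivAt (tangentExt A Θ) ((1 : ℝ) • tng Θ) t := by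
      intro t ht
      have : HasDerivAt (fun t => A Θ + (t - Θ) • tng Θ) ((1 : ℝ) • tng Θ) t :=
        (((hasDerivAt_id t).sub_const Θ).smul_const (tng Θ)).const_add (A Θ)
      refine this.congr_of_eventuallyEq ?_
      filter_upwards [lt_mem_nhds ht] with w hw
      rw [tangentExt, trunc_of_ge hΘ hw.le]
    refine ⟨S ∪ {Θ, -Θ}, C, fun t => if |t| < Θ then s t else 1, fun t ht => ?_⟩
    simp only [Finset.mem_union, Finset.mem_insert, Finset.mem_singleton, not_or] at ht
    obtain ⟨htS, ht1, ht2⟩ := ht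
    rcases lt_or_ge |t| Θ with h | h
    · have hev : ∀ᶠ w in 𝓝 t, |w| < Θ := continuous_abs.continuousAt.eventually (gt_mem_nhds h)
      obtain ⟨h1, h2, h3⟩ := hd t h htS
      beta_reduce
      rw [if_pos h, extTurn, if_pos h.le, trunc_of_abs_le h.le]
      refine ⟨h1.congr_of_eventuallyEq ?_, h2, h3,
        (hasDerivAt_id t).congr_of_eventuallyEq ?_, zero_le_one, le_rfl⟩
      · filter_upwards [hev] with w hw
        rw [tangentExt, trunc_of_abs_le hw.le]; simp
      · filter_upwards [hev] with w hw
        rw [trunc_of_abs_le hw.le]; rfl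
    · have h' : Θ < |t| := lt_of_le_of_ne h fun e => by
        rcases abs_choice t with h3 | h3 <;> rw [h3] at e
        · exact ht1 e.symm
        · exact ht2 (by linarith)
      beta_reduce
      rw [if_neg (not_lt.2 h), extTurn, if_neg (not_le.2 h')]
      rcases le_total 0 t with h0 | h0
      · rw [abs_of_nonneg h0] at h'
        rw [trunc_of_ge hΘ h'.le]
        refine ⟨hout t h', one_pos, hC, ?_, le_rfl, zero_le_one⟩
        refine (hasDerivAt_const t Θ).congr_of_eventuallyEq ?_
        filter_upwards [lt_mem_nhds h'] with w hw
        rw [trunc_of_ge hΘ hw.le]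
      · rw [abs_of_nonpos h0] at h'
        have e : trunc Θ t = -Θ := by
          rw [← neg_neg t, trunc_neg hΘ, trunc_of_ge hΘ h'.le]
        rw [e]
        refine ⟨?_, one_pos, hC, ?_, le_rfl, zero_le_one⟩
        · have := hasDerivAt_of_reflect (fun _ => tangentExt_neg hΘ hA) (hout (-t) h')
          simpa [tng] using this
        · refine (hasDerivAt_const t (-Θ)).congr_of_eventuallyEq ?_
          filter_upwards [gt_mem_nhds (show t < -Θ by linarith)] with w hw
          rw [← neg_neg w, trunc_neg hΘ, trunc_of_ge hΘ (by linarith)]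

/-- Sliding along a tangent line does not change the component along the normal, so the straight
ends have the support value of the end of the arc. -/
lemma dot_tangentExt (A : ℝ → ℝ × ℝ) (Θ t : ℝ) :
    dot (tangentExt A Θ t) (nrm (trunc Θ t)) = dot (A (trunc Θ t)) (nrm (trunc Θ t)) := by
  rw [tangentExt, dot_add_left, dot_smul_left, dot_tng_nrm]
  simp

/-! ### The closed components -/

/-- The length travelled down a vertical segment of `alphaCurve`. -/
def alphaShift (h t : ℝ) : ℝ := max 0 (min (|t| - Real.pi / 2) h)

/-- The normal angle of `alphaCurve`. -/
def alphaAngle (h t : ℝ) : ℝ := SignType.sign t * (|t| - alphaShift h t)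

/-- The innermost closed component. -/
def alphaBase (a b h t : ℝ) : ℝ × ℝ := archBase a b (alphaAngle h t) + (0, -alphaShift h t)

/-- The rate of turning of `alphaCurve`. -/
def alphaTurn (h t : ℝ) : ℝ := if |t| ≤ Real.pi / 2 ∨ Real.pi / 2 + h ≤ |t| then 1 else 0

section
variable {a b h t : ℝ}

lemma alphaShift_neg : alphaShift h (-t) = alphaShift h t := by simp [alphaShift]

lemma alphaAngle_neg : alphaAngle h (-t) = -alphaAngle h t := by
  simp [alphaAngle, alphaShift_neg, Left.sign_neg]

lemma alphaBase_neg :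
    alphaBase a b h (-t) = (-(alphaBase a b h t).1, (alphaBase a b h t).2) := by
  simp [alphaBase, alphaAngle_neg, alphaShift_neg, archBase_neg]

lemma alphaShift_of_abs_le (ht : |t| ≤ Real.pi / 2) : alphaShift h t = 0 :=
  max_eq_left ((min_le_left _ _).trans (by linarith))

lemma alphaAngle_of_abs_le (ht : |t| ≤ Real.pi / 2) : alphaAngle h t = t := by
  rw [alphaAngle, alphaShift_of_abs_le ht, sub_zero]
  exact sign_mul_abs t

lemma alphaShift_mid (ht : Real.pi / 2 ≤ t) (ht' : t ≤ Real.pi / 2 + h) :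
    alphaShift h t = t - Real.pi / 2 := by
  rw [alphaShift, abs_of_nonneg (by linarith [Real.pi_pos]), min_eq_left (by linarith),
    max_eq_right (by linarith)]

lemma alphaAngle_mid (ht : Real.pi / 2 ≤ t) (ht' : t ≤ Real.pi / 2 + h) :
    alphaAngle h t = Real.pi / 2 := by
  have h0 : 0 < t := by linarith [Real.pi_pos]
  rw [alphaAngle, alphaShift_mid ht ht', abs_of_pos h0, sign_pos h0]
  simp

lemma alphaShift_of_ge (hh : 0 ≤ h) (ht : Real.pi / 2 + h ≤ t) : alphaShift h t = h := by
  rw [alphaShift, abs_of_nonneg (by linarith [Real.pi_pos]), min_eq_right (by linarith),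
    max_eq_right hh]

lemma alphaAngle_of_ge (hh : 0 ≤ h) (ht : Real.pi / 2 + h ≤ t) : alphaAngle h t = t - h := by
  have h0 : 0 < t := by linarith [Real.pi_pos]
  rw [alphaAngle, alphaShift_of_ge hh ht, abs_of_pos h0, sign_pos h0]
  simp

/-- As a sum of two monotone functions with Lipschitz constant 1, the normal angle is visibly
monotone and Lipschitz, without going through the pieces of the curve. -/
lemma alphaAngle_eq (hh : 0 ≤ h) :
    alphaAngle h t = trunc (Real.pi / 2) t + (t - trunc (Real.pi / 2 + h) t) := by
  have hpi := Real.pi_pos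
  have key : ∀ t, 0 ≤ t →
      alphaAngle h t = trunc (Real.pi / 2) t + (t - trunc (Real.pi / 2 + h) t) := by
    intro t h0
    rcases le_total t (Real.pi / 2) with h1 | h1
    · rw [alphaAngle_of_abs_le (by rwa [abs_of_nonneg h0]),
        trunc_of_abs_le (by rwa [abs_of_nonneg h0]),
        trunc_of_abs_le (by rw [abs_of_nonneg h0]; linarith)]
      ring
    · rw [trunc_of_ge (by linarith) h1]
      rcases le_total t (Real.pi / 2 + h) with h2 | h2
      · rw [alphaAngle_mid h1 h2, trunc_of_abs_le (by rwa [abs_of_nonneg h0])]; ring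
      · rw [alphaAngle_of_ge hh h2, trunc_of_ge (by linarith) h2]; ring
  rcases le_total 0 t with h0 | h0
  · exact key t h0
  · have := key (-t) (by linarith)
    rw [alphaAngle_neg, trunc_neg (by linarith), trunc_neg (by linarith)] at this
    linarith

/-- Differentiation is done on the three pieces with `t > 0` and carried over to `t < 0` by
reflection. The tip, the ends of the clasp arc and the ends of the vertical segments are the
exceptional points. -/
lemma alpha_front (hP : ClaspParams a b) (hh : 0 ≤ h) :
    Front (alphaBase a b h) (alphaAngle h) (alphaTurn h) where
  cont := by
    have h1 : Continuous (alphaAngle h) := by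
      rw [show alphaAngle h = fun t => _ from funext fun t => alphaAngle_eq hh]
      have := (trunc_lipschitz (Real.pi / 2)).continuous
      have := (trunc_lipschitz (Real.pi / 2 + h)).continuous
      fun_prop
    refine ((archBase_continuous hP).comp h1).add (continuous_const.prodMk ?_)
    unfold alphaShift
    fun_prop
  mono := by
    rw [show alphaAngle h = fun t => _ from funext fun t => alphaAngle_eq hh]
    exact (trunc_monotone _).add (sub_trunc_monotone _)
  -- Both summands have constant 1; this is the source of the constant 2 in `Front`.
  lip := by
    have h1 : LipschitzWith 1 fun t => t - trunc (Real.pi / 2 + h) t := by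
      refine LipschitzWith.of_dist_le_mul fun x y => ?_
      simp only [NNReal.coe_one, one_mul]
      wlog hxy : y ≤ x generalizing x y
      · rw [dist_comm, dist_comm x]; exact this y x (le_of_not_ge hxy)
      rw [Real.dist_eq, Real.dist_eq, abs_of_nonneg (sub_nonneg.2 hxy),
        abs_of_nonneg (sub_nonneg.2 (sub_trunc_monotone _ hxy))]
      linarith [trunc_monotone (Real.pi / 2 + h) hxy]
    rw [show alphaAngle h = fun t => _ from funext fun t => alphaAngle_eq hh]
    exact ((trunc_lipschitz _).add h1).weaken (by norm_num)
  deriv := by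
    have hpi := Real.pi_pos
    obtain ⟨C, hC1, hC⟩ := exists_archSpeed_le hP
    have key : ∀ t, 0 < t → t ≠ Real.arcsin a → t ≠ Real.pi / 2 → t ≠ Real.pi / 2 + h →
        HasDerivAt (alphaBase a b h) (archSpeed a b (alphaAngle h t) • tng (alphaAngle h t)) t ∧
        0 < archSpeed a b (alphaAngle h t) ∧ archSpeed a b (alphaAngle h t) ≤ C ∧
        HasDerivAt (alphaAngle h) (alphaTurn h t) t := by
      intro t h0 h1 h2 h3
      have hpa := Real.arcsin_le_pi_div_two a
      rcases lt_or_gt_of_ne h2 with h2 | h2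
      · have hev : ∀ᶠ w in 𝓝 t, |w| ≤ Real.pi / 2 := by
          filter_upwards [Ioo_mem_nhds h0 h2] with w hw
          rw [abs_of_pos hw.1]; exact hw.2.le
        have hab : |t| ≤ Real.pi / 2 := by rw [abs_of_pos h0]; exact h2.le
        rw [alphaAngle_of_abs_le hab, alphaTurn, if_pos (.inl hab)]
        refine ⟨?_, archSpeed_pos hP h0.ne', hC t h0.ne', ?_⟩
        · refine (archBase_hasDerivAt hP h0.ne' (by rwa [abs_of_pos h0])).congr_of_eventuallyEq ?_
          filter_upwards [hev] with w hw
          simp [alphaBase, alphaAngle_of_abs_le hw, alphaShift_of_abs_le hw]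
        · refine (hasDerivAt_id t).congr_of_eventuallyEq ?_
          filter_upwards [hev] with w hw
          rw [alphaAngle_of_abs_le hw]; rfl
      rcases lt_or_gt_of_ne h3 with h3 | h3
      -- This holds even if `arcsin a = π / 2`, because `archSpeed` compares strictly; the vertical
      -- segment is thus traversed at unit speed.
      · have hsp : archSpeed a b (Real.pi / 2) = 1 := by
          rw [archSpeed, if_neg]
          rw [abs_of_pos (by linarith)]; linarith
        rw [alphaAngle_mid h2.le h3.le, alphaTurn, if_neg, hsp]
        · refine ⟨?_, one_pos, hC1, ?_⟩
          · have : HasDerivAt (fun t : ℝ => archBase a b (Real.pi / 2) + ((0 : ℝ), -(t - Real.pi / 2)))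
                ((1 : ℝ) • tng (Real.pi / 2)) t := by
              refine (((hasDerivAt_const t (0 : ℝ)).prodMk
                ((hasDerivAt_id t).sub_const (Real.pi / 2)).neg).const_add _).congr_deriv ?_
              simp [tng]
            refine this.congr_of_eventuallyEq ?_
            filter_upwards [Ioo_mem_nhds h2 h3] with w hw
            rw [alphaBase, alphaAngle_mid hw.1.le hw.2.le, alphaShift_mid hw.1.le hw.2.le]
          · refine (hasDerivAt_const t (Real.pi / 2)).congr_of_eventuallyEq ?_
            filter_upwards [Ioo_mem_nhds h2 h3] with w hw
            rw [alphaAngle_mid hw.1.le hw.2.le]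
        · rw [abs_of_pos h0]; push Not; exact ⟨h2, h3⟩
      · have ha0 : 0 < t - h := by linarith
        rw [alphaAngle_of_ge hh h3.le, alphaTurn,
          if_pos (.inr (by rw [abs_of_pos h0]; exact h3.le))]
        refine ⟨?_, archSpeed_pos hP ha0.ne', hC _ ha0.ne', ?_⟩
        · have h4 : HasDerivAt (archBase a b) (archSpeed a b (t - h) • tng (t - h)) (t - h) :=
            archBase_hasDerivAt hP ha0.ne' (by rw [abs_of_pos ha0]; linarith)
          have h5 := (h4.scomp t ((hasDerivAt_id t).sub_const h)).add_const ((0 : ℝ), -h)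
          rw [one_smul] at h5
          refine h5.congr_of_eventuallyEq ?_
          filter_upwards [lt_mem_nhds h3] with w hw
          rw [alphaBase, alphaAngle_of_ge hh hw.le, alphaShift_of_ge hh hw.le]; rfl
        · refine ((hasDerivAt_id t).sub_const h).congr_of_eventuallyEq ?_
          filter_upwards [lt_mem_nhds h3] with w hw
          rw [alphaAngle_of_ge hh hw.le]; rfl
    have hturn : ∀ t, 0 ≤ alphaTurn h t ∧ alphaTurn h t ≤ 1 := by
      intro t; unfold alphaTurn; split_ifs <;> simp
    refine ⟨{0, Real.arcsin a, Real.pi / 2, Real.pi / 2 + h, -Real.arcsin a, -(Real.pi / 2),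
      -(Real.pi / 2 + h)}, C, fun t => archSpeed a b (alphaAngle h |t|), fun t ht => ?_⟩
    simp only [Finset.mem_insert, Finset.mem_singleton, not_or] at ht
    obtain ⟨h0, h1, h2, h3, h4, h5, h6⟩ := ht
    rcases lt_or_gt_of_ne h0 with h0 | h0
    · obtain ⟨k1, k2, k3, k4⟩ := key (-t) (by linarith) (fun e => h4 (by linarith))
        (fun e => h5 (by linarith)) (fun e => h6 (by linarith))
      beta_reduce
      rw [abs_of_neg h0]
      refine ⟨?_, k2, k3, ?_, hturn t⟩
      · have := hasDerivAt_of_reflect (fun _ => alphaBase_neg) k1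
        simpa [tng, alphaAngle_neg] using this
      · have e : alphaAngle h = fun t => -alphaAngle h (-t) := by
          funext t; rw [alphaAngle_neg, neg_neg]
        rw [e]
        refine ((k4.comp t (hasDerivAt_neg t)).neg).congr_deriv ?_
        simp [alphaTurn]
    · obtain ⟨k1, k2, k3, k4⟩ := key t h0 h1 h2 h3
      beta_reduce
      rw [abs_of_pos h0]
      exact ⟨k1, k2, k3, k4, hturn t⟩

end

/-! ### The two planes -/

/-- The inclusion of `P₁` as a continuous linear map. -/
def embP₁ : (ℝ × ℝ) →L[ℝ] E3 := LinearMap.toContinuousLinearMap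
  { toFun := fun p => !₂[p.1, 0, p.2]
    map_add' := fun p q => by ext i; fin_cases i <;> simp
    map_smul' := fun c p => by ext i; fin_cases i <;> simp }

/-- The inclusion of `P₂`, reflected so that the copies of `γ` are convex upwards. -/
def embP₂ : (ℝ × ℝ) →L[ℝ] E3 := LinearMap.toContinuousLinearMap
  { toFun := fun p => !₂[0, p.1, -p.2]
    map_add' := fun p q => by ext i; fin_cases i <;> simp [add_comm]
    map_smul' := fun c p => by ext i; fin_cases i <;> simp }

lemma embP₁_apply (p : ℝ × ℝ) : embP₁ p = !₂[p.1, 0, p.2] := rfl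

lemma embP₂_apply (p : ℝ × ℝ) : embP₂ p = !₂[0, p.1, -p.2] := rfl

lemma inner_E3 (x y : E3) : inner ℝ x y = x 0 * y 0 + x 1 * y 1 + x 2 * y 2 := by
  simp [PiLp.inner_apply, Fin.sum_univ_three, mul_comm]

lemma inner_embP₁ (p q : ℝ × ℝ) : inner ℝ (embP₁ p) (embP₁ q) = dot p q := by
  simp [inner_E3, embP₁_apply, dot]

lemma inner_embP₂ (p q : ℝ × ℝ) : inner ℝ (embP₂ p) (embP₂ q) = dot p q := by
  simp [inner_E3, embP₂_apply, dot]

/-- Isometric linear embeddings of the plane. -/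
def IsPlane (e : (ℝ × ℝ) →L[ℝ] E3) : Prop := ∀ p q, inner ℝ (e p) (e q) = dot p q

/-- Cauchy–Schwarz: points separated by a slab of unit width have distance at least 1. The normal
`v` is not normalized, so that the support inequality applies as it stands. -/
lemma one_le_dist_of_inner {x y v : E3} {r : ℝ} (hr : 0 < r) (hv : ‖v‖ = r)
    (h : r ≤ inner ℝ (x - y) v) : 1 ≤ dist x y := by
  rw [dist_eq_norm]
  have := real_inner_le_norm (x - y) v
  rw [hv] at this
  nlinarith

lemma IsPlane.norm_nrm {e : (ℝ × ℝ) →L[ℝ] E3} (he : IsPlane e) (θ : ℝ) : ‖e (nrm θ)‖ = 1 := by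
  rw [← sq_eq_sq₀ (norm_nonneg _) zero_le_one, ← real_inner_self_eq_norm_sq, he, dot_nrm_nrm]
  simp

lemma IsPlane.norm_tng {e : (ℝ × ℝ) →L[ℝ] E3} (he : IsPlane e) (θ : ℝ) : ‖e (tng θ)‖ = 1 := by
  rw [← sq_eq_sq₀ (norm_nonneg _) zero_le_one, ← real_inner_self_eq_norm_sq, he]
  simp [dot, tng]
  nlinarith [Real.sin_sq_add_cos_sq θ]

/-- Different parallels in one plane have distance at least one. -/
lemma IsPlane.one_le_dist {e : (ℝ × ℝ) →L[ℝ] E3} (he : IsPlane e) {p q : ℝ × ℝ}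
    {d d' θ ψ : ℝ} (h : dot p (nrm ψ) ≤ dot q (nrm ψ)) (hd : 0 ≤ d) (hd' : d + 1 ≤ d') :
    1 ≤ dist (e (q + d' • nrm ψ)) (e (p + d • nrm θ)) := by
  -- The separating direction is the normal at the point of the outer copy; in it the offset of the
  -- inner point counts only `d * cos (θ - ψ) ≤ d`.
  refine one_le_dist_of_inner one_pos (he.norm_nrm ψ) ?_
  rw [← map_sub, he, show q + d' • nrm ψ - (p + d • nrm θ) =
    q + d' • nrm ψ + (-1 : ℝ) • (p + d • nrm θ) by module]
  simp only [dot_add_left, dot_smul_left, dot_nrm_nrm, sub_self, Real.cos_zero]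
  nlinarith [Real.cos_le_one (θ - ψ)]

/-- Points outside the two clasp arcs have distance at least one. -/
lemma one_le_dist_clasp {a b ψ φ : ℝ} (hP : ClaspParams a b) {p q : ℝ × ℝ}
    (hψ : |ψ| ≤ Real.pi / 2) (hφ : |φ| ≤ Real.arcsin b)
    (hp : dot (archBase a b ψ) (nrm ψ) ≤ dot p (nrm ψ))
    (hq : dot (claspArc b a φ) (nrm φ) ≤ dot q (nrm φ)) : 1 ≤ dist (embP₁ p) (embP₂ q) := by
  -- For `|ψ| = π / 2` the normal is horizontal, and its component alone already separates `p` by 1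
  -- from the plane `x₁ = 0` containing the other point.
  rcases hψ.eq_or_lt with hψ | hψ
  · have h1 : dot (archBase a b ψ) (nrm ψ) = 1 := by
      rw [archBase_of_ge hP (by rw [hψ]; exact Real.arcsin_le_pi_div_two a)]
      exact (dot_nrm_nrm ψ ψ).trans (by simp)
    rw [h1] at hp
    have hc : Real.cos ψ = 0 := by
      rw [← Real.cos_abs, hψ, Real.cos_pi_div_two]
    have hs : ∀ x, dot x (nrm ψ) = x.1 * Real.sin ψ := fun x => by simp [dot, nrm, hc]
    refine one_le_dist_of_inner one_pos (v := embP₁ (nrm ψ)) ?_ ?_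
    · exact IsPlane.norm_nrm inner_embP₁ ψ
    · rw [hs] at hp
      simpa [inner_E3, embP₁_apply, embP₂_apply, nrm, hc] using hp
  · have key := clasp_support hP hψ hφ
    have hcψ : 0 < Real.cos ψ := Real.cos_pos_of_mem_Ioo (abs_lt.1 hψ)
    have hcφ : 0 ≤ Real.cos φ := Real.cos_nonneg_of_mem_Icc
      (abs_le.1 (hφ.trans (Real.arcsin_le_pi_div_two b)))
    have hB : 0 < 1 - Real.sin ψ ^ 2 * Real.sin φ ^ 2 := by
      nlinarith [Real.sin_sq_add_cos_sq ψ, Real.sin_sq_le_one φ, sq_nonneg (Real.sin ψ),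
        sq_nonneg (Real.sin φ), pow_pos hcψ 2]
    -- This vector is orthogonal to both tangents, and its length is the left-hand side of the
    -- support inequality.
    refine one_le_dist_of_inner (Real.sqrt_pos.2 hB) (v := !₂[Real.sin ψ * Real.cos φ,
      -(Real.sin φ * Real.cos ψ), Real.cos ψ * Real.cos φ]) ?_ (key.trans ?_)
    · rw [← sq_eq_sq₀ (norm_nonneg _) (Real.sqrt_nonneg _), ← real_inner_self_eq_norm_sq,
        Real.sq_sqrt hB.le, inner_E3]
      simp
      have i1 := Real.sin_sq_add_cos_sq ψ
      have i2 := Real.sin_sq_add_cos_sq φ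
      linear_combination Real.cos φ ^ 2 * i1 + Real.sin φ ^ 2 * i1 + i2
    · have e1 := mul_le_mul_of_nonneg_right hp hcφ
      have e2 := mul_le_mul_of_nonneg_right hq hcψ.le
      simp only [dot, nrm] at e1 e2
      simp [inner_E3, embP₁_apply, embP₂_apply]
      linarith

/-! ### The components of the configuration as fronts -/

/-- The standing hypotheses. -/
structure Params (k l m : ℕ) (τ : ℝ) : Prop where
  one_le_l : 1 ≤ l
  one_le_m : 1 ≤ m
  nonneg : 0 ≤ τ
  le_l : τ ≤ l
  le_m : τ ≤ m

namespace Params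
variable {k l m : ℕ} {τ : ℝ}

lemma l_pos (H : Params k l m τ) : (0 : ℝ) < l := by exact_mod_cast H.one_le_l

lemma m_pos (H : Params k l m τ) : (0 : ℝ) < m := by exact_mod_cast H.one_le_m

lemma n_pos (H : Params k l m τ) : (0 : ℝ) < k + l := by have := H.l_pos; positivity

lemma clasp (H : Params k l m τ) : ClaspParams (τ / (k + l)) (τ / m) := by
  rcases H.nonneg.eq_or_lt with h | h
  · left; simp [← h]
  · have := H.l_pos
    have := H.m_pos
    have := H.n_pos
    refine .inr ⟨by positivity, (div_le_one H.n_pos).2 ?_, by positivity,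
      (div_le_one H.m_pos).2 H.le_m⟩
    have : (0 : ℝ) ≤ k := by positivity
    linarith [H.le_l]

lemma betaAngle_nonneg (H : Params k l m τ) : 0 ≤ betaAngle l τ :=
  Real.arcsin_nonneg.2 (div_nonneg H.nonneg H.l_pos.le)

lemma gammaAngle_nonneg (H : Params k l m τ) : 0 ≤ gammaAngle m τ :=
  Real.arcsin_nonneg.2 (div_nonneg H.nonneg H.m_pos.le)

lemma betaAngle_le (_ : Params k l m τ) : betaAngle l τ ≤ Real.pi / 2 :=
  Real.arcsin_le_pi_div_two _

lemma gammaAngle_le (_ : Params k l m τ) : gammaAngle m τ ≤ Real.pi / 2 :=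
  Real.arcsin_le_pi_div_two _

lemma arcsin_le_betaAngle (H : Params k l m τ) : Real.arcsin (τ / (k + l)) ≤ betaAngle l τ := by
  apply Real.monotone_arcsin
  have := H.nonneg
  have := H.l_pos
  gcongr
  linarith [show (0 : ℝ) ≤ k by positivity]

lemma height_nonneg (H : Params k l m τ) : (0 : ℝ) ≤ m - 1 := by
  have : (1 : ℝ) ≤ m := by exact_mod_cast H.one_le_m
  linarith

end Params

/-- The innermost curve parallel to a component. -/
def base (k l m : ℕ) (τ : ℝ) : Fin k ⊕ Fin l ⊕ Fin m → ℝ → ℝ × ℝ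
  | .inl _ => alphaBase (τ / (k + l)) (τ / m) (m - 1)
  | .inr (.inl _) => tangentExt (archBase (τ / (k + l)) (τ / m)) (betaAngle l τ)
  | .inr (.inr _) => tangentExt (claspArc (τ / m) (τ / (k + l))) (gammaAngle m τ)

/-- The normal angle of a component. -/
def angle (k l m : ℕ) (τ : ℝ) : Fin k ⊕ Fin l ⊕ Fin m → ℝ → ℝ
  | .inl _ => alphaAngle (m - 1)
  | .inr (.inl _) => trunc (betaAngle l τ)
  | .inr (.inr _) => trunc (gammaAngle m τ)

/-- The rate of turning of a component. -/
def turn (k l m : ℕ) (τ : ℝ) : Fin k ⊕ Fin l ⊕ Fin m → ℝ → ℝ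
  | .inl _ => alphaTurn (m - 1)
  | .inr (.inl _) => extTurn (betaAngle l τ)
  | .inr (.inr _) => extTurn (gammaAngle m τ)

/-- The distance of a component from the innermost parallel. -/
def depth (k l m : ℕ) : Fin k ⊕ Fin l ⊕ Fin m → ℝ
  | .inl i => i
  | .inr (.inl i) => k + i
  | .inr (.inr i) => i

/-- The inclusion of the plane of a component. -/
def emb (k l m : ℕ) : Fin k ⊕ Fin l ⊕ Fin m → (ℝ × ℝ) →L[ℝ] E3
  | .inl _ => embP₁
  | .inr (.inl _) => embP₁
  | .inr (.inr _) => embP₂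

section
variable {k l m : ℕ} {τ : ℝ}

lemma emb_isPlane (i : Fin k ⊕ Fin l ⊕ Fin m) : IsPlane (emb k l m i) := by
  rcases i with i | i | i
  · exact inner_embP₁
  · exact inner_embP₁
  · exact inner_embP₂

lemma depth_nonneg (i : Fin k ⊕ Fin l ⊕ Fin m) : 0 ≤ depth k l m i := by
  rcases i with i | i | i <;> simp only [depth] <;> positivity

lemma claspConfig_curve (b c : ℝ) (i : Fin k ⊕ Fin l ⊕ Fin m) (t : ℝ) :
    (claspConfig k l m τ b c).curve i t =
      emb k l m i (base k l m τ i t + depth k l m i • nrm (angle k l m τ i t)) := by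
  rcases i with i | i | i
  · simp only [claspConfig, emb, base, depth, angle, embP₁_apply, inP₁, alphaCurve, arch,
      alphaBase]
    ext j
    fin_cases j <;> simp [nrm, alphaAngle, alphaShift]
    ring
  · simp only [claspConfig, emb, base, depth, angle, embP₁_apply, inP₁, betaCurve, arch,
      tangentExt]
    ext j
    fin_cases j <;> simp [nrm, tng] <;> ring
  · simp only [claspConfig, emb, base, depth, angle, embP₂_apply, inP₂, gammaCurve, bowl, bowlBase,
      tangentExt, claspArc]
    ext j
    fin_cases j <;> simp [nrm, tng] <;> ring

lemma base_front (H : Params k l m τ) (i : Fin k ⊕ Fin l ⊕ Fin m) :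
    Front (base k l m τ i) (angle k l m τ i) (turn k l m τ i) := by
  have hP := H.clasp
  rcases i with i | i | i
  · exact alpha_front hP H.height_nonneg
  · obtain ⟨C, hC1, hC⟩ := exists_archSpeed_le hP
    refine tangentExt_front (C := C) (s := archSpeed (τ / (k + l)) (τ / m))
      {0, Real.arcsin (τ / (k + l)), -Real.arcsin (τ / (k + l))} H.betaAngle_nonneg hC1
      (fun _ => archBase_neg) (archBase_continuous hP).continuousOn fun θ _ hS => ?_
    simp only [Finset.mem_insert, Finset.mem_singleton, not_or] at hS
    refine ⟨archBase_hasDerivAt hP hS.1 fun e => ?_, archSpeed_pos hP hS.1, hC θ hS.1⟩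
    rcases abs_choice θ with h | h <;> rw [h] at e
    · exact hS.2.1 e
    · exact hS.2.2 (by linarith)
  · obtain ⟨C, hC1, hC⟩ := exists_claspSpeed_le hP.symm
    refine tangentExt_front (C := C) (s := fun θ => claspSpeed (τ / m) (τ / (k + l)) |Real.sin θ|)
      {0} H.gammaAngle_nonneg hC1 (fun _ => claspArc_neg) (claspArc_continuousOn hP.symm)
      fun θ h hS => ?_
    have h0 : θ ≠ 0 := by simpa using hS
    exact ⟨claspArc_hasDerivAt hP.symm h0 h, claspSpeed_sin_pos hP.symm h0 h.le, hC θ h.le h0⟩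

end

/-! ### Distances between components -/

lemma dot_offset (p : ℝ × ℝ) (d θ : ℝ) : dot (p + d • nrm θ) (nrm θ) = dot p (nrm θ) + d := by
  rw [dot_add_left, dot_smul_left, dot_nrm_nrm]; simp

section
variable {a b h t : ℝ}

lemma alphaAngle_end (hh : 0 ≤ h) : alphaAngle h (Real.pi + h) = Real.pi := by
  rw [alphaAngle_of_ge hh (by linarith [Real.pi_pos])]; ring

lemma alphaBase_end (hP : ClaspParams a b) (hh : 0 ≤ h) :
    alphaBase a b h (Real.pi + h) = alphaBase a b h (-(Real.pi + h)) := by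
  have hpi := Real.pi_pos
  have h1 := Real.arcsin_le_pi_div_two a
  have : archBase a b Real.pi = (0, -1) := by
    rw [archBase_of_ge hP (by rw [abs_of_pos hpi]; linarith)]; simp
  rw [alphaBase_neg, alphaBase, alphaAngle_end hh, this]
  simp

lemma alphaBase_of_abs_le (ht : |t| ≤ Real.pi / 2) : alphaBase a b h t = archBase a b t := by
  simp [alphaBase, alphaAngle_of_abs_le ht, alphaShift_of_abs_le ht]

/-- A point of the closed curve is on the upper part, where the shift is orthogonal to the normal,
or on the lower semicircle. -/
lemma alpha_cases (hh : 0 ≤ h) (ht : |t| ≤ Real.pi + h) :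
    (|alphaAngle h t| ≤ Real.pi / 2 ∧ alphaShift h t * Real.cos (alphaAngle h t) = 0) ∨
    (Real.pi / 2 ≤ |alphaAngle h t| ∧ Real.cos (alphaAngle h t) ≤ 0 ∧ alphaShift h t = h) := by
  have hpi := Real.pi_pos
  have key : ∀ t, 0 ≤ t → t ≤ Real.pi + h →
      (|alphaAngle h t| ≤ Real.pi / 2 ∧ alphaShift h t * Real.cos (alphaAngle h t) = 0) ∨
      (Real.pi / 2 ≤ |alphaAngle h t| ∧ Real.cos (alphaAngle h t) ≤ 0 ∧ alphaShift h t = h) := by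
    intro t h0 h1
    rcases le_total t (Real.pi / 2) with h2 | h2
    · have : |t| ≤ Real.pi / 2 := by rwa [abs_of_nonneg h0]
      left
      rw [alphaAngle_of_abs_le this, alphaShift_of_abs_le this]
      exact ⟨this, zero_mul _⟩
    rcases le_total t (Real.pi / 2 + h) with h3 | h3
    · left
      rw [alphaAngle_mid h2 h3, Real.cos_pi_div_two, mul_zero, abs_of_pos (by linarith)]
      exact ⟨le_rfl, rfl⟩
    · right
      rw [alphaAngle_of_ge hh h3, alphaShift_of_ge hh h3, abs_of_nonneg (by linarith)]
      exact ⟨by linarith, Real.cos_nonpos_of_pi_div_two_le_of_le (by linarith) (by linarith), rfl⟩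
  rcases le_total 0 t with h0 | h0
  · exact key t h0 (by rwa [abs_of_nonneg h0] at ht)
  · have := key (-t) (by linarith) (by rwa [abs_of_nonpos h0] at ht)
    rwa [alphaAngle_neg, alphaShift_neg, abs_neg, Real.cos_neg] at this

lemma sub_trunc_mul_sin_nonneg {Φ : ℝ} (h0 : 0 ≤ Φ) (h1 : Φ ≤ Real.pi / 2) :
    0 ≤ (t - trunc Φ t) * Real.sin (trunc Φ t) := by
  have hs : 0 ≤ Real.sin Φ := Real.sin_nonneg_of_nonneg_of_le_pi h0 (by linarith [Real.pi_pos])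
  rcases le_total |t| Φ with h | h
  · rw [trunc_of_abs_le h]; simp
  · rcases le_total 0 t with h2 | h2
    · rw [abs_of_nonneg h2] at h
      rw [trunc_of_ge h0 h]
      exact mul_nonneg (by linarith) hs
    · rw [abs_of_nonpos h2] at h
      rw [← neg_neg t, trunc_neg h0, trunc_of_ge h0 h, Real.sin_neg]
      nlinarith

lemma claspH_sin_nonneg (hP : ClaspParams a b) (h : |t| ≤ Real.arcsin a) :
    0 ≤ claspH a b (Real.sin t) := by
  rcases hP with ⟨rfl, rfl⟩ | ⟨ha, ha1, hb, hb1⟩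
  · have : t = 0 := by simpa using h
    simp [this, claspH_zero]
  · exact claspH_nonneg ha ha1 hb hb1 (abs_sin_le_of_abs_le_arcsin ha.le ha1 h)

end

section
variable {k l m : ℕ} {τ b c : ℝ}

/-- In the reflected coordinates of `P₂` the copies of `γ` are convex upwards with highest points at
heights `0, …, m - 1`. The bound keeps them clear of the lower semicircles of the `α`'s, whose
center is the tip of the last copy. -/
lemma gamma_height_le (H : Params k l m τ) (i : Fin m) (t : ℝ) :
    (base k l m τ (.inr (.inr i)) t + depth k l m (.inr (.inr i)) •
      nrm (angle k l m τ (.inr (.inr i)) t)).2 ≤ m - 1 := by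
  have h1 := sub_trunc_mul_sin_nonneg (t := t) H.gammaAngle_nonneg H.gammaAngle_le
  have h2 : 0 ≤ claspH (τ / m) (τ / (k + l)) (Real.sin (trunc (gammaAngle m τ) t)) :=
    claspH_sin_nonneg H.clasp.symm (abs_trunc_le (t := t) H.gammaAngle_nonneg)
  have h3 := Real.cos_le_one (trunc (gammaAngle m τ) t)
  have h4 : (i : ℝ) + 1 ≤ m := by exact_mod_cast i.2
  have h5 : (0 : ℝ) ≤ i := by positivity
  simp only [base, depth, angle, tangentExt, claspArc, tng, nrm, Prod.snd_add, Prod.smul_mk,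
    smul_eq_mul]
  nlinarith

/-- The tangents of the closed convex curve at its upper half are tangents of `archBase`. Since the
straight ends of the `β`'s stay on the end tangents, this separates `α`'s from `β`'s. -/
lemma alpha_dot_le (H : Params k l m τ) {t ψ : ℝ}
    (ht : t ∈ Icc (-(Real.pi + ((m : ℝ) - 1))) (Real.pi + (m - 1))) (hψ : |ψ| ≤ Real.pi / 2) :
    dot (alphaBase (τ / (k + l)) (τ / m) (m - 1) t) (nrm ψ) ≤
      dot (archBase (τ / (k + l)) (τ / m) ψ) (nrm ψ) := by
  have hh := H.height_nonneg
  have hpi := Real.pi_pos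
  have := (alpha_front H.clasp hh).dot_le_of_closed (alphaAngle_end hh)
    (by rw [alphaAngle_neg, alphaAngle_end hh]) (alphaBase_end H.clasp hh) ht (t₀ := ψ)
    ⟨by linarith [(abs_le.1 hψ).1], by linarith [(abs_le.1 hψ).2]⟩
  rwa [alphaAngle_of_abs_le hψ, alphaBase_of_abs_le hψ] at this

lemma add_one_le_of_ne {i j : ℕ} (h : i ≠ j) : (i : ℝ) + 1 ≤ j ∨ (j : ℝ) + 1 ≤ i := by
  rcases lt_or_gt_of_ne h with h | h
  · left; exact_mod_cast h
  · right; exact_mod_cast h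

lemma one_le_dist_alpha_alpha (H : Params k l m τ) {i j : Fin k} (hij : i ≠ j) {s t : ℝ}
    (hs : s ∈ (claspConfig k l m τ b c).dom (.inl i))
    (ht : t ∈ (claspConfig k l m τ b c).dom (.inl j)) :
    1 ≤ dist ((claspConfig k l m τ b c).curve (.inl i) s)
      ((claspConfig k l m τ b c).curve (.inl j) t) := by
  have hh := H.height_nonneg
  have key := fun {t t₀} => (alpha_front H.clasp hh).dot_le_of_closed (t := t) (t₀ := t₀)
    (alphaAngle_end hh) (by rw [alphaAngle_neg, alphaAngle_end hh]) (alphaBase_end H.clasp hh)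
  rw [claspConfig_curve, claspConfig_curve]
  rcases add_one_le_of_ne (fun h => hij (Fin.ext h)) with h | h
  · rw [dist_comm]
    exact IsPlane.one_le_dist inner_embP₁ (key hs ht) (depth_nonneg (.inl i)) h
  · exact IsPlane.one_le_dist inner_embP₁ (key ht hs) (depth_nonneg (.inl j)) h

lemma one_le_dist_ext_ext {A : ℝ → ℝ × ℝ} {Θ : ℝ} {κ : ℝ → ℝ} {e : (ℝ × ℝ) →L[ℝ] E3}
    (he : IsPlane e) (F : Front (tangentExt A Θ) (trunc Θ) κ) (h0 : 0 ≤ Θ) (h1 : Θ ≤ Real.pi / 2)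
    {d d' : ℝ} (hd : 0 ≤ d) (hd' : d + 1 ≤ d') (s t : ℝ) :
    1 ≤ dist (e (tangentExt A Θ s + d' • nrm (trunc Θ s)))
      (e (tangentExt A Θ t + d • nrm (trunc Θ t))) := by
  refine he.one_le_dist (F.dot_le_of_abs_le ?_) hd hd'
  have h2 := abs_le.1 (abs_trunc_le (t := s) h0)
  have h3 := abs_le.1 (abs_trunc_le (t := t) h0)
  rw [abs_le]
  exact ⟨by linarith, by linarith⟩

lemma one_le_dist_alpha_beta (H : Params k l m τ) (i : Fin k) (j : Fin l) {s : ℝ} (t : ℝ)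
    (hs : s ∈ (claspConfig k l m τ b c).dom (.inl i)) :
    1 ≤ dist ((claspConfig k l m τ b c).curve (.inl i) s)
      ((claspConfig k l m τ b c).curve (.inr (.inl j)) t) := by
  rw [claspConfig_curve, claspConfig_curve, dist_comm]
  refine IsPlane.one_le_dist inner_embP₁ ?_ (depth_nonneg (.inl i)) ?_
  · simp only [base, angle]
    rw [dot_tangentExt]
    exact alpha_dot_le H hs ((abs_trunc_le H.betaAngle_nonneg).trans H.betaAngle_le)
  · have : (i : ℝ) + 1 ≤ k := by exact_mod_cast i.2
    have : (0 : ℝ) ≤ j := by positivity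
    simp only [depth]
    linarith

lemma gamma_dot (i : Fin m) (t : ℝ) :
    dot (claspArc (τ / m) (τ / (k + l)) (trunc (gammaAngle m τ) t))
        (nrm (trunc (gammaAngle m τ) t)) ≤
      dot (base k l m τ (.inr (.inr i)) t + depth k l m (.inr (.inr i)) •
        nrm (angle k l m τ (.inr (.inr i)) t)) (nrm (trunc (gammaAngle m τ) t)) := by
  simp only [base, angle]
  rw [dot_offset, dot_tangentExt]
  linarith [depth_nonneg (k := k) (l := l) (.inr (.inr i))]

lemma one_le_dist_alpha_gamma (H : Params k l m τ) (i : Fin k) (j : Fin m) {s : ℝ} (t : ℝ)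
    (hs : s ∈ (claspConfig k l m τ b c).dom (.inl i)) :
    1 ≤ dist ((claspConfig k l m τ b c).curve (.inl i) s)
      ((claspConfig k l m τ b c).curve (.inr (.inr j)) t) := by
  have hh := H.height_nonneg
  have hd := depth_nonneg (l := l) (m := m) (.inl i)
  rw [claspConfig_curve, claspConfig_curve]
  -- On the upper part and the vertical segments the shift is orthogonal to the normal, so the
  -- support inequality of the clasp applies. On the lower semicircle the radius points downwards,
  -- and `gamma_height_le` separates along it.
  rcases alpha_cases hh (abs_le.2 hs) with ⟨h1, h2⟩ | ⟨h1, h2, h3⟩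
  · refine one_le_dist_clasp H.clasp h1 (abs_trunc_le H.gammaAngle_nonneg) ?_ (gamma_dot j t)
    simp only [base, angle]
    rw [dot_offset, alphaBase, dot_add_left]
    have : dot (0, -alphaShift (m - 1) s) (nrm (alphaAngle (m - 1) s)) = 0 := by
      simp only [dot, nrm]; linarith
    linarith
  · refine one_le_dist_of_inner one_pos (IsPlane.norm_nrm inner_embP₁ (alphaAngle (m - 1) s)) ?_
    have hg := gamma_height_le H j t
    set Q := base k l m τ (.inr (.inr j)) t + depth k l m (.inr (.inr j)) •
      nrm (angle k l m τ (.inr (.inr j)) t)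
    have hB : base k l m τ (.inl i) s = nrm (alphaAngle (m - 1) s) + (0, -((m : ℝ) - 1)) := by
      simp only [base, alphaBase]
      rw [h3, archBase_of_ge H.clasp ((Real.arcsin_le_pi_div_two _).trans h1)]
      rfl
    rw [hB, inner_sub_left]
    simp only [emb, inner_embP₁, angle]
    rw [dot_offset, dot_add_left, dot_nrm_nrm, sub_self, Real.cos_zero]
    simp only [inner_E3, embP₁_apply, embP₂_apply, dot, nrm]
    simp
    nlinarith

lemma one_le_dist_beta_gamma (H : Params k l m τ) (i : Fin l) (j : Fin m) (s t : ℝ) :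
    1 ≤ dist ((claspConfig k l m τ b c).curve (.inr (.inl i)) s)
      ((claspConfig k l m τ b c).curve (.inr (.inr j)) t) := by
  have hd := depth_nonneg (k := k) (m := m) (.inr (.inl i))
  rw [claspConfig_curve, claspConfig_curve]
  refine one_le_dist_clasp H.clasp
    ((abs_trunc_le (t := s) H.betaAngle_nonneg).trans H.betaAngle_le)
    (abs_trunc_le H.gammaAngle_nonneg) ?_ (gamma_dot j t)
  simp only [base, angle]
  rw [dot_offset, dot_tangentExt]
  linarith

lemma one_le_dist_claspConfig (H : Params k l m τ) {i j : Fin k ⊕ Fin l ⊕ Fin m} (hij : i ≠ j)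
    {s t : ℝ} (hs : s ∈ (claspConfig k l m τ b c).dom i)
    (ht : t ∈ (claspConfig k l m τ b c).dom j) :
    1 ≤ dist ((claspConfig k l m τ b c).curve i s) ((claspConfig k l m τ b c).curve j t) := by
  rcases i with i | i | i <;> rcases j with j | j | j
  · exact one_le_dist_alpha_alpha H (fun h => hij (by rw [h])) hs ht
  · exact one_le_dist_alpha_beta H i j t hs
  · exact one_le_dist_alpha_gamma H i j t hs
  · rw [dist_comm]; exact one_le_dist_alpha_beta H j i s ht
  · have F := base_front H (.inr (.inl i))
    have F' := base_front H (.inr (.inl j))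
    rw [claspConfig_curve, claspConfig_curve]
    rcases add_one_le_of_ne (i := (i : ℕ)) (j := j) (fun h => hij (by rw [Fin.ext h])) with h | h
    · rw [dist_comm]
      exact one_le_dist_ext_ext inner_embP₁ F' H.betaAngle_nonneg H.betaAngle_le
        (depth_nonneg (.inr (.inl i))) (by simp only [depth]; linarith) t s
    · exact one_le_dist_ext_ext inner_embP₁ F H.betaAngle_nonneg H.betaAngle_le
        (depth_nonneg (.inr (.inl j))) (by simp only [depth]; linarith) s t
  · exact one_le_dist_beta_gamma H i j s t
  · rw [dist_comm]; exact one_le_dist_alpha_gamma H j i s ht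
  · rw [dist_comm]; exact one_le_dist_beta_gamma H j i t s
  · have F := base_front H (.inr (.inr i))
    have F' := base_front H (.inr (.inr j))
    rw [claspConfig_curve, claspConfig_curve]
    rcases add_one_le_of_ne (i := (i : ℕ)) (j := j) (fun h => hij (by rw [Fin.ext h])) with h | h
    · rw [dist_comm]
      exact one_le_dist_ext_ext inner_embP₂ F' H.gammaAngle_nonneg H.gammaAngle_le
        (depth_nonneg (.inr (.inr i))) h t s
    · exact one_le_dist_ext_ext inner_embP₂ F H.gammaAngle_nonneg H.gammaAngle_le
        (depth_nonneg (.inr (.inr j))) h s t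

end

section
variable {k l m : ℕ} {τ b c : ℝ}

/-! ### The configuration is a generalized link of thickness one -/

lemma hasDerivAt_nrm (θ : ℝ) : HasDerivAt nrm (tng θ) θ :=
  (Real.hasDerivAt_sin θ).prodMk (Real.hasDerivAt_cos θ)

lemma hasDerivAt_tng (θ : ℝ) : HasDerivAt tng (-nrm θ) θ :=
  (Real.hasDerivAt_cos θ).prodMk (Real.hasDerivAt_sin θ).neg

/-- The unit tangent of a component. -/
def tangentVec (k l m : ℕ) (τ : ℝ) (i : Fin k ⊕ Fin l ⊕ Fin m) (t : ℝ) : E3 :=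
  emb k l m i (tng (angle k l m τ i t))

/-- The unit normal of a component. -/
def normalVec (k l m : ℕ) (τ : ℝ) (i : Fin k ⊕ Fin l ⊕ Fin m) (t : ℝ) : E3 :=
  emb k l m i (nrm (angle k l m τ i t))

lemma norm_tangentVec (i : Fin k ⊕ Fin l ⊕ Fin m) (t : ℝ) : ‖tangentVec k l m τ i t‖ = 1 :=
  (emb_isPlane i).norm_tng _

lemma norm_normalVec (i : Fin k ⊕ Fin l ⊕ Fin m) (t : ℝ) : ‖normalVec k l m τ i t‖ = 1 :=
  (emb_isPlane i).norm_nrm _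

lemma tangentVec_lipschitz (H : Params k l m τ) (i : Fin k ⊕ Fin l ⊕ Fin m) :
    LipschitzWith (1 * 2) (tangentVec k l m τ i) := by
  have h1 : LipschitzWith 1 fun θ => emb k l m i (tng θ) := by
    have hd : ∀ θ, HasDerivAt (fun θ => emb k l m i (tng θ)) (emb k l m i (-nrm θ)) θ :=
      fun θ => (emb k l m i).hasFDerivAt.comp_hasDerivAt θ (hasDerivAt_tng θ)
    refine lipschitzWith_of_nnnorm_deriv_le (fun θ => (hd θ).differentiableAt) fun θ => ?_
    rw [(hd θ).deriv, map_neg, nnnorm_neg, ← NNReal.coe_le_coe, coe_nnnorm,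
      (emb_isPlane i).norm_nrm]
    simp
  exact h1.comp (base_front H i).lip

lemma normalVec_continuous (H : Params k l m τ) (i : Fin k ⊕ Fin l ⊕ Fin m) :
    Continuous (normalVec k l m τ i) := by
  have h := (base_front H i).lip.continuous
  unfold normalVec nrm
  fun_prop

lemma curve_continuous (H : Params k l m τ) (i : Fin k ⊕ Fin l ⊕ Fin m) :
    Continuous ((claspConfig k l m τ b c).curve i) := by
  have h := (base_front H i).lip.continuous
  have h' := (base_front H i).cont
  rw [show (claspConfig k l m τ b c).curve i = _ from funext (claspConfig_curve b c i)]
  unfold nrm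
  fun_prop

lemma curve_hasDerivAt (H : Params k l m τ) (i : Fin k ⊕ Fin l ⊕ Fin m) :
    ∃ (S : Finset ℝ) (C : ℝ) (s : ℝ → ℝ), 0 ≤ C ∧ ∀ t, t ∉ S →
      (HasDerivAt ((claspConfig k l m τ b c).curve i) (s t • tangentVec k l m τ i t) t ∧
        0 < s t ∧ s t ≤ C) ∧
      HasDerivAt (tangentVec k l m τ i) (-(turn k l m τ i t • normalVec k l m τ i t)) t := by
  obtain ⟨S, C, s, hS⟩ := (base_front H i).deriv
  have hd := depth_nonneg i
  refine ⟨S, max 0 (C + depth k l m i), fun t => s t + depth k l m i * turn k l m τ i t,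
    le_max_left _ _, fun t ht => ?_⟩
  obtain ⟨h1, h2, h3, h4, h5, h6⟩ := hS t ht
  refine ⟨⟨?_, by positivity, le_max_of_le_right (by nlinarith)⟩, ?_⟩
  · rw [show (claspConfig k l m τ b c).curve i = _ from funext (claspConfig_curve b c i)]
    have h7 := (hasDerivAt_nrm (angle k l m τ i t)).scomp t h4
    refine ((emb k l m i).hasFDerivAt.comp_hasDerivAt t
      (h1.add (h7.const_smul (depth k l m i)))).congr_deriv ?_
    simp only [tangentVec, map_add, map_smul]
    module
  · have h7 := (hasDerivAt_tng (angle k l m τ i t)).scomp t h4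
    refine ((emb k l m i).hasFDerivAt.comp_hasDerivAt t h7).congr_deriv ?_
    simp [normalVec]

lemma mem_plane {ν p : E3} (hν : ‖ν‖ = 1) (h : inner ℝ ν p = b) : p ∈ plane ν b := by
  rw [plane, AffineSubspace.mem_mk', Submodule.mem_orthogonal_singleton_iff_inner_right,
    vsub_eq_sub, inner_sub_right, real_inner_smul_right, real_inner_self_eq_norm_sq, hν, h]
  ring

lemma direction_plane {ν p : E3} (h : p ∈ (plane ν b).direction) : inner ℝ ν p = 0 := by
  rw [plane, AffineSubspace.direction_mk', Submodule.mem_orthogonal_singleton_iff_inner_right] at h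
  exact h

lemma betaNormal_true (Θ : ℝ) : betaNormal Θ true = embP₁ (tng Θ) := by
  simp [betaNormal, embP₁_apply, tng, sgn]

lemma betaNormal_false (Θ : ℝ) : betaNormal Θ false = embP₁ (-tng (-Θ)) := by
  simp [betaNormal, embP₁_apply, tng, sgn]

lemma gammaNormal_true (Φ : ℝ) : gammaNormal Φ true = embP₂ (tng Φ) := by
  simp [gammaNormal, embP₂_apply, tng, sgn]

lemma gammaNormal_false (Φ : ℝ) : gammaNormal Φ false = embP₂ (-tng (-Φ)) := by
  simp [gammaNormal, embP₂_apply, tng, sgn]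

lemma norm_betaNormal (Θ : ℝ) (e : Bool) : ‖betaNormal Θ e‖ = 1 := by
  cases e
  · rw [betaNormal_false, map_neg, norm_neg, IsPlane.norm_tng inner_embP₁]
  · rw [betaNormal_true, IsPlane.norm_tng inner_embP₁]

lemma norm_gammaNormal (Φ : ℝ) (e : Bool) : ‖gammaNormal Φ e‖ = 1 := by
  cases e
  · rw [gammaNormal_false, map_neg, norm_neg, IsPlane.norm_tng inner_embP₂]
  · rw [gammaNormal_true, IsPlane.norm_tng inner_embP₂]

lemma dot_nrm_tng (θ ψ : ℝ) : dot (nrm θ) (tng ψ) = Real.sin (θ - ψ) := by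
  simp [dot, nrm, tng, Real.sin_sub]; ring

lemma dot_tng_tng (θ ψ : ℝ) : dot (tng θ) (tng ψ) = Real.cos (θ - ψ) := by
  simp [dot, tng, Real.cos_sub]

/-- Position of the positive end of a tangent extension along its tangent. -/
lemma dot_ext_end {A : ℝ → ℝ × ℝ} {Θ d r : ℝ} (hΘ : 0 ≤ Θ) (hr : 0 ≤ r) :
    dot (tangentExt A Θ (Θ + r) + d • nrm (trunc Θ (Θ + r))) (tng Θ) = dot (A Θ) (tng Θ) + r := by
  rw [tangentExt, trunc_of_ge hΘ (by linarith)]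
  simp only [dot_add_left, dot_smul_left, dot_nrm_tng, dot_tng_tng]
  simp

lemma dot_ext_start {A : ℝ → ℝ × ℝ} {Θ d r : ℝ} (hΘ : 0 ≤ Θ) (hr : 0 ≤ r)
    (hA : ∀ θ, A (-θ) = (-(A θ).1, (A θ).2)) :
    dot (tangentExt A Θ (-(Θ + r)) + d • nrm (trunc Θ (-(Θ + r)))) (-tng (-Θ)) =
      dot (A Θ) (tng Θ) + r := by
  rw [← dot_ext_end (d := d) hΘ hr, tangentExt_neg hΘ hA, trunc_neg hΘ, nrm_neg, tng_neg]
  simp [dot]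
  ring

lemma archBase_betaAngle (H : Params k l m τ) :
    archBase (τ / (k + l)) (τ / m) (betaAngle l τ) = nrm (betaAngle l τ) :=
  archBase_of_ge H.clasp (H.arcsin_le_betaAngle.trans (le_abs_self _))

lemma dot_archBase_tng (H : Params k l m τ) :
    dot (archBase (τ / (k + l)) (τ / m) (betaAngle l τ)) (tng (betaAngle l τ)) = 0 := by
  rw [archBase_betaAngle H, dot_nrm_tng]; simp

lemma dot_claspArc_tng :
    dot (claspArc (τ / m) (τ / (k + l)) (gammaAngle m τ)) (tng (gammaAngle m τ)) =
      gammaArcEnd k l m τ := by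
  simp [dot, claspArc, tng, gammaArcEnd, bowlBase]

lemma inner_betaNormal_end (H : Params k l m τ) (hb : 0 < b) (i : Fin l) :
    inner ℝ (betaNormal (betaAngle l τ) true)
      ((claspConfig k l m τ b c).curve (.inr (.inl i)) (betaAngle l τ + b)) = b := by
  rw [claspConfig_curve, real_inner_comm, betaNormal_true]
  simp only [emb, inner_embP₁, base, angle]
  rw [dot_ext_end H.betaAngle_nonneg hb.le, dot_archBase_tng H, zero_add]

lemma inner_betaNormal_start (H : Params k l m τ) (hb : 0 < b) (i : Fin l) :
    inner ℝ (betaNormal (betaAngle l τ) false)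
      ((claspConfig k l m τ b c).curve (.inr (.inl i)) (-(betaAngle l τ + b))) = b := by
  rw [claspConfig_curve, real_inner_comm, betaNormal_false]
  simp only [emb, inner_embP₁, base, angle]
  rw [dot_ext_start H.betaAngle_nonneg hb.le fun _ => archBase_neg, dot_archBase_tng H, zero_add]

lemma inner_gammaNormal_end (H : Params k l m τ) (hc : gammaArcEnd k l m τ < c) (i : Fin m) :
    inner ℝ (gammaNormal (gammaAngle m τ) true) ((claspConfig k l m τ b c).curve (.inr (.inr i))
      (gammaAngle m τ + (c - gammaArcEnd k l m τ))) = c := by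
  rw [claspConfig_curve, real_inner_comm, gammaNormal_true]
  simp only [emb, inner_embP₂, base, angle]
  rw [dot_ext_end H.gammaAngle_nonneg (by linarith), dot_claspArc_tng]
  ring

lemma inner_gammaNormal_start (H : Params k l m τ) (hc : gammaArcEnd k l m τ < c) (i : Fin m) :
    inner ℝ (gammaNormal (gammaAngle m τ) false) ((claspConfig k l m τ b c).curve (.inr (.inr i))
      (-(gammaAngle m τ + (c - gammaArcEnd k l m τ)))) = c := by
  rw [claspConfig_curve, real_inner_comm, gammaNormal_false]
  simp only [emb, inner_embP₂, base, angle]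
  rw [dot_ext_start H.gammaAngle_nonneg (by linarith) fun _ => claspArc_neg, dot_claspArc_tng]
  ring

lemma fderiv_const_sub_inner_ne_zero {ν p : E3} (hν : ‖ν‖ = 1) :
    fderiv ℝ (fun p => b - inner ℝ ν p) p ≠ 0 := by
  have h : HasFDerivAt (fun p : E3 => b - inner ℝ ν p) (-innerSL ℝ ν) p :=
    (innerSL ℝ ν).hasFDerivAt.const_sub b
  rw [h.fderiv]
  intro h0
  have := congrArg (fun L => L ν) h0
  simp [hν] at this

lemma claspConfig_lo_lt_hi (H : Params k l m τ) (hb : 0 < b) (hc : gammaArcEnd k l m τ < c)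
    (i : Fin k ⊕ Fin l ⊕ Fin m) :
    (claspConfig k l m τ b c).lo i < (claspConfig k l m τ b c).hi i := by
  have h1 := H.height_nonneg
  have h2 := H.betaAngle_nonneg
  have h3 := H.gammaAngle_nonneg
  have h4 := Real.pi_pos
  rcases i with i | i | i <;> simp only [claspConfig] <;> linarith

lemma isGeneralizedLink_claspConfig (H : Params k l m τ) (h : PlanesFarEnough k l m τ b c) :
    (claspConfig k l m τ b c).IsGeneralizedLink where
  lo_lt_hi := claspConfig_lo_lt_hi H h.1 h.2.1
  lipschitz i := by
    obtain ⟨S, C, s, hC, hS⟩ := curve_hasDerivAt (b := b) (c := c) H i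
    refine ⟨_, lipschitzOnWith_of_hasDerivAt_off_finset S hC (curve_continuous H i).continuousOn
      fun t _ ht => ⟨(hS t ht).1.1, ?_⟩⟩
    rw [norm_smul, norm_tangentVec, mul_one, Real.norm_of_nonneg (hS t ht).1.2.1.le]
    exact (hS t ht).1.2.2
  closes_up i hi := by
    rcases i with i | i | i
    · rw [claspConfig_curve, claspConfig_curve]
      have hh := H.height_nonneg
      simp only [claspConfig, base, angle]
      rw [alphaBase_end H.clasp hh, alphaAngle_neg, alphaAngle_end hh]
      simp [nrm]
    · exact hi.elim
    · exact hi.elim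
  start_mem i hi := by
    rcases i with i | i | i
    · exact (hi trivial).elim
    · exact mem_plane (norm_betaNormal _ _) (inner_betaNormal_start H h.1 i)
    · exact mem_plane (norm_gammaNormal _ _) (inner_gammaNormal_start H h.2.1 i)
  end_mem i hi := by
    rcases i with i | i | i
    · exact (hi trivial).elim
    · exact mem_plane (norm_betaNormal _ _) (inner_betaNormal_end H h.1 i)
    · exact mem_plane (norm_gammaNormal _ _) (inner_gammaNormal_end H h.2.1 i)
  disjoint i j hij := by
    rw [Set.disjoint_left]
    rintro _ ⟨s, hs, rfl⟩ ⟨t, ht, hst⟩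
    have := one_le_dist_claspConfig H hij hs ht
    rw [hst, dist_self] at this
    linarith
  obst_contDiff j := by
    rcases j with e | e <;> exact contDiff_const.sub (contDiff_const.inner ℝ contDiff_id)
  obst_regular j p _ := by
    rcases j with e | e
    · exact fderiv_const_sub_inner_ne_zero (norm_betaNormal _ _)
    · exact fderiv_const_sub_inner_ne_zero (norm_gammaNormal _ _)
  avoids := h.2.2

/-- The components in `P₁`, from the innermost outwards. -/
def archIdx (k l m : ℕ) (j : Fin (k + l)) : Fin k ⊕ Fin l ⊕ Fin m :=
  (finSumFinEquiv.symm j).elim .inl (.inr ∘ .inl)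

lemma depth_archIdx (j : Fin (k + l)) : depth k l m (archIdx k l m j) = j := by
  obtain ⟨i, rfl⟩ := finSumFinEquiv.surjective j
  rcases i with i | i <;> simp [archIdx, depth]

/-- On the common arc all components in `P₁` are parallels of `archBase`. -/
lemma curve_archIdx (H : Params k l m τ) (j : Fin (k + l)) {θ : ℝ} (hθ : |θ| ≤ betaAngle l τ) :
    (claspConfig k l m τ b c).curve (archIdx k l m j) θ =
      embP₁ (archBase (τ / (k + l)) (τ / m) θ + (j : ℝ) • nrm θ) := by
  rw [claspConfig_curve, depth_archIdx, archIdx]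
  rcases finSumFinEquiv.symm j with i | i
  · simp only [Sum.elim_inl, emb, base, angle]
    rw [alphaBase_of_abs_le (hθ.trans H.betaAngle_le), alphaAngle_of_abs_le
      (hθ.trans H.betaAngle_le)]
  · simp only [Sum.elim_inr, emb, base, angle, Function.comp_apply]
    rw [tangentExt, trunc_of_abs_le hθ]
    simp

lemma mem_dom_archIdx (H : Params k l m τ) (hb : 0 < b) (j : Fin (k + l)) {θ : ℝ}
    (hθ : |θ| ≤ betaAngle l τ) : θ ∈ (claspConfig k l m τ b c).dom (archIdx k l m j) := by
  have h1 := H.height_nonneg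
  have h2 := H.betaAngle_le
  have h4 := Real.pi_pos
  have h5 := abs_le.1 hθ
  rw [archIdx]
  rcases finSumFinEquiv.symm j with i | i <;>
    constructor <;> simp only [claspConfig, Sum.elim_inl, Sum.elim_inr, Function.comp_apply] <;>
    linarith

lemma mem_dom_gamma (hc : gammaArcEnd k l m τ < c) (i : Fin m) {φ : ℝ}
    (hφ : |φ| ≤ gammaAngle m τ) : φ ∈ (claspConfig k l m τ b c).dom (.inr (.inr i)) := by
  have h5 := abs_le.1 hφ
  constructor <;> simp only [claspConfig] <;> linarith

lemma archIdx_ne_gamma (j : Fin (k + l)) (i : Fin m) : archIdx k l m j ≠ .inr (.inr i) := by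
  rw [archIdx]
  rcases finSumFinEquiv.symm j with i | i <;> simp

lemma archIdx_injective : Function.Injective (archIdx k l m) := by
  intro i j h
  have := congrArg (depth k l m) h
  rw [depth_archIdx, depth_archIdx] at this
  exact Fin.ext (by exact_mod_cast this)

lemma curve_gamma (i : Fin m) {φ : ℝ} (hφ : |φ| ≤ gammaAngle m τ) :
    (claspConfig k l m τ b c).curve (.inr (.inr i)) φ =
      embP₂ (claspArc (τ / m) (τ / (k + l)) φ + (i : ℝ) • nrm φ) := by
  rw [claspConfig_curve]
  simp only [emb, base, angle, depth]
  rw [tangentExt, trunc_of_abs_le hφ]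
  simp

lemma curve_gamma_tip (i : Fin m) (H : Params k l m τ) :
    (claspConfig k l m τ b c).curve (.inr (.inr i)) 0 = embP₂ (0, (i : ℝ)) := by
  rw [curve_gamma i (by rw [abs_zero]; exact H.gammaAngle_nonneg)]
  congr 1
  simp [claspArc, claspX_zero, claspH_zero, nrm]

lemma curve_archIdx_circle (H : Params k l m τ) (j : Fin (k + l)) {θ : ℝ}
    (hθ : |θ| ≤ betaAngle l τ) (hθ' : Real.arcsin (τ / (k + l)) ≤ |θ|) (hj : (j : ℕ) = 0) :
    (claspConfig k l m τ b c).curve (archIdx k l m j) θ = embP₁ (nrm θ) := by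
  rw [curve_archIdx H j hθ, archBase_of_ge H.clasp hθ', hj]
  simp [nrm]

/-- The value 1 is attained between the tip of the innermost `γ` and the end of the clasp arc of the
innermost curve in `P₁`, which lies on the unit circle about that tip. This choice also works for `τ
= 0`. -/
lemma gThi_claspConfig (H : Params k l m τ) (hb : 0 < b) (hc : gammaArcEnd k l m τ < c) :
    (claspConfig k l m τ b c).gThi (claspConfig k l m τ b c).pos = 1 := by
  have hn : 0 < k + l := by have := H.one_le_l; omega
  have hA : |Real.arcsin (τ / (k + l))| = Real.arcsin (τ / (k + l)) :=
    abs_of_nonneg (Real.arcsin_nonneg.2 H.clasp.nonneg)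
  have h1 : |Real.arcsin (τ / (k + l))| ≤ betaAngle l τ := hA.trans_le H.arcsin_le_betaAngle
  have h0 : |(0 : ℝ)| ≤ gammaAngle m τ := by rw [abs_zero]; exact H.gammaAngle_nonneg
  refine IsLeast.csInf_eq ⟨⟨archIdx k l m ⟨0, hn⟩, .inr (.inr ⟨0, H.one_le_m⟩),
    archIdx_ne_gamma _ _, ⟨_, mem_dom_archIdx H hb _ h1⟩, ⟨0, mem_dom_gamma hc _ h0⟩, ?_⟩, ?_⟩
  · simp only [GenLink.pos]
    rw [curve_archIdx_circle H _ h1 hA.ge rfl, curve_gamma_tip _ H, dist_eq_norm]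
    simp only [Nat.cast_zero, Prod.mk_zero_zero, map_zero, sub_zero]
    exact (IsPlane.norm_nrm inner_embP₁ _).symm
  · rintro _ ⟨i, j, hij, s, t, rfl⟩
    exact one_le_dist_claspConfig H hij s.2 t.2

end

/-! ### One-sided derivatives of thickness and obstacle minimum -/

namespace GenLink
variable {ι κ : Type} [Finite ι]

/-- The compact family consists of all pairs of points on different components. The lower bound
required by `exists_hasDerivWithinAt_sInf` is the tangent line bound for the convex function `t ↦ ‖A
+ t • V‖`, obtained from Cauchy–Schwarz. -/
lemma exists_hasDerivWithinAt_gThi (L : GenLink ι κ) (hc : ∀ i, Continuous (L.curve i))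
    (h1 : ∀ i j, i ≠ j → ∀ s ∈ L.dom i, ∀ t ∈ L.dom j, 1 ≤ dist (L.curve i s) (L.curve j t))
    {i₀ j₀ : ι} (hij : i₀ ≠ j₀) (hi : (L.dom i₀).Nonempty) (hj : (L.dom j₀).Nonempty)
    (ξ : L.VF) :
    ∃ a, HasDerivWithinAt (fun t => L.gThi (L.move ξ t)) a (Ici 0) 0 ∧
      ∀ i j, i ≠ j → ∀ (s : L.dom i) (t : L.dom j), dist (L.curve i s) (L.curve j t) = 1 →
        a ≤ inner ℝ (L.curve i s - L.curve j t) (ξ i s - ξ j t) := by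
  let Y := Σ p : {p : ι × ι // p.1 ≠ p.2}, L.dom p.1.1 × L.dom p.1.2
  let A : Y → E3 := fun y => L.curve y.1.1.1 y.2.1 - L.curve y.1.1.2 y.2.2
  let V : Y → E3 := fun y => ξ y.1.1.1 y.2.1 - ξ y.1.1.2 y.2.2
  have hA : Continuous A := by
    refine continuous_sigma fun p => ?_
    have h2 := hc p.1.1
    have h3 := hc p.1.2
    change Continuous fun y : L.dom p.1.1 × L.dom p.1.2 => L.curve p.1.1 y.1 - L.curve p.1.2 y.2
    fun_prop
  have hV : Continuous V := by
    refine continuous_sigma fun p => ?_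
    change Continuous fun y : L.dom p.1.1 × L.dom p.1.2 => ξ p.1.1 y.1 - ξ p.1.2 y.2
    fun_prop
  have hA1 : ∀ y, 1 ≤ ‖A y‖ := fun y => by
    have := h1 _ _ y.1.2 y.2.1 y.2.1.2 y.2.2 y.2.2.2
    rwa [dist_eq_norm] at this
  have hA0 : ∀ y, A y ≠ 0 := fun y h => by
    have := hA1 y
    rw [h, norm_zero] at this
    linarith
  have : Nonempty Y := ⟨⟨⟨(i₀, j₀), hij⟩, ⟨_, hi.some_mem⟩, ⟨_, hj.some_mem⟩⟩⟩
  obtain ⟨a, ha, ha'⟩ := exists_hasDerivWithinAt_sInf (Y := Y) (fun t y => ‖A y + t • V y‖)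
    (fun y => ‖A y‖) (fun y => inner ℝ (A y) (V y) / ‖A y‖) hA.norm
    ((hA.inner hV).div hA.norm fun y => (norm_pos_iff.2 (hA0 y)).ne')
    (fun t _ y => by
      have h2 := real_inner_le_norm (A y) (A y + t • V y)
      rw [inner_add_right, real_inner_self_eq_norm_sq, real_inner_smul_right] at h2
      have h3 := norm_pos_iff.2 (hA0 y)
      rw [← sub_nonneg] at h2 ⊢
      have : ‖A y + t • V y‖ - (‖A y‖ + t * (inner ℝ (A y) (V y) / ‖A y‖)) =
        (‖A y‖ * ‖A y + t • V y‖ - (‖A y‖ ^ 2 + t * inner ℝ (A y) (V y))) / ‖A y‖ := by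
        field_simp
      rw [this]
      positivity)
    (fun y => by simp)
    (fun y => (hasDerivAt_norm_add_smul (V y) (hA0 y)).hasDerivWithinAt)
  refine ⟨a, ?_, fun i j hij s t hst => ?_⟩
  · convert ha using 2 with t
    unfold gThi
    congr 1
    ext d
    constructor
    · rintro ⟨i, j, hij, s, s', rfl⟩
      refine ⟨⟨⟨(i, j), hij⟩, s, s'⟩, ?_⟩
      simp only [A, V, move, dist_eq_norm]
      congr 1
      module
    · rintro ⟨⟨⟨⟨i, j⟩, hij⟩, s, s'⟩, rfl⟩
      refine ⟨i, j, hij, s, s', ?_⟩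
      simp only [A, V, move, dist_eq_norm]
      congr 1
      module
  · have h2 := ha' ⟨⟨(i, j), hij⟩, s, t⟩ fun y => by
      refine le_trans (le_of_eq ?_) (hA1 y)
      simp only [A, ← dist_eq_norm]
      exact hst
    rw [dist_eq_norm] at hst
    simpa [A, V, hst] using h2

/-- The obstacle functions are affine, so the family depends on time exactly affinely and the
required lower bound is an equality. -/
lemma exists_hasDerivWithinAt_obstMin [Finite κ] [Nonempty κ] (L : GenLink ι κ)
    (hc : ∀ i, Continuous (L.curve i))
    (ho : ∀ j, ∃ (r : ℝ) (ν : E3), ∀ p, L.obst j p = r - inner ℝ ν p)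
    {i₀ : ι} (hi : (L.dom i₀).Nonempty) (ξ : L.VF) :
    ∃ a, HasDerivWithinAt (fun t => L.obstMin (L.move ξ t)) a (Ici 0) 0 := by
  choose r ν ho using ho
  let Y := Σ p : κ × ι, L.dom p.2
  let g₀ : Y → ℝ := fun y => r y.1.1 - inner ℝ (ν y.1.1) (L.curve y.1.2 y.2)
  let g₁ : Y → ℝ := fun y => -inner ℝ (ν y.1.1) (ξ y.1.2 y.2)
  have h0 : Continuous g₀ := by
    refine continuous_sigma fun p => ?_
    have h2 := hc p.2
    change Continuous fun y : L.dom p.2 => r p.1 - inner ℝ (ν p.1) (L.curve p.2 y)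
    fun_prop
  have h1 : Continuous g₁ := by
    refine continuous_sigma fun p => ?_
    change Continuous fun y : L.dom p.2 => -inner ℝ (ν p.1) (ξ p.2 y)
    fun_prop
  have : Nonempty Y := ⟨⟨(Classical.arbitrary κ, i₀), ⟨_, hi.some_mem⟩⟩⟩
  obtain ⟨a, ha, -⟩ := exists_hasDerivWithinAt_sInf (Y := Y) (fun t y => g₀ y + t * g₁ y) g₀ g₁
    h0 h1 (fun t _ y => le_rfl) (fun y => by simp) (fun y => by
      have := ((hasDerivAt_id (0 : ℝ)).mul_const (g₁ y)).const_add (g₀ y)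
      simpa using this.hasDerivWithinAt)
  refine ⟨a, ?_⟩
  convert ha using 2 with t
  unfold obstMin
  congr 1
  ext d
  constructor
  · rintro ⟨j, i, s, rfl⟩
    refine ⟨⟨(j, i), s⟩, ?_⟩
    simp only [g₀, g₁, move, ho, inner_add_right, real_inner_smul_right]
    ring
  · rintro ⟨⟨⟨j, i⟩, s⟩, rfl⟩
    refine ⟨j, i, s, ?_⟩
    simp only [g₀, g₁, move, ho, inner_add_right, real_inner_smul_right]
    ring

end GenLink

/-! ### The first variation of length -/

/-- The functional `ξ ↦ ⟪v, ξ(hi)⟫ - ⟪w, ξ(lo)⟫ + ∫ κ ⟪N, ξ⟫` on vector fields along an interval. -/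
lemma exists_variation_functional {lo hi : ℝ} (hlh : lo ≤ hi) (v w : E3) {N : ℝ → E3} {κ : ℝ → ℝ}
    (hN : Continuous N) (hN1 : ∀ t, ‖N t‖ = 1) (hκ : Measurable κ)
    (hκ1 : ∀ t, 0 ≤ κ t ∧ κ t ≤ 1) :
    ∃ D : C(Icc lo hi, E3) →L[ℝ] ℝ, ∀ ξ, D ξ = inner ℝ v (ξ ⟨hi, right_mem_Icc.2 hlh⟩) -
      inner ℝ w (ξ ⟨lo, left_mem_Icc.2 hlh⟩) +
      ∫ t in lo..hi, κ t * inner ℝ (N t) (ξ (projIcc lo hi hlh t)) := by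
  have hInt : ∀ ξ : C(Icc lo hi, E3), IntervalIntegrable
      (fun t => κ t * inner ℝ (N t) (ξ (projIcc lo hi hlh t))) volume lo hi := by
    intro ξ
    have h1 : Continuous fun t => inner ℝ (N t) (ξ (projIcc lo hi hlh t)) :=
      hN.inner (ξ.continuous.comp continuous_projIcc)
    have h2 : IntervalIntegrable κ volume lo hi := by
      refine (intervalIntegrable_const (c := (1 : ℝ))).mono_fun hκ.aestronglyMeasurable ?_
      refine Eventually.of_forall fun t => ?_
      beta_reduce
      rw [Real.norm_of_nonneg (hκ1 t).1]
      simpa using (hκ1 t).2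
    exact h2.mul_continuousOn h1.continuousOn
  refine ⟨LinearMap.mkContinuous
    { toFun := fun ξ => inner ℝ v (ξ ⟨hi, right_mem_Icc.2 hlh⟩) -
        inner ℝ w (ξ ⟨lo, left_mem_Icc.2 hlh⟩) +
        ∫ t in lo..hi, κ t * inner ℝ (N t) (ξ (projIcc lo hi hlh t))
      map_add' := fun ξ ζ => ?_
      map_smul' := fun r ξ => ?_ } (‖v‖ + ‖w‖ + |hi - lo|) fun ξ => ?_, fun ξ => rfl⟩
  · simp only [ContinuousMap.add_apply, inner_add_right, mul_add]
    rw [intervalIntegral.integral_add (hInt ξ) (hInt ζ)]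
    ring
  · simp only [ContinuousMap.smul_apply, real_inner_smul_right, smul_eq_mul, RingHom.id_apply]
    rw [show (fun t => κ t * (r * inner ℝ (N t) (ξ (projIcc lo hi hlh t)))) =
      fun t => r * (κ t * inner ℝ (N t) (ξ (projIcc lo hi hlh t))) by funext t; ring,
      intervalIntegral.integral_const_mul]
    ring
  · have hx : ∀ x, ‖ξ x‖ ≤ ‖ξ‖ := ξ.norm_coe_le_norm
    have h1 := (abs_real_inner_le_norm v (ξ ⟨hi, right_mem_Icc.2 hlh⟩)).trans
      (mul_le_mul_of_nonneg_left (hx _) (norm_nonneg v))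
    have h2 := (abs_real_inner_le_norm w (ξ ⟨lo, left_mem_Icc.2 hlh⟩)).trans
      (mul_le_mul_of_nonneg_left (hx _) (norm_nonneg w))
    have h3 : ‖∫ t in lo..hi, κ t * inner ℝ (N t) (ξ (projIcc lo hi hlh t))‖ ≤
        ‖ξ‖ * |hi - lo| := by
      refine norm_integral_le_of_norm_le_const fun t _ => ?_
      rw [norm_mul, Real.norm_of_nonneg (hκ1 t).1, Real.norm_eq_abs]
      have h4 := abs_real_inner_le_norm (N t) (ξ (projIcc lo hi hlh t))
      rw [hN1, one_mul] at h4
      have := (hκ1 t).2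
      have := (hκ1 t).1
      nlinarith [abs_nonneg (inner ℝ (N t) (ξ (projIcc lo hi hlh t))), hx (projIcc lo hi hlh t)]
    change |_| ≤ _
    rw [Real.norm_eq_abs] at h3
    refine (abs_add_le _ _).trans ?_
    have := (abs_sub _ _).trans (add_le_add h1 h2)
    linarith

section
variable {k l m : ℕ} {τ b c : ℝ}

lemma measurable_turn (i : Fin k ⊕ Fin l ⊕ Fin m) : Measurable (turn k l m τ i) := by
  have h1 : ∀ h, alphaTurn h = fun t => alphaTurn h t := fun _ => rfl
  have h2 : ∀ Θ, extTurn Θ = fun t => extTurn Θ t := fun _ => rfl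
  rcases i with i | i | i <;> simp only [turn] <;> first | rw [h1] | rw [h2]
  all_goals
    simp only [alphaTurn, extTurn]
    refine Measurable.ite ?_ measurable_const measurable_const
  · exact (measurableSet_le continuous_abs.measurable measurable_const).union
      (measurableSet_le measurable_const continuous_abs.measurable)
  · exact measurableSet_le (by fun_prop) (by fun_prop)
  · exact measurableSet_le (by fun_prop) (by fun_prop)

lemma turn_mem (i : Fin k ⊕ Fin l ⊕ Fin m) (t : ℝ) :
    0 ≤ turn k l m τ i t ∧ turn k l m τ i t ≤ 1 := by
  rcases i with i | i | i <;> simp only [turn, alphaTurn, extTurn] <;> split_ifs <;> simp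

/-- A vector field along a component, extended to the whole line. -/
def extField (h : ∀ i, (claspConfig k l m τ b c).lo i ≤ (claspConfig k l m τ b c).hi i)
    (ξ : (claspConfig k l m τ b c).VF) (i : Fin k ⊕ Fin l ⊕ Fin m) (t : ℝ) : E3 :=
  ξ i (projIcc _ _ (h i) t)

lemma extField_continuous (h : ∀ i, (claspConfig k l m τ b c).lo i ≤ (claspConfig k l m τ b c).hi i)
    (ξ : (claspConfig k l m τ b c).VF) (i : Fin k ⊕ Fin l ⊕ Fin m) :
    Continuous (extField h ξ i) := (ξ i).continuous.comp continuous_projIcc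

lemma extField_of_mem (h : ∀ i, (claspConfig k l m τ b c).lo i ≤ (claspConfig k l m τ b c).hi i)
    (ξ : (claspConfig k l m τ b c).VF) {i : Fin k ⊕ Fin l ⊕ Fin m} {t : ℝ}
    (ht : t ∈ (claspConfig k l m τ b c).dom i) : extField h ξ i t = ξ i ⟨t, ht⟩ := by
  rw [extField, projIcc_of_mem _ ht]

lemma exists_isFirstVariationLen (H : Params k l m τ)
    (h : ∀ i, (claspConfig k l m τ b c).lo i ≤ (claspConfig k l m τ b c).hi i) :
    ∃ D : (claspConfig k l m τ b c).VF →L[ℝ] ℝ,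
      (claspConfig k l m τ b c).IsFirstVariationLen (fun _ => 1) D ∧
      ∀ ξ, D ξ = ∑ i, (inner ℝ (tangentVec k l m τ i ((claspConfig k l m τ b c).hi i))
          (ξ i ⟨_, right_mem_Icc.2 (h i)⟩) -
        inner ℝ (tangentVec k l m τ i ((claspConfig k l m τ b c).lo i))
          (ξ i ⟨_, left_mem_Icc.2 (h i)⟩) +
        ∫ t in ((claspConfig k l m τ b c).lo i)..((claspConfig k l m τ b c).hi i),
          turn k l m τ i t * inner ℝ (normalVec k l m τ i t) (extField h ξ i t)) := by
  choose D hD using fun i => exists_variation_functional (h i)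
    (tangentVec k l m τ i ((claspConfig k l m τ b c).hi i))
    (tangentVec k l m τ i ((claspConfig k l m τ b c).lo i)) (normalVec_continuous H i)
    (norm_normalVec i) (measurable_turn (τ := τ) i) (turn_mem i)
  refine ⟨∑ i, (D i).comp (ContinuousLinearMap.proj i), fun η hη => ?_, fun ξ => ?_⟩
  · simp only [GenLink.wlen, one_mul]
    rw [sum_apply]
    refine HasDerivAt.fun_sum fun i _ => ?_
    obtain ⟨S, C, s, -, hS⟩ := curve_hasDerivAt (b := b) (c := c) H i
    obtain ⟨K, hK⟩ := hη i
    refine (hasDerivAt_integral_norm_deriv (h i) S (fun t _ ht => (hS t ht).1)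
      (norm_tangentVec i) (tangentVec_lipschitz H i) (fun t _ ht => (hS t ht).2) hK).congr_deriv ?_
    simp only [ContinuousLinearMap.comp_apply, ContinuousLinearMap.proj_apply, hD]
    congr 1
    refine intervalIntegral.integral_congr fun t ht => ?_
    rw [uIcc_of_le (h i)] at ht
    simp only [projIcc_of_mem _ ht, ContinuousMap.restrict_apply]
  · rw [sum_apply]
    exact Finset.sum_congr rfl fun i _ => hD i (ξ i)

end

/-! ### Integrals over the clasp arcs -/

section
variable {α : ℝ}

lemma hasDerivAt_arcsin_mul {r : ℝ} (h0 : 0 < α) (h1 : α ≤ 1) (hr : r ∈ Ioo (0 : ℝ) 1) :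
    HasDerivAt (fun r => Real.arcsin (α * r)) (α / √(1 - (α * r) ^ 2)) r := by
  have h2 : α * r < 1 := by nlinarith [hr.1, hr.2]
  have h3 : 0 < α * r := mul_pos h0 hr.1
  refine ((Real.hasDerivAt_arcsin (by linarith) h2.ne).comp r
    ((hasDerivAt_id r).const_mul α)).congr_deriv ?_
  simp
  ring

lemma intervalIntegrable_arcsin_mul (h0 : 0 < α) (h1 : α ≤ 1) :
    IntervalIntegrable (fun r => α / √(1 - (α * r) ^ 2)) volume 0 1 := by
  refine intervalIntegrable_deriv_of_nonneg (g := fun r => Real.arcsin (α * r))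
    (Real.continuous_arcsin.comp (by fun_prop)).continuousOn ?_ ?_
  · intro r hr
    simp only [zero_le_one, inf_of_le_left, sup_of_le_right] at hr
    exact hasDerivAt_arcsin_mul h0 h1 hr
  · intro r _
    positivity

lemma intervalIntegrable_comp_arcsin {F : ℝ → ℝ} (hF : Continuous F) (h0 : 0 < α) (h1 : α ≤ 1) :
    IntervalIntegrable (fun r => F (Real.arcsin (α * r)) * (α / √(1 - (α * r) ^ 2))) volume 0 1 :=
  (intervalIntegrable_arcsin_mul h0 h1).continuousOn_mul
    (hF.comp (Real.continuous_arcsin.comp (by fun_prop))).continuousOn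

/-- The substitution `sin θ = α * r` expresses integrals over both clasp arcs in the common
parameter `r` of their touching pairs. -/
lemma integral_comp_arcsin {F : ℝ → ℝ} (hF : Continuous F) (h0 : 0 < α) (h1 : α ≤ 1) :
    ∫ r in (0 : ℝ)..1, F (Real.arcsin (α * r)) * (α / √(1 - (α * r) ^ 2)) =
      ∫ θ in (0 : ℝ)..Real.arcsin α, F θ := by
  have := intervalIntegral.integral_comp_mul_deriv''' (a := 0) (b := 1)
    (f := fun r => Real.arcsin (α * r)) (f' := fun r => α / √(1 - (α * r) ^ 2)) (g := F)
    (Real.continuous_arcsin.comp (by fun_prop)).continuousOn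
    (fun r hr => by
      simp only [zero_le_one, inf_of_le_left, sup_of_le_right] at hr
      exact (hasDerivAt_arcsin_mul h0 h1 hr).hasDerivWithinAt)
    hF.continuousOn
    (hF.continuousOn.integrableOn_compact
      (isCompact_uIcc.image (Real.continuous_arcsin.comp (by fun_prop))))
    (by
      rw [uIcc_of_le zero_le_one, integrableOn_Icc_iff_integrableOn_Ioc,
        ← intervalIntegrable_iff_integrableOn_Ioc_of_le zero_le_one]
      exact intervalIntegrable_comp_arcsin hF h0 h1)
  simpa using this

/-- The density, with respect to the parameter `r`, of the contact force of the clasp. -/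
def claspDensity (a₁ a₂ r : ℝ) : ℝ :=
  √(1 - (a₁ * r) ^ 2 * (a₂ * (1 - r)) ^ 2) / (√(1 - (a₁ * r) ^ 2) * √(1 - (a₂ * (1 - r)) ^ 2))

lemma claspDensity_intervalIntegrable {a₁ a₂ : ℝ} (h1 : 0 < a₁) (h1' : a₁ ≤ 1) (h2 : 0 < a₂)
    (h2' : a₂ ≤ 1) : IntervalIntegrable (claspDensity a₁ a₂) volume 0 1 := by
  have i1 := (intervalIntegrable_arcsin_mul h1 h1').const_mul (2 / a₁)
  have i2 : IntervalIntegrable (fun r => 2 / a₂ * (a₂ / √(1 - (a₂ * (1 - r)) ^ 2))) volume 0 1 := by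
    have := ((intervalIntegrable_arcsin_mul h2 h2').comp_sub_left 1).symm
    simp only [sub_self, sub_zero] at this
    exact this.const_mul (2 / a₂)
  refine (i1.add i2).mono_fun' ?_ ?_
  · exact (Measurable.div (by fun_prop) (by fun_prop)).aestronglyMeasurable
  · rw [EventuallyLE, ae_restrict_iff' measurableSet_uIoc]
    filter_upwards [Measure.ae_ne volume (1 : ℝ)] with r hr1 hr
    rw [uIoc_of_le zero_le_one] at hr
    have hr1 : r < 1 := lt_of_le_of_ne hr.2 hr1
    have e1 : 2 / a₁ * (a₁ / √(1 - (a₁ * r) ^ 2)) = 2 / √(1 - (a₁ * r) ^ 2) := by field_simp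
    have e2 : 2 / a₂ * (a₂ / √(1 - (a₂ * (1 - r)) ^ 2)) = 2 / √(1 - (a₂ * (1 - r)) ^ 2) := by
      field_simp
    rw [e1, e2, Real.norm_of_nonneg (by unfold claspDensity; positivity), claspDensity]
    set u := a₁ * r with hu
    set v := a₂ * (1 - r) with hv
    have hu0 : 0 < u := mul_pos h1 hr.1
    have hv0 : 0 < v := mul_pos h2 (by linarith)
    have hu1 : u ≤ r := by rw [hu]; nlinarith [hr.1]
    have hv1 : v ≤ 1 - r := by rw [hv]; nlinarith
    have hp : 0 < √(1 - u ^ 2) := Real.sqrt_pos.2 (by nlinarith)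
    have hq : 0 < √(1 - v ^ 2) := Real.sqrt_pos.2 (by nlinarith [hr.1])
    have hr' : √(1 - u ^ 2 * v ^ 2) ≤ 1 := by
      rw [Real.sqrt_le_one]
      have : 0 ≤ u ^ 2 * v ^ 2 := by positivity
      linarith
    -- Since `u ≤ r` and `v ≤ 1 - r`, one of `u`, `v` is at most `1 / 2`, so the two square roots
    -- are never small together. Hence the density is bounded by a sum of two integrable terms, each
    -- singular at one end at most.
    have hpq : 1 ≤ 2 * √(1 - u ^ 2) + 2 * √(1 - v ^ 2) := by
      rcases le_total r (1 / 2) with h | h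
      · have : (1 / 2 : ℝ) ≤ √(1 - u ^ 2) := Real.le_sqrt_of_sq_le (by nlinarith)
        linarith
      · have : (1 / 2 : ℝ) ≤ √(1 - v ^ 2) := Real.le_sqrt_of_sq_le (by nlinarith)
        linarith
    rw [div_add_div _ _ hp.ne' hq.ne']
    gcongr
    linarith

/-- The total contact force of the clasp bounds the curvature force of both arcs. -/
lemma clasp_integral_ge {a₁ a₂ a : ℝ} (h1 : 0 < a₁) (h1' : a₁ ≤ 1) (h2 : 0 < a₂) (h2' : a₂ ≤ 1)
    {F G : ℝ → ℝ} (hF : Continuous F) (hG : Continuous G)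
    (h : ∀ r ∈ Ioo (0 : ℝ) 1, 2 * a * √(1 - (a₁ * r) ^ 2 * (a₂ * (1 - r)) ^ 2) ≤
      √(1 - (a₂ * (1 - r)) ^ 2) * F (Real.arcsin (a₁ * r)) +
        √(1 - (a₁ * r) ^ 2) * G (Real.arcsin (a₂ * (1 - r)))) :
    2 * a * (∫ r in (0 : ℝ)..1, claspDensity a₁ a₂ r) ≤
      (∫ θ in (0 : ℝ)..Real.arcsin a₁, F θ) / a₁ + (∫ φ in (0 : ℝ)..Real.arcsin a₂, G φ) / a₂ := by
  have iF := intervalIntegrable_comp_arcsin hF h1 h1'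
  have iG := intervalIntegrable_comp_arcsin hG h2 h2'
  have iG' := (iG.comp_sub_left 1).symm
  simp only [sub_self, sub_zero] at iG'
  have eG : ∫ r in (0 : ℝ)..1, G (Real.arcsin (a₂ * (1 - r))) * (a₂ / √(1 - (a₂ * (1 - r)) ^ 2)) =
      ∫ φ in (0 : ℝ)..Real.arcsin a₂, G φ := by
    rw [← integral_comp_arcsin hG h2 h2', intervalIntegral.integral_comp_sub_left
      (fun r => G (Real.arcsin (a₂ * r)) * (a₂ / √(1 - (a₂ * r) ^ 2))) 1]
    simp
  rw [← eG, ← integral_comp_arcsin hF h1 h1', ← intervalIntegral.integral_const_mul,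
    ← intervalIntegral.integral_div, ← intervalIntegral.integral_div,
    ← intervalIntegral.integral_add (iF.div_const a₁) (iG'.div_const a₂)]
  refine intervalIntegral.integral_mono_on_of_le_Ioo zero_le_one
    ((claspDensity_intervalIntegrable h1 h1' h2 h2').const_mul (2 * a))
    ((iF.div_const a₁).add (iG'.div_const a₂)) fun r hr => ?_
  have hr' := h r hr
  have hu0 : 0 < a₁ * r := mul_pos h1 hr.1
  have hv0 : 0 < a₂ * (1 - r) := mul_pos h2 (by linarith [hr.2])
  have hu1 : a₁ * r < 1 := by nlinarith [hr.1, hr.2]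
  have hv1 : a₂ * (1 - r) < 1 := by nlinarith [hr.1, hr.2]
  unfold claspDensity
  generalize a₁ * r = u at *
  generalize a₂ * (1 - r) = v at *
  have hp : 0 < √(1 - u ^ 2) := Real.sqrt_pos.2 (by nlinarith)
  have hq : 0 < √(1 - v ^ 2) := Real.sqrt_pos.2 (by nlinarith)
  -- Dividing the pointwise hypothesis by both cosines produces exactly the Jacobians of the two
  -- arcsine substitutions.
  have e : F (Real.arcsin u) * (a₁ / √(1 - u ^ 2)) / a₁ + G (Real.arcsin v) *
      (a₂ / √(1 - v ^ 2)) / a₂ = (√(1 - v ^ 2) * F (Real.arcsin u) +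
        √(1 - u ^ 2) * G (Real.arcsin v)) / (√(1 - u ^ 2) * √(1 - v ^ 2)) := by
    field_simp
  rw [e, ← mul_div_assoc]
  gcongr

end

/-! ### Splitting the curvature integrals -/

lemma integral_symm {f : ℝ → ℝ} {R : ℝ} (hf : ∀ x y, IntervalIntegrable f volume x y) :
    ∫ t in (-R)..R, f t = ∫ t in (0 : ℝ)..R, (f t + f (-t)) := by
  have h : IntervalIntegrable (fun t => f (-t)) volume 0 R := by
    simpa using (IntervalIntegrable.iff_comp_neg (f := f) (a := -0) (b := -R)).1 (hf _ _)
  rw [intervalIntegral.integral_add (hf 0 R) h, intervalIntegral.integral_comp_neg, neg_zero,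
    add_comm, intervalIntegral.integral_add_adjacent_intervals (hf _ _) (hf _ _)]

lemma integral_extTurn_mul {g : ℝ → ℝ} (hg : Continuous g) {Θ r : ℝ} (hΘ : 0 ≤ Θ) (hr : 0 ≤ r)
    (hi : ∀ x y, IntervalIntegrable (fun t => extTurn Θ t * g t) volume x y) :
    ∫ t in (-(Θ + r))..(Θ + r), extTurn Θ t * g t = ∫ t in (0 : ℝ)..Θ, (g t + g (-t)) := by
  have e1 : ∫ t in (-(Θ + r))..(-Θ), extTurn Θ t * g t = 0 := by
    refine (intervalIntegral.integral_congr_Ioo_of_le (g := fun _ => 0) (by linarith) fun t ht => ?_).trans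
      (by simp)
    rw [extTurn, if_neg, zero_mul]
    rw [abs_of_neg (by linarith [ht.2])]
    linarith [ht.2]
  have e2 : ∫ t in Θ..(Θ + r), extTurn Θ t * g t = 0 := by
    refine (intervalIntegral.integral_congr_Ioo_of_le (g := fun _ => 0) (by linarith) fun t ht => ?_).trans
      (by simp)
    rw [extTurn, if_neg, zero_mul]
    rw [abs_of_pos (by linarith [ht.1])]
    linarith [ht.1]
  have e3 : ∫ t in (-Θ)..Θ, extTurn Θ t * g t = ∫ t in (-Θ)..Θ, g t := by
    refine intervalIntegral.integral_congr fun t ht => ?_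
    rw [uIcc_of_le (by linarith)] at ht
    rw [extTurn, if_pos (abs_le.2 ht), one_mul]
  rw [← intervalIntegral.integral_add_adjacent_intervals (hi _ Θ) (hi _ _),
    ← intervalIntegral.integral_add_adjacent_intervals (hi _ (-Θ)) (hi _ Θ), e1, e2, e3,
    integral_symm fun x y => hg.intervalIntegrable x y]
  ring

lemma integral_alphaTurn_mul {g : ℝ → ℝ} {h : ℝ} (hh : 0 ≤ h)
    (hi : ∀ x y, IntervalIntegrable (fun t => alphaTurn h t * g t) volume x y) :
    ∫ t in (-(Real.pi + h))..(Real.pi + h), alphaTurn h t * g t =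
      (∫ t in (0 : ℝ)..(Real.pi / 2), (g t + g (-t))) +
        ∫ t in (Real.pi / 2 + h)..(Real.pi + h), (g t + g (-t)) := by
  have hpi := Real.pi_pos
  have hi' : ∀ x y, IntervalIntegrable (fun t => alphaTurn h t * g t +
      alphaTurn h (-t) * g (-t)) volume x y := fun x y => by
    have := (IntervalIntegrable.iff_comp_neg
      (f := fun t => alphaTurn h t * g t) (a := -x) (b := -y)).1 (hi (-x) (-y))
    simp only [neg_neg] at this
    exact (hi x y).add this
  have e1 : ∫ t in (Real.pi / 2)..(Real.pi / 2 + h), (alphaTurn h t * g t +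
      alphaTurn h (-t) * g (-t)) = 0 := by
    refine (intervalIntegral.integral_congr_Ioo_of_le (g := fun _ => 0) (by linarith) fun t ht => ?_).trans
      (by simp)
    have : ¬ (|t| ≤ Real.pi / 2 ∨ Real.pi / 2 + h ≤ |t|) := by
      rw [abs_of_pos (by linarith [ht.1])]
      push Not
      exact ht
    simp [alphaTurn, abs_neg, if_neg this]
  have e2 : ∀ x y, x ≤ y → (∀ t ∈ Icc x y, |t| ≤ Real.pi / 2 ∨ Real.pi / 2 + h ≤ |t|) →
      ∫ t in x..y, (alphaTurn h t * g t + alphaTurn h (-t) * g (-t)) =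
        ∫ t in x..y, (g t + g (-t)) := by
    intro x y hxy hh
    refine intervalIntegral.integral_congr fun t ht => ?_
    rw [uIcc_of_le hxy] at ht
    simp [alphaTurn, abs_neg, if_pos (hh t ht)]
  rw [integral_symm hi, ← intervalIntegral.integral_add_adjacent_intervals 
      (hi' _ (Real.pi / 2 + h)) (hi' _ _),
    ← intervalIntegral.integral_add_adjacent_intervals (hi' _ (Real.pi / 2)) (hi' _ (Real.pi / 2 + h)), e1,
    e2 _ _ (by linarith), e2 _ _ (by linarith)]
  · ring
  · intro t ht
    exact .inr (ht.1.trans (le_abs_self t))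
  · intro t ht
    exact .inl (by rw [abs_of_nonneg ht.1]; exact ht.2)

section
variable {k l m : ℕ} {τ b c a : ℝ} {X : Fin k ⊕ Fin l ⊕ Fin m → ℝ → E3}

/-! ### Force balance -/

/-- Under the velocity field `X`, the distance of any two touching points of different components
grows at least at the rate `a`. -/
def Separating (k l m : ℕ) (τ b c a : ℝ) (X : Fin k ⊕ Fin l ⊕ Fin m → ℝ → E3) : Prop :=
  ∀ i j, i ≠ j → ∀ s ∈ (claspConfig k l m τ b c).dom i, ∀ t ∈ (claspConfig k l m τ b c).dom j,
    dist ((claspConfig k l m τ b c).curve i s) ((claspConfig k l m τ b c).curve j t) = 1 →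
    a ≤ inner ℝ ((claspConfig k l m τ b c).curve i s - (claspConfig k l m τ b c).curve j t)
      (X i s - X j t)

/-- The normal speed of a component. -/
def push (τ : ℝ) (X : Fin k ⊕ Fin l ⊕ Fin m → ℝ → E3) (i : Fin k ⊕ Fin l ⊕ Fin m) (t : ℝ) : ℝ :=
  inner ℝ (normalVec k l m τ i t) (X i t)

/-- The total normal speed at two symmetric points of a component. -/
def pull (τ : ℝ) (X : Fin k ⊕ Fin l ⊕ Fin m → ℝ → E3) (i : Fin k ⊕ Fin l ⊕ Fin m) (t : ℝ) : ℝ :=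
  push τ X i t + push τ X i (-t)

lemma push_continuous (H : Params k l m τ) (hX : ∀ i, Continuous (X i))
    (i : Fin k ⊕ Fin l ⊕ Fin m) : Continuous (push τ X i) :=
  (normalVec_continuous H i).inner (hX i)

lemma pull_continuous (H : Params k l m τ) (hX : ∀ i, Continuous (X i))
    (i : Fin k ⊕ Fin l ⊕ Fin m) : Continuous (pull τ X i) :=
  (push_continuous H hX i).add ((push_continuous H hX i).comp continuous_neg)

lemma Separating.le_inner (hK : Separating k l m τ b c a X) {i j : Fin k ⊕ Fin l ⊕ Fin m}
    (hij : i ≠ j) {s t : ℝ} (hs : s ∈ (claspConfig k l m τ b c).dom i)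
    (ht : t ∈ (claspConfig k l m τ b c).dom j) {v : E3} (hv : ‖v‖ = 1)
    (h : (claspConfig k l m τ b c).curve i s = (claspConfig k l m τ b c).curve j t + v) :
    inner ℝ v (X j t) + a ≤ inner ℝ v (X i s) := by
  have e : (claspConfig k l m τ b c).curve i s - (claspConfig k l m τ b c).curve j t = v := by
    rw [h, add_sub_cancel_left]
  have := hK i j hij s hs t ht (by rw [dist_eq_norm, e, hv])
  rw [e, inner_sub_right] at this
  linarith

lemma add_mul_le_of_step {n : ℕ} (hn : 0 < n) {f : Fin n → ℝ}
    (h : ∀ i j : Fin n, (j : ℕ) = i + 1 → f i + a ≤ f j) (i : Fin n) : f ⟨0, hn⟩ + i * a ≤ f i := by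
  obtain ⟨i, hi⟩ := i
  induction i with
  | zero => simp
  | succ i ih =>
    have h1 := ih (by omega)
    have h2 := h ⟨i, by omega⟩ ⟨i + 1, hi⟩ rfl
    push_cast
    push_cast at h1
    linarith

lemma normalVec_archIdx (H : Params k l m τ) (j : Fin (k + l)) {θ : ℝ}
    (hθ : |θ| ≤ betaAngle l τ) : normalVec k l m τ (archIdx k l m j) θ = embP₁ (nrm θ) := by
  rw [normalVec, archIdx]
  rcases finSumFinEquiv.symm j with i | i
  · simp only [Sum.elim_inl, emb, angle]
    rw [alphaAngle_of_abs_le (hθ.trans H.betaAngle_le)]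
  · simp only [Sum.elim_inr, emb, angle, Function.comp_apply]
    rw [trunc_of_abs_le hθ]

lemma normalVec_gamma (i : Fin m) {φ : ℝ} (hφ : |φ| ≤ gammaAngle m τ) :
    normalVec k l m τ (.inr (.inr i)) φ = embP₂ (nrm φ) := by
  simp only [normalVec, emb, angle]
  rw [trunc_of_abs_le hφ]

namespace Separating

/-- On `|θ| ≤ Θ` the points with the same `θ` on consecutive curves in `P₁` differ by their common
unit normal, so they touch; the estimate telescopes from the innermost curve. -/
lemma push_archIdx (hK : Separating k l m τ b c a X) (H : Params k l m τ) (hb : 0 < b)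
    (hn : 0 < k + l) (j : Fin (k + l)) {θ : ℝ} (hθ : |θ| ≤ betaAngle l τ) :
    push τ X (archIdx k l m ⟨0, hn⟩) θ + j * a ≤ push τ X (archIdx k l m j) θ := by
  refine add_mul_le_of_step hn (f := fun j => push τ X (archIdx k l m j) θ) (fun i j hij => ?_) j
  simp only [push, normalVec_archIdx H _ hθ]
  refine hK.le_inner (fun h => ?_) (mem_dom_archIdx H hb _ hθ) (mem_dom_archIdx H hb _ hθ)
    (IsPlane.norm_nrm inner_embP₁ θ) ?_
  · have := archIdx_injective h
    rw [this] at hij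
    omega
  · rw [curve_archIdx H _ hθ, curve_archIdx H _ hθ, ← map_add, hij]
    congr 1
    push_cast
    module

lemma push_gamma (hK : Separating k l m τ b c a X) (hc : gammaArcEnd k l m τ < c)
    (hm : 0 < m) (i : Fin m) {φ : ℝ} (hφ : |φ| ≤ gammaAngle m τ) :
    push τ X (.inr (.inr ⟨0, hm⟩)) φ + i * a ≤ push τ X (.inr (.inr i)) φ := by
  refine add_mul_le_of_step hm (f := fun j => push τ X (.inr (.inr j)) φ) (fun i j hij => ?_) i
  simp only [push, normalVec_gamma _ hφ]
  refine hK.le_inner (fun h => ?_) (mem_dom_gamma hc _ hφ) (mem_dom_gamma hc _ hφ)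
    (IsPlane.norm_nrm inner_embP₂ φ) ?_
  · simp only [Sum.inr.injEq] at h
    rw [h] at hij
    omega
  · rw [curve_gamma _ hφ, curve_gamma _ hφ, ← map_add, hij]
    congr 1
    push_cast
    module

lemma push_alpha (hK : Separating k l m τ b c a X) (hk : 0 < k) (i : Fin k) {t : ℝ}
    (ht : t ∈ Icc (-(Real.pi + ((m : ℝ) - 1))) (Real.pi + (m - 1))) :
    push τ X (.inl ⟨0, hk⟩) t + i * a ≤ push τ X (.inl i) t := by
  refine add_mul_le_of_step hk (f := fun j => push τ X (.inl j) t) (fun i j hij => ?_) i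
  refine hK.le_inner (i := .inl j) (j := .inl i) (fun h => ?_) ht ht
    (norm_normalVec (l := l) (τ := τ) (.inl j) t) ?_
  · simp only [Sum.inl.injEq] at h
    rw [h] at hij
    omega
  · rw [claspConfig_curve, claspConfig_curve, normalVec]
    simp only [emb, base, angle, depth]
    rw [← map_add, hij]
    congr 1
    push_cast
    module

end Separating

lemma inner_embP₁_nrm_add (θ : ℝ) (y : E3) :
    inner ℝ (embP₁ (nrm θ)) y + inner ℝ (embP₁ (nrm (-θ))) y = 2 * Real.cos θ * y 2 := by
  simp [inner_E3, embP₁_apply, nrm]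
  ring

lemma push_gamma_zero (H : Params k l m τ) (i : Fin m) :
    push τ X (.inr (.inr i)) 0 = -X (.inr (.inr i)) 0 2 := by
  rw [push, normalVec_gamma _ (by rw [abs_zero]; exact H.gammaAngle_nonneg)]
  simp [inner_E3, embP₂_apply, nrm]

namespace Separating

/-- The tips of the `γ`'s form a vertical stack of touching points. It transmits the load of the
lower semicircles to the innermost tip. -/
lemma height_gamma (hK : Separating k l m τ b c a X) (H : Params k l m τ)
    (hc : gammaArcEnd k l m τ < c) (hm : 0 < m) :
    X (.inr (.inr ⟨m - 1, by omega⟩)) 0 2 + (m - 1) * a ≤ X (.inr (.inr ⟨0, hm⟩)) 0 2 := by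
  have := hK.push_gamma hc hm ⟨m - 1, by omega⟩ (φ := 0)
    (by rw [abs_zero]; exact H.gammaAngle_nonneg)
  rw [push_gamma_zero H, push_gamma_zero H, Nat.cast_sub hm] at this
  push_cast at this
  linarith

/-- A component in `P₁` which is the unit circle about the tip of a component in `P₂`. -/
lemma push_circle (hK : Separating k l m τ b c a X) (H : Params k l m τ)
    (hc : gammaArcEnd k l m τ < c) {i : Fin k ⊕ Fin l ⊕ Fin m} {j : Fin m}
    (hij : i ≠ .inr (.inr j)) {t θ : ℝ} (ht : t ∈ (claspConfig k l m τ b c).dom i)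
    (hN : normalVec k l m τ i t = embP₁ (nrm θ))
    (h : (claspConfig k l m τ b c).curve i t = embP₁ (nrm θ + (0, -(j : ℝ)))) :
    inner ℝ (embP₁ (nrm θ)) (X (.inr (.inr j)) 0) + a ≤ push τ X i t := by
  rw [push, hN]
  refine hK.le_inner hij ht (mem_dom_gamma hc _ (by rw [abs_zero]; exact H.gammaAngle_nonneg))
    (IsPlane.norm_nrm inner_embP₁ θ) ?_
  rw [h, curve_gamma_tip _ H, map_add, add_comm]
  rfl

/-- On the unit circle the strut is the radius to the tip. Adding the struts at `±θ` cancels the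
horizontal motion of the tip and leaves its vertical speed with factor `2 * cos θ`. -/
lemma pull_arch_circle (hK : Separating k l m τ b c a X) (H : Params k l m τ) (hb : 0 < b)
    (hc : gammaArcEnd k l m τ < c) (hn : 0 < k + l) (hm : 0 < m) {θ : ℝ}
    (hθ : |θ| ≤ betaAngle l τ) (hθ' : Real.arcsin (τ / (k + l)) ≤ |θ|) :
    2 * Real.cos θ * X (.inr (.inr ⟨0, hm⟩)) 0 2 + 2 * a ≤ pull τ X (archIdx k l m ⟨0, hn⟩) θ := by
  have key : ∀ θ, |θ| ≤ betaAngle l τ → Real.arcsin (τ / (k + l)) ≤ |θ| →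
      inner ℝ (embP₁ (nrm θ)) (X (.inr (.inr ⟨0, hm⟩)) 0) + a ≤
        push τ X (archIdx k l m ⟨0, hn⟩) θ := fun θ hθ hθ' => by
    refine hK.push_circle H hc (archIdx_ne_gamma _ _) (mem_dom_archIdx H hb _ hθ)
      (normalVec_archIdx H _ hθ) ?_
    rw [curve_archIdx_circle H _ hθ hθ' rfl]
    simp [Prod.mk_zero_zero, -Prod.mk_eq_zero]
  have h1 := key θ hθ hθ'
  have h2 := key (-θ) (by rwa [abs_neg]) (by rwa [abs_neg])
  have h3 := inner_embP₁_nrm_add θ (X (.inr (.inr ⟨0, hm⟩)) 0)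
  rw [pull]
  linarith

/-- One contact leads from the tip to the innermost `α` and `i` more lead to copy `i`, whence the
factor `i + 1`. -/
lemma pull_alpha_upper (hK : Separating k l m τ b c a X) (H : Params k l m τ)
    (hc : gammaArcEnd k l m τ < c) (hm : 0 < m) (i : Fin k) {θ : ℝ}
    (hθ : |θ| ≤ Real.pi / 2) (hθ' : Real.arcsin (τ / (k + l)) ≤ |θ|) :
    2 * Real.cos θ * X (.inr (.inr ⟨0, hm⟩)) 0 2 + 2 * (i + 1) * a ≤ pull τ X (.inl i) θ := by
  have hk : 0 < k := i.pos
  have hh := H.height_nonneg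
  have hpi := Real.pi_pos
  have key : ∀ θ, |θ| ≤ Real.pi / 2 → Real.arcsin (τ / (k + l)) ≤ |θ| →
      inner ℝ (embP₁ (nrm θ)) (X (.inr (.inr ⟨0, hm⟩)) 0) + a + i * a ≤
        push τ X (.inl i) θ := fun θ hθ hθ' => by
    have hmem : θ ∈ Icc (-(Real.pi + ((m : ℝ) - 1))) (Real.pi + (m - 1)) := by
      have := abs_le.1 hθ
      constructor <;> linarith
    refine le_trans ?_ (hK.push_alpha hk i hmem)
    gcongr
    refine hK.push_circle H hc (by simp) hmem ?_ ?_
    · simp only [normalVec, emb, angle]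
      rw [alphaAngle_of_abs_le hθ]
    · rw [claspConfig_curve]
      simp only [emb, base, angle, depth]
      rw [alphaAngle_of_abs_le hθ, alphaBase_of_abs_le hθ, archBase_of_ge H.clasp hθ']
      simp [nrm]
  have h1 := key θ hθ hθ'
  have h2 := key (-θ) (by rwa [abs_neg]) (by rwa [abs_neg])
  have h3 := inner_embP₁_nrm_add θ (X (.inr (.inr ⟨0, hm⟩)) 0)
  rw [pull]
  linarith

/-- Here the circle is centered at the tip of the outermost `γ`, index `m - 1`; the cosine is
nonpositive, so these contacts push that tip the opposite way. -/
lemma pull_alpha_lower (hK : Separating k l m τ b c a X) (H : Params k l m τ)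
    (hc : gammaArcEnd k l m τ < c) (hm : 0 < m) (i : Fin k) {t : ℝ}
    (ht : Real.pi / 2 + (m - 1) ≤ t) (ht' : t ≤ Real.pi + (m - 1)) :
    2 * Real.cos (t - (m - 1)) * X (.inr (.inr ⟨m - 1, by omega⟩)) 0 2 + 2 * (i + 1) * a ≤
      pull τ X (.inl i) t := by
  have hk : 0 < k := i.pos
  have hh := H.height_nonneg
  have hpi := Real.pi_pos
  have hA := Real.arcsin_le_pi_div_two (τ / (k + l))
  have key : ∀ s θ, |s| = t → alphaAngle (m - 1) s = θ → |θ| = t - (m - 1) →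
      inner ℝ (embP₁ (nrm θ)) (X (.inr (.inr ⟨m - 1, by omega⟩)) 0) + a + i * a ≤
        push τ X (.inl i) s := fun s θ hs hθ hθ' => by
    have hmem : s ∈ Icc (-(Real.pi + ((m : ℝ) - 1))) (Real.pi + (m - 1)) :=
      abs_le.1 (hs.trans_le ht')
    refine le_trans ?_ (hK.push_alpha hk i hmem)
    gcongr
    refine hK.push_circle H hc (by simp) hmem ?_ ?_
    · simp only [normalVec, emb, angle]
      rw [hθ]
    · rw [claspConfig_curve]
      simp only [emb, base, angle, depth]
      have hsh : alphaShift (m - 1) s = m - 1 := by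
        rcases abs_choice s with h | h <;> rw [h] at hs
        · rw [hs]; exact alphaShift_of_ge hh ht
        · rw [← alphaShift_neg, hs]; exact alphaShift_of_ge hh ht
      rw [alphaBase, hsh, hθ, archBase_of_ge H.clasp (by rw [hθ']; linarith)]
      simp [nrm, Nat.cast_sub hm]
  have e1 := alphaAngle_of_ge hh ht
  have e2 : |t| = t := abs_of_nonneg (by linarith)
  have e3 : |t - (m - 1)| = t - (m - 1) := abs_of_nonneg (by linarith)
  have h1 := key t (t - (m - 1)) e2 e1 e3
  have h2 := key (-t) (-(t - (m - 1))) (by rwa [abs_neg]) (by rw [alphaAngle_neg, e1])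
    (by rwa [abs_neg])
  have h3 := inner_embP₁_nrm_add (t - (m - 1)) (X (.inr (.inr ⟨m - 1, by omega⟩)) 0)
  rw [pull]
  linarith

end Separating


/-- For a fixed point of the first arc, the two strut directions to the mirror points of the second
add up to `2 * cos φ / ρ` times its normal; similarly for the second arc, with `cos θ` and the
opposite sign. So adding all four hypotheses leaves normal speeds only. -/
lemma clasp_force_sum {x x' y y' : E3} {θ φ ρ : ℝ} (hρ : 0 < ρ)
    (k1 : inner ℝ (!₂[Real.sin θ * Real.cos φ / ρ, -(Real.sin φ * Real.cos θ / ρ),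
        Real.cos θ * Real.cos φ / ρ] : E3) y + a ≤
      inner ℝ (!₂[Real.sin θ * Real.cos φ / ρ, -(Real.sin φ * Real.cos θ / ρ),
        Real.cos θ * Real.cos φ / ρ] : E3) x)
    (k2 : inner ℝ (!₂[Real.sin θ * Real.cos φ / ρ, - -(Real.sin φ * Real.cos θ / ρ),
        Real.cos θ * Real.cos φ / ρ] : E3) y' + a ≤
      inner ℝ (!₂[Real.sin θ * Real.cos φ / ρ, - -(Real.sin φ * Real.cos θ / ρ),
        Real.cos θ * Real.cos φ / ρ] : E3) x)
    (k3 : inner ℝ (!₂[-(Real.sin θ * Real.cos φ / ρ), -(Real.sin φ * Real.cos θ / ρ),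
        Real.cos θ * Real.cos φ / ρ] : E3) y + a ≤
      inner ℝ (!₂[-(Real.sin θ * Real.cos φ / ρ), -(Real.sin φ * Real.cos θ / ρ),
        Real.cos θ * Real.cos φ / ρ] : E3) x')
    (k4 : inner ℝ (!₂[-(Real.sin θ * Real.cos φ / ρ), - -(Real.sin φ * Real.cos θ / ρ),
        Real.cos θ * Real.cos φ / ρ] : E3) y' + a ≤
      inner ℝ (!₂[-(Real.sin θ * Real.cos φ / ρ), - -(Real.sin φ * Real.cos θ / ρ),
        Real.cos θ * Real.cos φ / ρ] : E3) x') :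
    2 * a * ρ ≤ Real.cos φ * (inner ℝ (embP₁ (nrm θ)) x + inner ℝ (embP₁ (nrm (-θ))) x') +
      Real.cos θ * (inner ℝ (embP₂ (nrm φ)) y + inner ℝ (embP₂ (nrm (-φ))) y') := by
  simp only [inner_E3, embP₁_apply, embP₂_apply, nrm, Fin.isValue,
    Matrix.cons_val_zero, Matrix.cons_val_one, Matrix.cons_val, Real.sin_neg,
    Real.cos_neg] at k1 k2 k3 k4 ⊢
  have ks := mul_le_mul_of_nonneg_right (add_le_add (add_le_add k1 k2) (add_le_add k3 k4)) hρ.le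
  have d1 : Real.sin θ * Real.cos φ / ρ * ρ = Real.sin θ * Real.cos φ := by field_simp
  have d2 : Real.sin φ * Real.cos θ / ρ * ρ = Real.sin φ * Real.cos θ := by field_simp
  have d3 : Real.cos θ * Real.cos φ / ρ * ρ = Real.cos θ * Real.cos φ := by field_simp
  generalize Real.sin θ * Real.cos φ / ρ = p at *
  generalize Real.sin φ * Real.cos θ / ρ = q at *
  generalize Real.cos θ * Real.cos φ / ρ = r at *
  have g1 := congrArg (fun z => z * (x 0 - x' 0)) d1
  have g2 := congrArg (fun z => z * (y 1 - y' 1)) d2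
  have g3 := congrArg (fun z => z * (x 2 + x' 2 - y 2 - y' 2)) d3
  simp only at g1 g2 g3
  linarith

/-- The four contacts of a clasp at the angles `±θ`, `±φ`. -/
lemma Separating.clasp_contact (hK : Separating k l m τ b c a X) (H : Params k l m τ) (hb : 0 < b)
    (hc : gammaArcEnd k l m τ < c) (hτ : 0 < τ) (hn : 0 < k + l) (hm : 0 < m) {θ φ : ℝ}
    (hθ0 : 0 ≤ θ) (hθ : θ ≤ Real.arcsin (τ / (k + l))) (hφ0 : 0 ≤ φ) (hφ : φ ≤ gammaAngle m τ)
    (h : Real.sin φ = τ / m * (1 - Real.sin θ / (τ / (k + l)))) :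
    2 * a * √(1 - Real.sin θ ^ 2 * Real.sin φ ^ 2) ≤
      Real.cos φ * pull τ X (archIdx k l m ⟨0, hn⟩) θ +
        Real.cos θ * pull τ X (.inr (.inr ⟨0, hm⟩)) φ := by
  have hP := H.clasp
  have ha : 0 < τ / (k + l) := div_pos hτ H.n_pos
  have hm' : 0 < τ / m := div_pos hτ H.m_pos
  obtain ⟨hρ, e1, e2, e3⟩ := clasp_touch ha hP.le_one hm' hP.symm.le_one hθ0 hθ hφ0 hφ h
  set ρ := √(1 - Real.sin θ ^ 2 * Real.sin φ ^ 2) with hρd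
  have hρ2 : ρ ^ 2 = 1 - Real.sin θ ^ 2 * Real.sin φ ^ 2 :=
    Real.sq_sqrt (Real.sqrt_pos.1 hρ).le
  have hθβ : |θ| ≤ betaAngle l τ := by
    rw [abs_of_nonneg hθ0]; exact hθ.trans H.arcsin_le_betaAngle
  have hφγ : |φ| ≤ gammaAngle m τ := by rwa [abs_of_nonneg hφ0]
  have i1 := Real.sin_sq_add_cos_sq θ
  have i2 := Real.sin_sq_add_cos_sq φ
  -- The signs `s` and `s'` choose the mirror images of the two points; all four strut directions
  -- come from one computation.
  have key : ∀ s s' : ℝ, (s = 1 ∨ s = -1) → (s' = 1 ∨ s' = -1) →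
      inner ℝ (!₂[s * (Real.sin θ * Real.cos φ / ρ), -(s' * (Real.sin φ * Real.cos θ / ρ)),
        Real.cos θ * Real.cos φ / ρ] : E3) (X (.inr (.inr ⟨0, hm⟩)) (s' * φ)) + a ≤
      inner ℝ (!₂[s * (Real.sin θ * Real.cos φ / ρ), -(s' * (Real.sin φ * Real.cos θ / ρ)),
        Real.cos θ * Real.cos φ / ρ] : E3) (X (archIdx k l m ⟨0, hn⟩) (s * θ)) := by
    intro s s' hs hs'
    have as : |s * θ| ≤ betaAngle l τ := by rcases hs with rfl | rfl <;> simpa using hθβ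
    have as' : |s' * φ| ≤ gammaAngle m τ := by rcases hs' with rfl | rfl <;> simpa using hφγ
    have ss : s ^ 2 = 1 := by rcases hs with rfl | rfl <;> norm_num
    have ss' : s' ^ 2 = 1 := by rcases hs' with rfl | rfl <;> norm_num
    refine hK.le_inner (archIdx_ne_gamma _ _) (mem_dom_archIdx H hb _ as)
      (mem_dom_gamma hc _ as') ?_ ?_
    · rw [← sq_eq_sq₀ (norm_nonneg _) zero_le_one, ← real_inner_self_eq_norm_sq, inner_E3]
      simp only [Fin.isValue, Matrix.cons_val_zero, Matrix.cons_val_one,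
        Matrix.cons_val]
      field_simp
      rw [hρ2, ss, ss']
      linear_combination Real.cos φ ^ 2 * i1 + Real.sin φ ^ 2 * i1 + i2
    · have eA : archBase (τ / (k + l)) (τ / m) (s * θ) =
          (s * (archBase (τ / (k + l)) (τ / m) θ).1, (archBase (τ / (k + l)) (τ / m) θ).2) := by
        rcases hs with rfl | rfl
        · simp
        · simp [archBase_neg]
      have eC : claspArc (τ / m) (τ / (k + l)) (s' * φ) =
          (s' * (claspArc (τ / m) (τ / (k + l)) φ).1, (claspArc (τ / m) (τ / (k + l)) φ).2) := by
        rcases hs' with rfl | rfl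
        · simp
        · simp [claspArc_neg]
      rw [curve_archIdx H _ as, curve_gamma _ as', eA, eC, e1]
      simp only [claspArc, e2, embP₁_apply, embP₂_apply]
      ext q
      fin_cases q
      · simp
      · simp
      · simp
        linarith
  have hN1 := normalVec_archIdx (m := m) H ⟨0, hn⟩ hθβ
  have hN2 := normalVec_archIdx (m := m) H ⟨0, hn⟩ (θ := -θ) (by rwa [abs_neg])
  have hN3 := normalVec_gamma (k := k) (l := l) ⟨0, hm⟩ hφγ
  have hN4 := normalVec_gamma (k := k) (l := l) (τ := τ) ⟨0, hm⟩ (φ := -φ) (by rwa [abs_neg])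
  have k1 := key 1 1 (.inl rfl) (.inl rfl)
  have k2 := key 1 (-1) (.inl rfl) (.inr rfl)
  have k3 := key (-1) 1 (.inr rfl) (.inl rfl)
  have k4 := key (-1) (-1) (.inr rfl) (.inr rfl)
  simp only [pull, push, hN1, hN2, hN3, hN4]
  simp only [one_mul, neg_one_mul] at k1 k2 k3 k4
  generalize X (archIdx k l m ⟨0, hn⟩) θ = x at *
  generalize X (archIdx k l m ⟨0, hn⟩) (-θ) = x' at *
  generalize X (.inr (.inr ⟨0, hm⟩)) φ = y at *
  generalize X (.inr (.inr ⟨0, hm⟩)) (-φ) = y' at *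
  exact clasp_force_sum hρ k1 k2 k3 k4

end

/-! ### Integration of the contact inequalities over the components. -/

section
variable {k l m : ℕ} {τ b c a : ℝ} {X : Fin k ⊕ Fin l ⊕ Fin m → ℝ → E3}

lemma intervalIntegrable_turn_mul (H : Params k l m τ) (hX : ∀ i, Continuous (X i))
    (i : Fin k ⊕ Fin l ⊕ Fin m) (x y : ℝ) :
    IntervalIntegrable (fun t => turn k l m τ i t * push τ X i t) volume x y := by
  have h2 : IntervalIntegrable (turn k l m τ i) volume x y := by
    refine (intervalIntegrable_const (c := (1 : ℝ))).mono_fun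
      (measurable_turn i).aestronglyMeasurable (Eventually.of_forall fun t => ?_)
    have := turn_mem (τ := τ) i t
    simpa [abs_of_nonneg this.1] using this.2
  exact h2.mul_continuousOn (push_continuous H hX i).continuousOn

lemma integral_turn_alpha (H : Params k l m τ) (hX : ∀ i, Continuous (X i)) (i : Fin k) :
    ∫ t in ((claspConfig k l m τ b c).lo (.inl i))..((claspConfig k l m τ b c).hi (.inl i)),
        turn k l m τ (.inl i) t * push τ X (.inl i) t =
      (∫ t in (0 : ℝ)..betaAngle l τ, pull τ X (.inl i) t) +
        (∫ t in (betaAngle l τ)..(Real.pi / 2), pull τ X (.inl i) t) +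
        ∫ t in (Real.pi / 2 + (m - 1))..(Real.pi + (m - 1)), pull τ X (.inl i) t := by
  have h := (pull_continuous H hX (.inl i)).intervalIntegrable (μ := volume)
  rw [intervalIntegral.integral_add_adjacent_intervals (h _ _) (h _ _)]
  exact integral_alphaTurn_mul H.height_nonneg (intervalIntegrable_turn_mul H hX (.inl i))

lemma integral_turn_beta (H : Params k l m τ) (hb : 0 < b) (hX : ∀ i, Continuous (X i))
    (i : Fin l) :
    ∫ t in ((claspConfig k l m τ b c).lo (.inr (.inl i)))..
        ((claspConfig k l m τ b c).hi (.inr (.inl i))),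
        turn k l m τ (.inr (.inl i)) t * push τ X (.inr (.inl i)) t =
      ∫ t in (0 : ℝ)..betaAngle l τ, pull τ X (.inr (.inl i)) t :=
  integral_extTurn_mul (push_continuous H hX (.inr (.inl i))) H.betaAngle_nonneg hb.le
    (intervalIntegrable_turn_mul H hX (.inr (.inl i)))

lemma integral_turn_gamma (H : Params k l m τ) (hc : gammaArcEnd k l m τ < c)
    (hX : ∀ i, Continuous (X i)) (i : Fin m) :
    ∫ t in ((claspConfig k l m τ b c).lo (.inr (.inr i)))..
        ((claspConfig k l m τ b c).hi (.inr (.inr i))),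
        turn k l m τ (.inr (.inr i)) t * push τ X (.inr (.inr i)) t =
      ∫ t in (0 : ℝ)..gammaAngle m τ, pull τ X (.inr (.inr i)) t :=
  integral_extTurn_mul (push_continuous H hX (.inr (.inr i))) H.gammaAngle_nonneg
    (sub_nonneg.2 hc.le) (intervalIntegrable_turn_mul H hX (.inr (.inr i)))

lemma sum_archIdx (f : Fin k ⊕ Fin l ⊕ Fin m → ℝ) :
    ∑ j, f (archIdx k l m j) = ∑ i, f (.inl i) + ∑ i, f (.inr (.inl i)) := by
  rw [← Equiv.sum_comp finSumFinEquiv, Fintype.sum_sum_type]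
  simp [archIdx]

lemma integral_cos_lower {f : ℝ → ℝ} (hf : Continuous f) {x y h z C : ℝ} (hxy : x ≤ y)
    (hle : ∀ t ∈ Icc x y, 2 * Real.cos (t - h) * z + C ≤ f t) :
    2 * (Real.sin (y - h) - Real.sin (x - h)) * z + C * (y - x) ≤ ∫ t in x..y, f t := by
  have hc : Continuous fun t => 2 * Real.cos (t - h) * z := by fun_prop
  have e : ∫ t in x..y, (2 * Real.cos (t - h) * z + C) =
      2 * (Real.sin (y - h) - Real.sin (x - h)) * z + C * (y - x) := by
    rw [intervalIntegral.integral_add (hc.intervalIntegrable _ _) intervalIntegrable_const,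
      intervalIntegral.integral_mul_const, intervalIntegral.integral_const_mul,
      intervalIntegral.integral_comp_sub_right (fun t => Real.cos t), integral_cos,
      intervalIntegral.integral_const, smul_eq_mul]
    ring
  rw [← e]
  exact intervalIntegral.integral_mono_on hxy ((hc.add continuous_const).intervalIntegrable _ _)
    (hf.intervalIntegrable _ _) hle

lemma integral_add_const_le {f g : ℝ → ℝ} (hf : Continuous f) (hg : Continuous g) {x y C : ℝ}
    (hxy : x ≤ y) (hle : ∀ t ∈ Icc x y, f t + C ≤ g t) :
    (∫ t in x..y, f t) + C * (y - x) ≤ ∫ t in x..y, g t := by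
  have e : ∫ t in x..y, (f t + C) = (∫ t in x..y, f t) + C * (y - x) := by
    rw [intervalIntegral.integral_add (hf.intervalIntegrable _ _) intervalIntegrable_const,
      intervalIntegral.integral_const, smul_eq_mul, mul_comm C]
  rw [← e]
  exact intervalIntegral.integral_mono_on hxy ((hf.add continuous_const).intervalIntegrable _ _)
    (hg.intervalIntegrable _ _) hle

/-- The total force exerted across the clasp. -/
def claspForce (k l m : ℕ) (τ : ℝ) : ℝ :=
  2 * τ * ∫ r in (0 : ℝ)..1, claspDensity (τ / (k + l)) (τ / m) r

lemma claspForce_nonneg (hτ : 0 ≤ τ) : 0 ≤ claspForce k l m τ := by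
  refine mul_nonneg (by positivity) (intervalIntegral.integral_nonneg zero_le_one fun r _ => ?_)
  unfold claspDensity
  positivity

namespace Separating

/-- The substitutions produce the weights `1 / τ₁` and `1 / τ₂`; after multiplication by `τ` they
become `k + l` and `m`, so summing over all parallel copies gives exactly the right-hand side, up to
contributions of the offsets and of the circular part. -/
lemma integral_clasp_ge (hK : Separating k l m τ b c a X) (H : Params k l m τ) (hb : 0 < b)
    (hc : gammaArcEnd k l m τ < c) (hX : ∀ i, Continuous (X i)) (hn : 0 < k + l) (hm : 0 < m) :
    claspForce k l m τ * a ≤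
      (k + l) * (∫ t in (0 : ℝ)..Real.arcsin (τ / (k + l)), pull τ X (archIdx k l m ⟨0, hn⟩) t) +
        m * ∫ t in (0 : ℝ)..gammaAngle m τ, pull τ X (.inr (.inr ⟨0, hm⟩)) t := by
  have hP := H.clasp
  rcases H.nonneg.eq_or_lt with hτ | hτ
  · simp [claspForce, gammaAngle, ← hτ]
  have ha : 0 < τ / (k + l) := div_pos hτ H.n_pos
  have hm' : 0 < τ / m := div_pos hτ H.m_pos
  have key := clasp_integral_ge (a := a) ha hP.le_one hm' hP.symm.le_one
    (pull_continuous H hX (archIdx k l m ⟨0, hn⟩)) (pull_continuous H hX (.inr (.inr ⟨0, hm⟩)))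
    fun r hr => by
      have hu0 : 0 ≤ τ / (k + l) * r := mul_nonneg ha.le hr.1.le
      have hv0 : 0 ≤ τ / m * (1 - r) := mul_nonneg hm'.le (by linarith [hr.2])
      have hu1 : τ / (k + l) * r ≤ τ / (k + l) := by nlinarith [hr.2]
      have hv1 : τ / m * (1 - r) ≤ τ / m := by nlinarith [hr.1]
      have su := Real.sin_arcsin (by linarith) (hu1.trans hP.le_one)
      have sv := Real.sin_arcsin (by linarith) (hv1.trans hP.symm.le_one)
      have := hK.clasp_contact H hb hc hτ hn hm (Real.arcsin_nonneg.2 hu0)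
        (Real.monotone_arcsin hu1) (Real.arcsin_nonneg.2 hv0) (Real.monotone_arcsin hv1)
        (by rw [su, sv, mul_div_cancel_left₀ _ ha.ne'])
      rwa [su, sv, Real.cos_arcsin, Real.cos_arcsin] at this
  have := mul_le_mul_of_nonneg_left key hτ.le
  rw [mul_add, ← mul_div_assoc, ← mul_div_assoc, mul_div_right_comm, mul_div_right_comm,
    div_div_cancel₀ hτ.ne', div_div_cancel₀ hτ.ne'] at this
  rw [claspForce]
  refine le_trans (le_of_eq ?_) this
  ring

/-- Copy `j` is compared with the innermost curve on the whole range up to `Θ`. The innermost curve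
is the unit circle beyond the clasp arc, and `∫ cos` over that part gives `τ / l - τ / (k + l)`. The
clasp part is kept for `integral_clasp_ge`. -/
lemma integral_arch_ge (hK : Separating k l m τ b c a X) (H : Params k l m τ) (hb : 0 < b)
    (hc : gammaArcEnd k l m τ < c) (hX : ∀ i, Continuous (X i)) (hn : 0 < k + l) (hm : 0 < m)
    (j : Fin (k + l)) :
    (∫ t in (0 : ℝ)..Real.arcsin (τ / (k + l)), pull τ X (archIdx k l m ⟨0, hn⟩) t) +
        2 * (τ / l - τ / (k + l)) * X (.inr (.inr ⟨0, hm⟩)) 0 2 +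
        (2 * (betaAngle l τ - Real.arcsin (τ / (k + l))) + 2 * j * betaAngle l τ) * a ≤
      ∫ t in (0 : ℝ)..betaAngle l τ, pull τ X (archIdx k l m j) t := by
  have hP := H.clasp
  have hA : 0 ≤ Real.arcsin (τ / (k + l)) := Real.arcsin_nonneg.2 hP.nonneg
  have hi := (pull_continuous H hX (archIdx k l m ⟨0, hn⟩)).intervalIntegrable (μ := volume)
  have h1 := integral_add_const_le (pull_continuous H hX (archIdx k l m ⟨0, hn⟩))
    (pull_continuous H hX (archIdx k l m j)) (C := 2 * j * a) H.betaAngle_nonneg fun t ht => by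
      have ht' : |t| ≤ betaAngle l τ := by rw [abs_of_nonneg ht.1]; exact ht.2
      have := hK.push_archIdx H hb hn j ht'
      have := hK.push_archIdx H hb hn j (θ := -t) (by rwa [abs_neg])
      unfold pull
      linarith
  have h2 := integral_cos_lower (pull_continuous H hX (archIdx k l m ⟨0, hn⟩)) (h := 0)
    (C := 2 * a) (z := X (.inr (.inr ⟨0, hm⟩)) 0 2) H.arcsin_le_betaAngle fun t ht => by
      have ht0 : |t| = t := abs_of_nonneg (hA.trans ht.1)
      have := hK.pull_arch_circle H hb hc hn hm (θ := t) (by rw [ht0]; exact ht.2)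
        (by rw [ht0]; exact ht.1)
      rwa [sub_zero]
  rw [← intervalIntegral.integral_add_adjacent_intervals (hi _ (Real.arcsin (τ / (k + l))))
    (hi _ _)] at h1
  have s1 : Real.sin (betaAngle l τ) = τ / l := Real.sin_arcsin
    (by linarith [div_nonneg H.nonneg H.l_pos.le]) ((div_le_one H.l_pos).2 H.le_l)
  have s2 : Real.sin (Real.arcsin (τ / (k + l))) = τ / (k + l) :=
    Real.sin_arcsin (by linarith [hP.nonneg]) hP.le_one
  rw [sub_zero, sub_zero, s1, s2] at h2
  linarith

lemma integral_alpha_upper_ge (hK : Separating k l m τ b c a X) (H : Params k l m τ)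
    (hc : gammaArcEnd k l m τ < c) (hX : ∀ i, Continuous (X i)) (hm : 0 < m) (i : Fin k) :
    2 * (1 - τ / l) * X (.inr (.inr ⟨0, hm⟩)) 0 2 +
        2 * (i + 1) * (Real.pi / 2 - betaAngle l τ) * a ≤
      ∫ t in (betaAngle l τ)..(Real.pi / 2), pull τ X (.inl i) t := by
  have h2 := integral_cos_lower (pull_continuous H hX (.inl i)) (h := 0)
    (C := 2 * (i + 1) * a) (z := X (.inr (.inr ⟨0, hm⟩)) 0 2) H.betaAngle_le fun t ht => by
      have ht0 : |t| = t := abs_of_nonneg (H.betaAngle_nonneg.trans ht.1)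
      have := hK.pull_alpha_upper H hc hm i (θ := t) (by rw [ht0]; exact ht.2)
        (by rw [ht0]; exact H.arcsin_le_betaAngle.trans ht.1)
      rwa [sub_zero]
  have s1 : Real.sin (betaAngle l τ) = τ / l := Real.sin_arcsin
    (by linarith [div_nonneg H.nonneg H.l_pos.le]) ((div_le_one H.l_pos).2 H.le_l)
  rw [sub_zero, sub_zero, s1, Real.sin_pi_div_two] at h2
  linarith

lemma integral_alpha_lower_ge (hK : Separating k l m τ b c a X) (H : Params k l m τ)
    (hc : gammaArcEnd k l m τ < c) (hX : ∀ i, Continuous (X i)) (hm : 0 < m) (i : Fin k) :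
    -2 * X (.inr (.inr ⟨m - 1, by omega⟩)) 0 2 + (i + 1) * Real.pi * a ≤
      ∫ t in (Real.pi / 2 + (m - 1))..(Real.pi + (m - 1)), pull τ X (.inl i) t := by
  have h2 := integral_cos_lower (pull_continuous H hX (.inl i)) (h := m - 1)
    (x := Real.pi / 2 + (m - 1)) (y := Real.pi + (m - 1))
    (C := 2 * (i + 1) * a) (z := X (.inr (.inr ⟨m - 1, by omega⟩)) 0 2)
    (by linarith [Real.pi_pos]) fun t ht => hK.pull_alpha_lower H hc hm i ht.1 ht.2
  rw [add_sub_cancel_right, add_sub_cancel_right, Real.sin_pi_div_two, Real.sin_pi] at h2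
  linarith

lemma integral_gamma_ge (hK : Separating k l m τ b c a X) (H : Params k l m τ)
    (hc : gammaArcEnd k l m τ < c) (hX : ∀ i, Continuous (X i)) (hm : 0 < m) (i : Fin m) :
    (∫ t in (0 : ℝ)..gammaAngle m τ, pull τ X (.inr (.inr ⟨0, hm⟩)) t) +
        2 * i * gammaAngle m τ * a ≤
      ∫ t in (0 : ℝ)..gammaAngle m τ, pull τ X (.inr (.inr i)) t := by
  have h1 := integral_add_const_le (pull_continuous H hX (.inr (.inr ⟨0, hm⟩)))
    (pull_continuous H hX (.inr (.inr i))) (C := 2 * i * a) H.gammaAngle_nonneg fun t ht => by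
      have ht' : |t| ≤ gammaAngle m τ := by rw [abs_of_nonneg ht.1]; exact ht.2
      have := hK.push_gamma hc hm i ht'
      have := hK.push_gamma hc hm i (φ := -t) (by rwa [abs_neg])
      unfold pull
      linarith
  linarith

end Separating

/-- The rate at which a separating velocity field lengthens the link. -/
def totalForce (k l m : ℕ) (τ : ℝ) : ℝ :=
  claspForce k l m τ +
    ∑ j : Fin (k + l), (2 * (betaAngle l τ - Real.arcsin (τ / (k + l))) + 2 * j * betaAngle l τ) +
    ∑ i : Fin k, (2 * ((i : ℝ) + 1) * (Real.pi / 2 - betaAngle l τ) + (i + 1) * Real.pi) +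
    ∑ i : Fin m, 2 * (i : ℝ) * gammaAngle m τ + 2 * k * (m - 1)

lemma totalForce_nonneg (H : Params k l m τ) : 0 ≤ totalForce k l m τ := by
  have h1 := claspForce_nonneg (k := k) (l := l) (m := m) H.nonneg
  have h2 := H.betaAngle_nonneg
  have h3 := H.gammaAngle_nonneg
  have h4 := sub_nonneg.2 H.arcsin_le_betaAngle
  have h5 := sub_nonneg.2 H.betaAngle_le
  have h6 := H.height_nonneg
  have h7 := Real.pi_pos
  unfold totalForce
  positivity

/-- Force balance: the first variation of length, at a field with compatible ends, is bounded below
by the speed of separation. -/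
lemma Separating.totalForce_mul_le (hK : Separating k l m τ b c a X) (H : Params k l m τ)
    (hb : 0 < b) (hc : gammaArcEnd k l m τ < c) (hX : ∀ i, Continuous (X i)) :
    totalForce k l m τ * a ≤ ∑ i, ∫ t in ((claspConfig k l m τ b c).lo i)..
      ((claspConfig k l m τ b c).hi i), turn k l m τ i t * push τ X i t := by
  have hn : 0 < k + l := by have := H.one_le_l; omega
  have hm : 0 < m := H.one_le_m
  have e := sum_archIdx (k := k) (l := l) (m := m)
    fun i => ∫ t in (0 : ℝ)..betaAngle l τ, pull τ X i t
  have hA := Finset.sum_le_sum fun j (_ : j ∈ Finset.univ) =>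
    hK.integral_arch_ge H hb hc hX hn hm j
  have hU := Finset.sum_le_sum fun i (_ : i ∈ Finset.univ) =>
    hK.integral_alpha_upper_ge H hc hX hm i
  have hL := Finset.sum_le_sum fun i (_ : i ∈ Finset.univ) =>
    hK.integral_alpha_lower_ge H hc hX hm i
  have hG := Finset.sum_le_sum fun i (_ : i ∈ Finset.univ) =>
    hK.integral_gamma_ge H hc hX hm i
  have hC := hK.integral_clasp_ge H hb hc hX hn hm
  have hZ := hK.height_gamma H hc hm
  rw [Fintype.sum_sum_type, Fintype.sum_sum_type]
  simp only [integral_turn_alpha H hX, integral_turn_beta H hb hX, integral_turn_gamma H hc hX]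
  simp only [Finset.sum_add_distrib, Finset.sum_const, Finset.card_univ, Fintype.card_fin,
    nsmul_eq_mul, ← Finset.sum_mul] at hA hU hL hG e ⊢
  push_cast at hA
  unfold totalForce
  simp only [Finset.sum_add_distrib, Finset.sum_const, Finset.card_univ, Fintype.card_fin,
    nsmul_eq_mul, ← Finset.sum_mul]
  push_cast
  have hZ' := mul_le_mul_of_nonneg_left hZ (show (0 : ℝ) ≤ 2 * k by positivity)
  -- Vertical equilibrium at the innermost tip: the circular parts of all `k + l` curves up to `Θ`
  -- and of the `k` closed ones beyond `Θ` load it with `2 * k`. This matches the lower semicircles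
  -- and is the reason for `sin Θ = τ / l`.
  have hlin : ((k : ℝ) + l) * (2 * (τ / l - τ / (k + l))) + k * (2 * (1 - τ / l)) = 2 * k := by
    have := H.l_pos
    have := H.n_pos
    field_simp
    ring
  have hlin' := congrArg (fun x => x * X (.inr (.inr ⟨0, hm⟩)) 0 2) hlin
  simp only at hlin'
  linarith

end

section
variable {k l m : ℕ} {τ b c : ℝ}

/-! ### Strong criticality -/

/-- The ends of the components do not contribute to the first variation of length. -/
lemma inner_tangentVec_ends (H : Params k l m τ) (hb : 0 < b) (hc : gammaArcEnd k l m τ < c)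
    {ξ : (claspConfig k l m τ b c).VF} (hξ : (claspConfig k l m τ b c).Compatible ξ)
    (i : Fin k ⊕ Fin l ⊕ Fin m) (s t : (claspConfig k l m τ b c).dom i)
    (hs : (s : ℝ) = (claspConfig k l m τ b c).lo i)
    (ht : (t : ℝ) = (claspConfig k l m τ b c).hi i) :
    inner ℝ (tangentVec k l m τ i ((claspConfig k l m τ b c).hi i)) (ξ i t) -
      inner ℝ (tangentVec k l m τ i ((claspConfig k l m τ b c).lo i)) (ξ i s) = 0 := by
  obtain ⟨h1, h2⟩ := hξ i
  rcases i with i | i | i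
  -- A closed component has the same tangent at the normal angles `π` and `-π`. For the arcs the end
  -- tangents are, up to sign, the normals of the constraint planes.
  · rw [h1 trivial s t hs ht]
    simp only [tangentVec, claspConfig, angle, emb]
    rw [alphaAngle_neg, alphaAngle_end H.height_nonneg]
    simp [tng]
  · obtain ⟨h3, h4⟩ := h2 id
    have h5 := direction_plane (h3 s hs)
    have h6 := direction_plane (h4 t ht)
    rw [betaNormal_false, map_neg, inner_neg_left, neg_eq_zero] at h5
    rw [betaNormal_true] at h6
    have e1 : tangentVec k l m τ (.inr (.inl i)) ((claspConfig k l m τ b c).hi (.inr (.inl i))) =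
        embP₁ (tng (betaAngle l τ)) := by
      simp only [tangentVec, claspConfig, angle, emb]
      rw [trunc_of_ge H.betaAngle_nonneg (by linarith)]
    have e2 : tangentVec k l m τ (.inr (.inl i)) ((claspConfig k l m τ b c).lo (.inr (.inl i))) =
        embP₁ (tng (-betaAngle l τ)) := by
      simp only [tangentVec, claspConfig, angle, emb]
      rw [trunc_neg H.betaAngle_nonneg, trunc_of_ge H.betaAngle_nonneg (by linarith)]
    rw [e1, e2, h5, h6, sub_zero]
  · obtain ⟨h3, h4⟩ := h2 id
    have h5 := direction_plane (h3 s hs)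
    have h6 := direction_plane (h4 t ht)
    rw [gammaNormal_false, map_neg, inner_neg_left, neg_eq_zero] at h5
    rw [gammaNormal_true] at h6
    have e1 : tangentVec k l m τ (.inr (.inr i)) ((claspConfig k l m τ b c).hi (.inr (.inr i))) =
        embP₂ (tng (gammaAngle m τ)) := by
      simp only [tangentVec, claspConfig, angle, emb]
      rw [trunc_of_ge H.gammaAngle_nonneg (by linarith)]
    have e2 : tangentVec k l m τ (.inr (.inr i)) ((claspConfig k l m τ b c).lo (.inr (.inr i))) =
        embP₂ (tng (-gammaAngle m τ)) := by
      simp only [tangentVec, claspConfig, angle, emb]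
      rw [trunc_neg H.gammaAngle_nonneg, trunc_of_ge H.gammaAngle_nonneg (by linarith)]
    rw [e1, e2, h5, h6, sub_zero]

theorem stronglyCritical_claspConfig (H : Params k l m τ) (hb : 0 < b)
    (hc : gammaArcEnd k l m τ < c) :
    (claspConfig k l m τ b c).StronglyCritical (fun _ => 1) := by
  have hn : 0 < k + l := by have := H.one_le_l; omega
  have hlh := claspConfig_lo_lt_hi H hb hc
  obtain ⟨D, hD, hDξ⟩ := exists_isFirstVariationLen H fun i => (hlh i).le
  have hM := totalForce_nonneg H
  -- From `M ≥ 0` and `M * a ≤ -1` it follows that `a < 0`, hence `(M + 1) * a ≤ -1`; the `+ 1`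
  -- makes positivity of `ε` immediate.
  refine ⟨D, hD, 1 / (totalForce k l m τ + 1), by positivity, fun ξ hξ hD1 => ?_⟩
  have hne : ∀ i, ((claspConfig k l m τ b c).dom i).Nonempty := fun i => nonempty_Icc.2 (hlh i).le
  obtain ⟨a, ha, hK⟩ := (claspConfig k l m τ b c).exists_hasDerivWithinAt_gThi
    (curve_continuous H) (fun i j hij s hs t ht => one_le_dist_claspConfig H hij hs ht)
    (archIdx_ne_gamma ⟨0, hn⟩ ⟨0, H.one_le_m⟩) (hne _) (hne _) ξ
  obtain ⟨a', ha'⟩ := (claspConfig k l m τ b c).exists_hasDerivWithinAt_obstMin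
    (curve_continuous H) (fun j => by rcases j with e | e <;> exact ⟨_, _, fun p => rfl⟩)
    (hne (archIdx k l m ⟨0, hn⟩)) ξ
  refine ⟨a, a', ha, ha', (min_le_left _ _).trans ?_⟩
  have hS : Separating k l m τ b c a (extField (fun i => (hlh i).le) ξ) := by
    intro i j hij s hs t ht hst
    rw [extField_of_mem _ _ hs, extField_of_mem _ _ ht]
    exact hK i j hij ⟨s, hs⟩ ⟨t, ht⟩ hst
  have key := hS.totalForce_mul_le H hb hc (extField_continuous (fun i => (hlh i).le) ξ)
  rw [hDξ] at hD1
  rw [Finset.sum_congr rfl fun i _ => by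
    rw [inner_tangentVec_ends H hb hc hξ i ⟨_, left_mem_Icc.2 (hlh i).le⟩
      ⟨_, right_mem_Icc.2 (hlh i).le⟩ rfl rfl, zero_add]] at hD1
  have key' : totalForce k l m τ * a ≤ -1 := key.trans_eq hD1
  rw [le_neg, div_le_iff₀ (by positivity)]
  nlinarith

end

section
variable {k l m : ℕ} {τ b c : ℝ}

/-! ### Planes far enough out -/

/-- Tangent extensions stay on the inner side of the planes through their ends. -/
lemma dot_tangentExt_le {A : ℝ → ℝ × ℝ} {Θ d r t : ℝ} (h0 : 0 ≤ Θ) (h1 : Θ ≤ Real.pi / 2)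
    (hA : ∀ θ, A (-θ) = (-(A θ).1, (A θ).2)) (hx : 0 ≤ (A Θ).1) (hd : 0 ≤ d) (ht : |t| ≤ Θ + r)
    (hmid : |t| ≤ Θ → dot (A t + d • nrm t) (tng Θ) ≤ dot (A Θ) (tng Θ) + r) :
    dot (tangentExt A Θ t + d • nrm (trunc Θ t)) (tng Θ) ≤ dot (A Θ) (tng Θ) + r := by
  have hc : 0 ≤ Real.cos Θ := Real.cos_nonneg_of_mem_Icc ⟨by linarith [Real.pi_pos], h1⟩
  have hs : 0 ≤ Real.sin Θ := Real.sin_nonneg_of_nonneg_of_le_pi h0 (by linarith [Real.pi_pos])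
  have hcs := Real.sin_sq_add_cos_sq Θ
  rcases le_total |t| Θ with h | h
  · rw [tangentExt, trunc_of_abs_le h]
    simpa using hmid h
  rw [tangentExt]
  rcases le_total 0 t with h2 | h2
  · rw [abs_of_nonneg h2] at h ht
    rw [trunc_of_ge h0 h]
    simp only [dot_add_left, dot_smul_left, dot_nrm_tng, dot_tng_tng]
    simp
    linarith
  · rw [abs_of_nonpos h2] at h ht
    -- The opposite straight end has inner product `-cos (2 * Θ)` with the plane normal, so it
    -- approaches the plane no faster than the proper end; its starting point is no closer since `(A
    -- Θ).1 ≥ 0`.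
    have e : trunc Θ t = -Θ := by
      rw [← neg_neg t, trunc_neg h0, trunc_of_ge h0 h]
    rw [e, hA]
    simp only [dot, tng, nrm, Prod.smul_mk, smul_eq_mul, Prod.fst_add, Prod.snd_add, Real.sin_neg,
      Real.cos_neg]
    have e1 := mul_nonneg hx hc
    have e2 := mul_nonneg hd (mul_nonneg hs hc)
    have e3 : 0 ≤ (-t - Θ) * Real.cos Θ ^ 2 := mul_nonneg (by linarith) (sq_nonneg _)
    have e4 : (-t - Θ) * (Real.sin Θ ^ 2 + Real.cos Θ ^ 2) = -t - Θ := by rw [hcs, mul_one]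
    nlinarith

lemma dot_tangentExt_le' {A : ℝ → ℝ × ℝ} {Θ d r t : ℝ} (h0 : 0 ≤ Θ) (h1 : Θ ≤ Real.pi / 2)
    (hA : ∀ θ, A (-θ) = (-(A θ).1, (A θ).2)) (hx : 0 ≤ (A Θ).1) (hd : 0 ≤ d) (ht : |t| ≤ Θ + r)
    (hmid : |t| ≤ Θ → dot (A t + d • nrm t) (-tng (-Θ)) ≤ dot (A Θ) (tng Θ) + r) :
    dot (tangentExt A Θ t + d • nrm (trunc Θ t)) (-tng (-Θ)) ≤ dot (A Θ) (tng Θ) + r := by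
  have key : ∀ (A : ℝ × ℝ) (θ : ℝ), dot ((-A.1, A.2) + d • nrm (-θ)) (tng Θ) =
      dot (A + d • nrm θ) (-tng (-Θ)) := fun A θ => by
    simp [dot, nrm, tng]
    ring
  have := dot_tangentExt_le (t := -t) h0 h1 hA hx hd (by rwa [abs_neg]) fun h => by
    rw [abs_neg] at h
    rw [hA, key]
    exact hmid h
  rwa [tangentExt_neg h0 hA, trunc_neg h0, key] at this

/-- The size of the part of a component that does not depend on the bounding planes. -/
def coreBound (l m : ℕ) (τ : ℝ) : Fin k ⊕ Fin l ⊕ Fin m → ℝ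
  | .inl _ => Real.pi + (m - 1)
  | .inr (.inl _) => betaAngle l τ
  | .inr (.inr _) => gammaAngle m τ

lemma exists_norm_core_le (H : Params k l m τ) : ∃ C : ℝ, 0 ≤ C ∧
    ∀ (b c : ℝ) (i : Fin k ⊕ Fin l ⊕ Fin m) (t : ℝ), |t| ≤ coreBound l m τ i →
      ‖(claspConfig k l m τ b c).curve i t‖ ≤ C := by
  have h : ∀ i : Fin k ⊕ Fin l ⊕ Fin m, ∃ C, ∀ t ∈ Icc (-coreBound l m τ i) (coreBound l m τ i),
      -- The curves as functions on the line do not depend on `b` and `c`; only their parameter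
      -- intervals do. So the bound for `b = c = 0` serves all planes.
      ‖(claspConfig k l m τ 0 0).curve i t‖ ≤ C := fun i =>
    isCompact_Icc.exists_bound_of_continuousOn (curve_continuous H i).continuousOn
  choose C hC using h
  refine ⟨∑ i, |C i|, Finset.sum_nonneg fun i _ => abs_nonneg _, fun b c i t ht => ?_⟩
  refine (hC i t (abs_le.1 ht)).trans ((le_abs_self _).trans ?_)
  exact Finset.single_le_sum (f := fun i => |C i|) (fun i _ => abs_nonneg _) (Finset.mem_univ i)

lemma inner_le_of_norm_le {ν p : E3} {C : ℝ} (hν : ‖ν‖ = 1) (hp : ‖p‖ ≤ C) : inner ℝ ν p ≤ C :=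
  (real_inner_le_norm ν p).trans (by rwa [hν, one_mul])

/-- The straight ends of the `β`'s descend, so their height is bounded by that of the arcs,
independently of `b`. This keeps arbitrarily long ends below the `γ` planes. -/
lemma beta_height_le {C : ℝ} (H : Params k l m τ)
    (hC : ∀ (i : Fin l) (t : ℝ), |t| ≤ betaAngle l τ →
      ‖(claspConfig k l m τ b c).curve (.inr (.inl i)) t‖ ≤ C) (i : Fin l) (t : ℝ) :
    (base k l m τ (.inr (.inl i)) t + depth k l m (.inr (.inl i)) •
      nrm (angle k l m τ (.inr (.inl i)) t)).2 ≤ C := by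
  have hθ := abs_trunc_le (t := t) H.betaAngle_nonneg
  have h1 := sub_trunc_mul_sin_nonneg (t := t) H.betaAngle_nonneg H.betaAngle_le
  have h2 := inner_le_of_norm_le (ν := embP₁ (nrm 0)) (IsPlane.norm_nrm inner_embP₁ 0)
    (hC i _ hθ)
  rw [claspConfig_curve] at h2
  simp only [emb, inner_embP₁, base, angle, tangentExt, trunc_of_abs_le hθ] at h2 ⊢
  simp [dot, nrm, tng] at h2 ⊢
  linarith

theorem exists_planesFarEnough (H : Params k l m τ) :
    ∃ R : ℝ, ∀ b c : ℝ, R ≤ b → R ≤ c → PlanesFarEnough k l m τ b c := by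
  obtain ⟨C, hC0, hC⟩ := exists_norm_core_le H
  have hm := H.height_nonneg
  -- `C` bounds the arcs and closed components, and also the height of the `β`'s against the `γ`
  -- planes; `m` exceeds the reflected height of the `γ`'s against the `β` planes; `1` and
  -- `gammaArcEnd k l m τ + 1` give the straight ends positive length.
  refine ⟨max (max 1 C) (max m (gammaArcEnd k l m τ + 1)), fun b c hb hc => ?_⟩
  simp only [max_le_iff] at hb hc
  obtain ⟨⟨hb1, hbC⟩, hbm, -⟩ := hb
  obtain ⟨⟨hc1, hcC⟩, -, hcg⟩ := hc
  have hsΘ : 0 ≤ Real.sin (betaAngle l τ) := Real.sin_nonneg_of_nonneg_of_le_pi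
    H.betaAngle_nonneg (by linarith [Real.pi_pos, H.betaAngle_le])
  have hsΦ : 0 ≤ Real.sin (gammaAngle m τ) := Real.sin_nonneg_of_nonneg_of_le_pi
    H.gammaAngle_nonneg (by linarith [Real.pi_pos, H.gammaAngle_le])
  refine ⟨by linarith, by linarith, fun j i s hs => ?_⟩
  have hcore := hC b c i s
  have hlo : (claspConfig k l m τ b c).lo i = -(claspConfig k l m τ b c).hi i := by
    rcases i with i | i | i <;> rfl
  rw [GenLink.dom, hlo] at hs
  replace hs := abs_le.2 hs
  rcases i with i | i | i
  · have h := hcore hs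
    rcases j with e | e
    · exact sub_nonneg.2 ((inner_le_of_norm_le (norm_betaNormal _ e) h).trans hbC)
    · exact sub_nonneg.2 ((inner_le_of_norm_le (norm_gammaNormal _ e) h).trans hcC)
  · have hx : 0 ≤ (archBase (τ / (k + l)) (τ / m) (betaAngle l τ)).1 := by
      rw [archBase_betaAngle H]; exact hsΘ
    rcases j with e | e
    · refine sub_nonneg.2 ?_
      have hmid := fun h => (inner_le_of_norm_le (norm_betaNormal (betaAngle l τ) e)
        (hcore h)).trans hbC
      rw [real_inner_comm, claspConfig_curve] at hmid ⊢
      have hq := dot_archBase_tng H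
      simp only [coreBound] at hmid
      cases e
      · rw [betaNormal_false] at hmid ⊢
        simp only [emb, inner_embP₁, base, angle, depth] at hmid ⊢
        refine (dot_tangentExt_le' (r := b) H.betaAngle_nonneg H.betaAngle_le
          (fun _ => archBase_neg) hx (by positivity) hs fun h => ?_).trans_eq (by rw [hq, zero_add])
        have := hmid h
        rw [tangentExt, trunc_of_abs_le h] at this
        simpa [hq] using this
      · rw [betaNormal_true] at hmid ⊢
        simp only [emb, inner_embP₁, base, angle, depth] at hmid ⊢
        refine (dot_tangentExt_le (r := b) H.betaAngle_nonneg H.betaAngle_le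
          (fun _ => archBase_neg) hx (by positivity) hs fun h => ?_).trans_eq (by rw [hq, zero_add])
        have := hmid h
        rw [tangentExt, trunc_of_abs_le h] at this
        simpa [hq] using this
    · have h := beta_height_le H (fun i t => hC b c (.inr (.inl i)) t) i s
      refine sub_nonneg.2 (le_trans ?_ hcC)
      rw [claspConfig_curve]
      simp only [emb]
      generalize base k l m τ (.inr (.inl i)) s + depth k l m (.inr (.inl i)) •
        nrm (angle k l m τ (.inr (.inl i)) s) = p at h ⊢
      have e : inner ℝ (gammaNormal (gammaAngle m τ) e) (embP₁ p) =
          Real.sin (gammaAngle m τ) * p.2 := by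
        simp [inner_E3, embP₁_apply, gammaNormal]
      rw [e]
      nlinarith [Real.sin_le_one (gammaAngle m τ)]
  · have hx : 0 ≤ (claspArc (τ / m) (τ / (k + l)) (gammaAngle m τ)).1 := by
      exact mul_nonneg hsΦ (Real.sqrt_nonneg _)
    rcases j with e | e
    · have h := gamma_height_le H i s
      refine sub_nonneg.2 ?_
      rw [claspConfig_curve]
      simp only [emb]
      generalize base k l m τ (.inr (.inr i)) s + depth k l m (.inr (.inr i)) •
        nrm (angle k l m τ (.inr (.inr i)) s) = p at h ⊢
      have e : inner ℝ (betaNormal (betaAngle l τ) e) (embP₂ p) =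
          Real.sin (betaAngle l τ) * p.2 := by
        simp [inner_E3, embP₂_apply, betaNormal]
      rw [e]
      nlinarith [Real.sin_le_one (betaAngle l τ)]
    · refine sub_nonneg.2 ?_
      have hmid := fun h => (inner_le_of_norm_le (norm_gammaNormal (gammaAngle m τ) e)
        (hcore h)).trans hcC
      rw [real_inner_comm, claspConfig_curve] at hmid ⊢
      have hq := dot_claspArc_tng (k := k) (l := l) (m := m) (τ := τ)
      simp only [coreBound] at hmid
      cases e
      · rw [gammaNormal_false] at hmid ⊢
        simp only [emb, inner_embP₂, base, angle, depth] at hmid ⊢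
        refine (dot_tangentExt_le' (r := c - gammaArcEnd k l m τ) H.gammaAngle_nonneg
          H.gammaAngle_le (fun _ => claspArc_neg) hx (by positivity) hs fun h => ?_).trans_eq
          (by rw [hq]; ring)
        have := hmid h
        rw [tangentExt, trunc_of_abs_le h] at this
        simpa [hq] using this
      · rw [gammaNormal_true] at hmid ⊢
        simp only [emb, inner_embP₂, base, angle, depth] at hmid ⊢
        refine (dot_tangentExt_le (r := c - gammaArcEnd k l m τ) H.gammaAngle_nonneg
          H.gammaAngle_le (fun _ => claspArc_neg) hx (by positivity) hs fun h => ?_).trans_eq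
          (by rw [hq]; ring)
        have := hmid h
        rw [tangentExt, trunc_of_abs_le h] at this
        simpa [hq] using this

end

end Ropelength
end

theorem theorem4p1 (k l m : ℕ) (hl : 1 ≤ l) (hm : 1 ≤ m) (τ : ℝ) (hτ : 0 ≤ τ)
    (hτl : τ ≤ l) (hτm : τ ≤ m) :
    (∃ R : ℝ, ∀ b c : ℝ, R ≤ b → R ≤ c → Ropelength.PlanesFarEnough k l m τ b c) ∧
    ∀ b c : ℝ, Ropelength.PlanesFarEnough k l m τ b c →
      (Ropelength.claspConfig k l m τ b c).IsGeneralizedLink ∧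
      (Ropelength.claspConfig k l m τ b c).gThi (Ropelength.claspConfig k l m τ b c).pos = 1 ∧
      (Ropelength.claspConfig k l m τ b c).StronglyCritical (fun _ => 1) := by
  have H : Ropelength.Params k l m τ := ⟨hl, hm, hτ, hτl, hτm⟩
  exact ⟨Ropelength.exists_planesFarEnough H, fun b c h =>
    ⟨Ropelength.isGeneralizedLink_claspConfig H h, Ropelength.gThi_claspConfig H h.1 h.2.1,
      Ropelength.stronglyCritical_claspConfig H h.1 h.2.1⟩⟩
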